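/- **Setting.** Let $n\ge 1$, write $(t,x)\in\mathbb R\times\mathbb R^n$, $(\tau,\xi)$ for the dual variables, $D=-i\partial$, $D_1=D_t$, and let $p(y,hD)$ denote the standard (left) semiclassical quantization. A function $f(y,\eta)$ is a symbol of order $m$ if it is smooth and each of its derivatives is bounded by a constant times $(1+|\eta|)^m$. Let $q_{jk}(t,x,\xi)=q_{kj}(t,x,\xi)$, $1\le j,k\le n$, be real-valued symbols of order $0$ such that the quadratic form with matrix $(q_{jk}(0,0,0))$ is non-degenerate, let $b(t,x,\tau,\xi)$ be a complex-valued symbol of order $1$, and let $P(h)$ be the operator with symbol $$p=\tau\Bigl(\tau+\sum_{j,k}q_{jk}(t,x,\xi)\xi_j\xi_k\Bigr)+h\,b(t,x,\tau,\xi).$$ For $\beta>0$ and a fixed covector $\xi\in\mathbb R^n$ put $\alpha=1-4\beta$, $\gamma=3\beta$, $b_h(t)=b(t,0,0,h^\beta\xi)$, $$q_0(t)=\sum_{j,k}q_{jk}(t,0,0)\xi_j\xi_k,\quad q_1(t,D_x)=\sum_{j,k}q_{jk}(t,0,0)\xi_jD_k,\quad q_2(t,D_x)=\sum_{j,k}q_{jk}(t,0,0)D_jD_k,$$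 $$T_ha=h^{-2\beta}b_h(t)a+q_0(t)D_1a+h^{1-2\beta}D_1^2a+2h^{1-4\beta}q_1(t,D_x)D_1a+h^{2(1-4\beta)}q_2(t,D_x)D_1a .$$ Let $P_\gamma(h)$ be $P(h)$ in the scaled variables, i.e. $(P_\gamma(h)v)(t,x)=(P(h)w)(t,h^{\gamma}x)$ with $w(t,x)=v(t,h^{-\gamma}x)$. **Proposition 3.3.** 0. There are $\xi\in\mathbb R^n$ and $\delta>0$ such that $q_0(t)\ne0$ for $|t|\le\delta$. 1. (Transport system.) Let $0<\beta\le 1/6$ and $\xi\in\mathbb R^n$. For every family $(a_h)_{0<h\le1}$ of smooth functions on $\mathbb R^{1+n}$ with supports in one compact set and all derivatives bounded uniformly in $h$, $$e^{-ix\cdot\xi/h^\alpha}P_\gamma(h)\bigl(e^{ix\cdot\xi/h^\alpha}a_h\bigr)=h^{1+2\beta}\bigl(T_ha_h+\mathcal O(h^\beta)\bigr),\qquad 0<h\le1,$$ where the remainder is $\mathcal O(h^\beta)$ both uniformly on $\mathbb R^{1+n}$ and in $L^2(\mathbb R^{1+n})$. 2. (Solution formula.) Let $0<\beta\le1/7$,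 $\xi\in\mathbb R^n$, let $q_0\neq0$ on an interval $[t_1,t_2]$, let $t_0\in[t_1,t_2]$ and $\phi\in C_c^\infty(\mathbb R^n)$. Then $$a(t,x)=\phi(x)\,e^{-ih^{-2\beta}\int_{t_0}^t b_h(s)/q_0(s)\,ds}$$ satisfies, for $t_1<t<t_2$, $x\in\mathbb R^n$, $0<h\le1$, $$h^{-2\beta}b_h(t)a+q_0(t)D_1a=0,\qquad |T_ha(t,x)|\le C\,h^\beta\,\Bigl|e^{-ih^{-2\beta}\int_{t_0}^t b_h(s)/q_0(s)\,ds}\Bigr|,$$ with $C$ independent of $t,x,h$. 3. (Quasimodes.) Let $\xi\in\mathbb R^n$ and $t_1<t_2$ be such that $q_0\ne0$ on $[t_1,t_2]$ and $t\mapsto \operatorname{Im}b(t,0,0,0)/q_0(t)$ is positive at $t_1$ and negative at $t_2$. Then for all $\varepsilon>0$ and $N\in\mathbb N$ there are $C$, $h_0>0$ and functions $u(h)\in C_c^\infty(\mathbb R^{1+n})$, $0<h<h_0$, supported in $[t_1,t_2]\times\{|x|\le\varepsilon\}$, with $\|u(h)\|_{L^2}=1$ and $\|P(h)u(h)\|_{L^2}\le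 C h^N$. -/

import Mathlib

open MeasureTheory Set FourierTransform
open scoped ContDiff

namespace TangentialQuasimode

noncomputable section

/-- The space `ℝⁿ` of the variables `x` (and of the dual variables `ξ`). -/
abbrev X (n : ℕ) := EuclideanSpace ℝ (Fin n)

/-- The Euclidean space `ℝ × ℝⁿ` of the points `(t, x)` (and of the covectors `(τ, ξ)`). -/
abbrev E (n : ℕ) := WithLp 2 (ℝ × X n)

/-- The point `(t, x)`, or the covector `(τ, ξ)`. -/
def pt {n : ℕ} (t : ℝ) (x : X n) : E n := WithLp.toLp 2 (t, x)

/-- The symbol class `S(⟨η⟩ᵐ)`: smooth functions `f (y, η)`, all of whose derivatives in `(y, η)`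
are bounded by a constant times `(1 + |η|)ᵐ`. -/
def IsSymbol {V W F : Type*} [NormedAddCommGroup V] [NormedSpace ℝ V]
    [NormedAddCommGroup W] [NormedSpace ℝ W] [NormedAddCommGroup F] [NormedSpace ℝ F]
    (m : ℕ) (f : V → W → F) : Prop :=
  ContDiff ℝ ∞ (fun z : V × W => f z.1 z.2) ∧
    ∀ k : ℕ, ∃ C : ℝ, ∀ (y : V) (η : W),
      ‖iteratedFDeriv ℝ k (fun z : V × W => f z.1 z.2) (y, η)‖ ≤ C * (1 + ‖η‖) ^ m

/-- The standard semiclassical quantization `p(y, hD)`, where `D = -i∂`: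
`(p(y, hD) u)(y) = (2π)⁻ᵈ ∫ e^{i y·η} p(y, hη) (∫ e^{-i z·η} u(z) dz) dη`,
written with the Fourier transform `∫ e^{-2π i z·ζ} u(z) dz`, that is with `η = 2πζ`. -/
def opH {n : ℕ} (p : E n → E n → ℂ) (h : ℝ) (u : E n → ℂ) (y : E n) : ℂ :=
  ∫ ζ : E n, Complex.exp (Complex.I * ((2 * Real.pi * inner ℝ y ζ : ℝ) : ℂ)) *
    p y ((2 * Real.pi * h) • ζ) * 𝓕 u ζ

/-- The symbol `τ (τ + ∑ q_{jk}(t, x, ξ) ξ_j ξ_k) + h b(t, x, τ, ξ)`. -/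
def fullSymbol {n : ℕ} (q : Fin n → Fin n → E n → X n → ℝ) (b : E n → E n → ℂ) (h : ℝ)
    (y η : E n) : ℂ :=
  ((η.fst * (η.fst + ∑ j, ∑ k, q j k y η.snd * η.snd j * η.snd k) : ℝ) : ℂ) + (h : ℂ) * b y η

/-- The operator `P(h)` with this symbol. -/
def opP {n : ℕ} (q : Fin n → Fin n → E n → X n → ℝ) (b : E n → E n → ℂ) (h : ℝ)
    (u : E n → ℂ) : E n → ℂ :=
  opH (fullSymbol q b h) h u

/-- The dilation `(t, x) ↦ (t, r x)`. -/
def dil {n : ℕ} (r : ℝ) (y : E n) : E n := pt y.fst (r • y.snd)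

/-- The operator `P(h)` in the scaled variables, in which `(x, hD_x)` has become
`(h^γ x, h^{1-γ} D_x)` and `t` is unchanged. -/
def scaledP {n : ℕ} (q : Fin n → Fin n → E n → X n → ℝ) (b : E n → E n → ℂ) (γ h : ℝ)
    (v : E n → ℂ) (y : E n) : ℂ :=
  opP q b h (fun z => v (dil (h ^ (-γ)) z)) (dil (h ^ γ) y)

/-- The oscillating factor `e^{i x·ξ / h^α}`. -/
def osc {n : ℕ} (α : ℝ) (ξ : X n) (h : ℝ) (y : E n) : ℂ :=
  Complex.exp (Complex.I * ((inner ℝ y.snd ξ / h ^ α : ℝ) : ℂ))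

/-- The conjugated scaled operator `e^{-i x·ξ / h^α} P(h) (e^{i x·ξ / h^α} a)`, with the parameters
`α = 1 - 4β` and `γ = 3β`. -/
def conjP {n : ℕ} (q : Fin n → Fin n → E n → X n → ℝ) (b : E n → E n → ℂ) (β : ℝ) (ξ : X n)
    (h : ℝ) (a : E n → ℂ) (y : E n) : ℂ :=
  (osc (1 - 4 * β) ξ h y)⁻¹ *
    scaledP q b (3 * β) h (fun z => osc (1 - 4 * β) ξ h z * a z) y

/-- `D₁ = -i ∂_t`. -/
def Dt {n : ℕ} (a : E n → ℂ) (y : E n) : ℂ := -Complex.I * fderiv ℝ a y (pt 1 0)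

/-- `D_j = -i ∂_{x_j}`. -/
def Dx {n : ℕ} (j : Fin n) (a : E n → ℂ) (y : E n) : ℂ :=
  -Complex.I * fderiv ℝ a y (pt 0 (EuclideanSpace.single j 1))

/-- `q₀(t) = ∑ q_{jk}(t, 0, 0) ξ_j ξ_k`. -/
def q0 {n : ℕ} (q : Fin n → Fin n → E n → X n → ℝ) (ξ : X n) (t : ℝ) : ℝ :=
  ∑ j, ∑ k, q j k (pt t 0) 0 * ξ j * ξ k

/-- `q₁(t, D_x) = ∑ q_{jk}(t, 0, 0) ξ_j D_k`. -/
def q1 {n : ℕ} (q : Fin n → Fin n → E n → X n → ℝ) (ξ : X n) (a : E n → ℂ) (y : E n) : ℂ :=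
  ∑ j, ∑ k, ((q j k (pt y.fst 0) 0 * ξ j : ℝ) : ℂ) * Dx k a y

/-- `q₂(t, D_x) = ∑ q_{jk}(t, 0, 0) D_j D_k`. -/
def q2 {n : ℕ} (q : Fin n → Fin n → E n → X n → ℝ) (a : E n → ℂ) (y : E n) : ℂ :=
  ∑ j, ∑ k, (q j k (pt y.fst 0) 0 : ℂ) * Dx j (Dx k a) y

/-- `b_h(t) = b(t, 0, 0, h^β ξ)`. -/
def bh {n : ℕ} (b : E n → E n → ℂ) (β : ℝ) (ξ : X n) (h t : ℝ) : ℂ :=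
  b (pt t 0) (pt 0 (h ^ β • ξ))

/-- The transport expression
`h^{-2β} b_h(t) a + q₀(t) D₁a + h^{1-2β} D₁²a + 2 h^{1-4β} q₁(t, D_x) D₁a
  + h^{2(1-4β)} q₂(t, D_x) D₁a`. -/
def transport {n : ℕ} (q : Fin n → Fin n → E n → X n → ℝ) (b : E n → E n → ℂ) (β : ℝ) (ξ : X n)
    (h : ℝ) (a : E n → ℂ) (y : E n) : ℂ :=
  ((h ^ (-2 * β) : ℝ) : ℂ) * bh b β ξ h y.fst * a y
    + (q0 q ξ y.fst : ℂ) * Dt a y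
    + ((h ^ (1 - 2 * β) : ℝ) : ℂ) * Dt (Dt a) y
    + ((2 * h ^ (1 - 4 * β) : ℝ) : ℂ) * q1 q ξ (Dt a) y
    + ((h ^ (2 * (1 - 4 * β)) : ℝ) : ℂ) * q2 q (Dt a) y

/-- The exponential `e^{-i h^{-2β} ∫_{t₀}^t b_h(s) / q₀(s) ds}`. -/
def expFactor {n : ℕ} (q : Fin n → Fin n → E n → X n → ℝ) (b : E n → E n → ℂ) (β : ℝ) (ξ : X n)
    (t₀ h t : ℝ) : ℂ :=
  Complex.exp (-Complex.I * ((h ^ (-2 * β) : ℝ) : ℂ) *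
    ∫ s in t₀..t, bh b β ξ h s / (q0 q ξ s : ℂ))

/-- Families `(a_h)`, `0 < h ≤ 1`, that are bounded in `C_c^∞`: the supports lie in one compact set
and every derivative is bounded uniformly in `h`. -/
def BoundedFamily {n : ℕ} (a : ℝ → E n → ℂ) : Prop :=
  (∃ K : Set (E n), IsCompact K ∧ ∀ h ∈ Ioc (0 : ℝ) 1, tsupport (a h) ⊆ K) ∧
  (∀ h ∈ Ioc (0 : ℝ) 1, ContDiff ℝ ∞ (a h)) ∧
  ∀ k : ℕ, ∃ C : ℝ, ∀ h ∈ Ioc (0 : ℝ) 1, ∀ y, ‖iteratedFDeriv ℝ k (a h) y‖ ≤ C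

end

end TangentialQuasimode

open TangentialQuasimode

/-! The exponents are chosen so that conjugation and scaling freeze the coefficients of the
operator. Put $\theta=h^{3\beta}$. By `conjP_eq_oscInt`, the conjugated operator quantizes $p$ at
the point $(t,\theta x)$ and the covector $(h\tau,\,h^\beta(\xi+h^{1-4\beta}\eta))$. This covector
is $c+\theta(\mu_1\tau,\mu_2\eta)$ with $c=(0,h^\beta\xi)$, $\mu_1=h^{1-3\beta}$,
$\mu_2=h^{1-6\beta}$, and $\mu_1,\mu_2\le1$ when $\beta\le1/6$. The polynomial factors of $p$ act
exactly, as $D_t$ and $\xi_j+h^{1-4\beta}D_j$ (`conjP_eq`). The functions $q_{jk}$ and $b$ depend on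
$x$ and on the dual variables only through $\theta$, so Taylor's formula in $\theta$ expands them
uniformly in $h$ (`scaledOp_taylor`). The remainders decay rapidly in $y$, because the quantization
of an order one symbol applied to a $C_c^\infty$ function is the Fourier transform of a smooth,
integrable amplitude (`norm_oscInt_le`). One weighted bound therefore gives the uniform and the
$L^2$ estimate.

The zeroth Taylor term, with the covector in $q_{jk}$ also replaced by $0$, is the transport system.
In the solution formula each $D_t$ costs $h^{-2\beta}$, and the neglected terms are $O(h^\beta)$ as
soon as $\beta\le1/7$. The existence of a suitable $\xi$ is polarization.

The quasimodes use $\beta=1/7$ and $s=h^{1/7}$. Every scale is then an integer power of $s$, and all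
coefficients are smooth up to $s=0$. On $e^{\varphi/s^2}a$ the Taylor expansion of the operator acts
as $s^7(qD_t\varphi+b)a+s^9(qD_ta+sRa)$, where $R$ is a differential operator with smooth
coefficients (`exists_isDiffOp_conjExpansion`). The eikonal equation $qD_t\varphi=-b$ gives
$\partial_t\operatorname{Re}\varphi=\operatorname{Im}b/q$. The sign change from $+$ to $-$ puts the
maximum of $\operatorname{Re}\varphi$ inside the interval, with a definite drop near the ends
(`exists_phase`). The transport equation is solved by a polynomial in $s$, cut off in $t$ where
$e^{\varphi/s^2}$ is negligible (`exists_amplitude`).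

Each Taylor order gains $s^3$, and each derivative of the oscillating function costs $s^{-2}$, so a
high order wins. The norm of the approximate solution is at least a multiple of $s^{n+1}$, so any
power of $h$ survives normalization (`exists_conjP_quasimode`). Undoing the conjugation and the
dilation gives the quasimodes of $P(h)$. -/

namespace TangentialQuasimode

noncomputable section

/-! ### Fourier transforms of compactly supported functions and decay of quantizations. -/

section Fourier

variable {V : Type*} [NormedAddCommGroup V] [InnerProductSpace ℝ V] [FiniteDimensional ℝ V]
  [MeasurableSpace V] [BorelSpace V]

/-- Smooth functions supported in the ball of radius `R`, whose derivatives up to order `k` are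
bounded by `b`. -/
structure CkBound (R : ℝ) (k : ℕ) (b : ℝ) (B : V → ℂ) : Prop where
  smooth : ContDiff ℝ ∞ B
  supp : tsupport B ⊆ Metric.closedBall 0 R
  bound : ∀ j ≤ k, ∀ y, ‖iteratedFDeriv ℝ j B y‖ ≤ b

omit [MeasurableSpace V] [BorelSpace V] in
theorem CkBound.hasCompactSupport {R : ℝ} {k : ℕ} {b : ℝ} {B : V → ℂ} (h : CkBound R k b B) :
    HasCompactSupport B :=
  (isCompact_closedBall (0 : V) R).of_isClosed_subset (isClosed_tsupport B) h.supp

omit [FiniteDimensional ℝ V] [MeasurableSpace V] [BorelSpace V] in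
theorem CkBound.nonneg {R : ℝ} {k : ℕ} {b : ℝ} {B : V → ℂ} (h : CkBound R k b B) : 0 ≤ b :=
  (norm_nonneg _).trans (h.bound 0 (Nat.zero_le _) 0)

omit [FiniteDimensional ℝ V] [MeasurableSpace V] [BorelSpace V] in
theorem CkBound.mono {R : ℝ} {k l : ℕ} {b c : ℝ} {B : V → ℂ} (h : CkBound R k b B) (hl : l ≤ k)
    (hc : b ≤ c) : CkBound R l c B :=
  ⟨h.smooth, h.supp, fun j hj y => (h.bound j (hj.trans hl) y).trans hc⟩

theorem integrable_weighted_iteratedFDeriv {B : V → ℂ} (h : ContDiff ℝ ∞ B)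
    (hc : HasCompactSupport B) (p q : ℕ) :
    Integrable (fun v => ‖v‖ ^ p * ‖iteratedFDeriv ℝ q B v‖) := by
  refine Continuous.integrable_of_hasCompactSupport ?_ ?_
  · exact (continuous_norm.pow p).mul
      (h.continuous_iteratedFDeriv (by exact_mod_cast le_top)).norm
  · exact (hc.iteratedFDeriv q).norm.mul_left

theorem integral_weighted_iteratedFDeriv_le {R : ℝ} {k : ℕ} {b : ℝ} {B : V → ℂ}
    (h : CkBound R k b B) (p q : ℕ) (hq : q ≤ k) :
    ∫ v, ‖v‖ ^ p * ‖iteratedFDeriv ℝ q B v‖ ≤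
      |R| ^ p * volume.real (Metric.closedBall (0 : V) R) * b := by
  have hle : ∀ v, ‖v‖ ^ p * ‖iteratedFDeriv ℝ q B v‖ ≤
      (Metric.closedBall (0 : V) R).indicator (fun _ => |R| ^ p * b) v := by
    intro v
    by_cases hv : v ∈ Metric.closedBall (0 : V) R
    · rw [indicator_of_mem hv]
      have : ‖v‖ ≤ |R| := (mem_closedBall_zero_iff.1 hv).trans (le_abs_self R)
      gcongr
      exact h.bound q hq v
    · rw [indicator_of_notMem hv]
      have : iteratedFDeriv ℝ q B v = 0 := by
        by_contra h0
        exact hv (h.supp (support_iteratedFDeriv_subset q h0))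
      simp [this]
  have hfin : volume (Metric.closedBall (0 : V) R) ≠ ⊤ :=
    (isCompact_closedBall (0 : V) R).measure_lt_top.ne
  calc ∫ v, ‖v‖ ^ p * ‖iteratedFDeriv ℝ q B v‖
      ≤ ∫ v, (Metric.closedBall (0 : V) R).indicator (fun _ => |R| ^ p * b) v :=
        integral_mono (integrable_weighted_iteratedFDeriv h.smooth h.hasCompactSupport p q)
          ((integrable_indicator_iff Metric.isClosed_closedBall.measurableSet).2
            (integrableOn_const hfin)) hle
    _ = |R| ^ p * volume.real (Metric.closedBall (0 : V) R) * b := by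
        rw [integral_indicator_const _ Metric.isClosed_closedBall.measurableSet, smul_eq_mul]
        ring

/-- Weighted bounds for a Fourier transform in terms of integrals of derivatives. -/
theorem one_add_pow_mul_norm_iteratedFDeriv_fourier_le {f : V → ℂ} (j N : ℕ)
    (hf : ContDiff ℝ N f)
    (h'f : ∀ p ≤ j, ∀ q ≤ N, Integrable (fun v => ‖v‖ ^ p * ‖iteratedFDeriv ℝ q f v‖)) (w : V) :
    (1 + ‖w‖) ^ N * ‖iteratedFDeriv ℝ j (𝓕 f) w‖ ≤
      2 ^ N * (2 * ((2 * Real.pi) ^ j * (2 * j + 2) ^ N *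
        ∑ p ∈ Finset.range (j + 1) ×ˢ Finset.range (N + 1),
          ∫ v, ‖v‖ ^ p.1 * ‖iteratedFDeriv ℝ p.2 f v‖)) := by
  set S : ℕ → ℝ := fun m => ∑ p ∈ Finset.range (j + 1) ×ˢ Finset.range (m + 1),
          ∫ v, ‖v‖ ^ p.1 * ‖iteratedFDeriv ℝ p.2 f v‖ with hS
  have hSmono : S 0 ≤ S N := by
    refine Finset.sum_le_sum_of_subset_of_nonneg ?_ ?_
    · exact Finset.product_subset_product_right (Finset.range_mono (by omega))
    · intro p _ _
      exact integral_nonneg fun v => by positivity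
  have hSnn : ∀ m, 0 ≤ S m := fun m => Finset.sum_nonneg fun p _ =>
    integral_nonneg fun v => by positivity
  have key : ∀ m ≤ N, ‖w‖ ^ m * ‖iteratedFDeriv ℝ j (𝓕 f) w‖ ≤
      (2 * Real.pi) ^ j * (2 * j + 2) ^ m * S m := by
    intro m hm
    refine Real.pow_mul_norm_iteratedFDeriv_fourier_le (K := (j : ℕ∞)) (N := (N : ℕ∞))
      (by exact_mod_cast hf) ?_ le_rfl (by exact_mod_cast hm) w
    intro p q hp hq
    exact h'f p (by exact_mod_cast hp) q (by exact_mod_cast hq)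
  have h0 := key 0 (Nat.zero_le _)
  have hN := key N le_rfl
  have hone : (1 : ℝ) ≤ (2 * j + 2) ^ N := one_le_pow₀ (by
    have : (0 : ℝ) ≤ j := by positivity
    linarith)
  have h1 : ‖iteratedFDeriv ℝ j (𝓕 f) w‖ ≤ (2 * Real.pi) ^ j * (2 * j + 2) ^ N * S N := by
    calc ‖iteratedFDeriv ℝ j (𝓕 f) w‖ ≤ (2 * Real.pi) ^ j * 1 * S 0 := by simpa using h0
      _ ≤ _ := by have := hSnn 0; gcongr
  have h2 : (1 + ‖w‖) ^ N ≤ 2 ^ N * (1 + ‖w‖ ^ N) := by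
    refine (add_pow_le zero_le_one (norm_nonneg w) N).trans ?_
    rw [one_pow]
    gcongr
    · norm_num
    · omega
  calc (1 + ‖w‖) ^ N * ‖iteratedFDeriv ℝ j (𝓕 f) w‖
      ≤ 2 ^ N * (1 + ‖w‖ ^ N) * ‖iteratedFDeriv ℝ j (𝓕 f) w‖ := by gcongr
    _ = 2 ^ N * (‖iteratedFDeriv ℝ j (𝓕 f) w‖ + ‖w‖ ^ N * ‖iteratedFDeriv ℝ j (𝓕 f) w‖) := by ring
    _ ≤ _ := by
        gcongr
        linarith

/-- Derivatives of the transform cost moments, which the fixed support controls; decay of order `N`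
costs `N` derivatives of `B`. The constant precedes `B`, so it serves whole families. -/
theorem CkBound.fourier_decay (R : ℝ) (j N : ℕ) : ∃ C : ℝ, 0 ≤ C ∧ ∀ (b : ℝ) (B : V → ℂ),
    CkBound R N b B → ∀ ζ, (1 + ‖ζ‖) ^ N * ‖iteratedFDeriv ℝ j (𝓕 B) ζ‖ ≤ C * b := by
  refine ⟨2 ^ N * (2 * ((2 * Real.pi) ^ j * (2 * j + 2) ^ N *
        ∑ p ∈ Finset.range (j + 1) ×ˢ Finset.range (N + 1),
          |R| ^ p.1 * volume.real (Metric.closedBall (0 : V) R))), by positivity, ?_⟩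
  intro b B h ζ
  refine (one_add_pow_mul_norm_iteratedFDeriv_fourier_le j N (h.smooth.of_le (by exact_mod_cast le_top))
    (fun p _ q _ => integrable_weighted_iteratedFDeriv h.smooth h.hasCompactSupport p q) ζ).trans ?_
  rw [mul_assoc (2 ^ N : ℝ), mul_assoc (2 : ℝ), mul_assoc ((2 * Real.pi) ^ j * (2 * j + 2) ^ N : ℝ), Finset.sum_mul]
  gcongr with p hp
  exact integral_weighted_iteratedFDeriv_le h _ _
    (by have := (Finset.mem_product.1 hp).2; simp at this; omega)

theorem contDiff_fourier_of_hasCompactSupport {B : V → ℂ} (h : ContDiff ℝ ∞ B)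
    (hc : HasCompactSupport B) : ContDiff ℝ ∞ (𝓕 B) := by
  have := Real.contDiff_fourier (N := ⊤) (f := B) (fun p _ => by
    simpa using integrable_weighted_iteratedFDeriv h hc p 0)
  exact this

/-- The integrand of `∫ e^{i y·η} F(η) B̂(η) dη`. -/
def oscKernel (F B : V → ℂ) (y ζ : V) : ℂ :=
  Complex.exp (Complex.I * ((2 * Real.pi * inner ℝ y ζ : ℝ) : ℂ)) * F ((2 * Real.pi) • ζ) * 𝓕 B ζ

/-- The quantization of the symbol `F`, frozen at the point `y`. -/
def oscInt (F B : V → ℂ) (y : V) : ℂ := ∫ ζ, oscKernel F B y ζ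

omit [FiniteDimensional ℝ V] [MeasurableSpace V] [BorelSpace V] in
theorem norm_exp_I_mul (r : ℝ) : ‖Complex.exp (Complex.I * (r : ℂ))‖ = 1 := by
  rw [mul_comm, Complex.norm_exp_ofReal_mul_I]

theorem norm_oscKernel (F B : V → ℂ) (y ζ : V) :
    ‖oscKernel F B y ζ‖ = ‖F ((2 * Real.pi) • ζ)‖ * ‖𝓕 B ζ‖ := by
  rw [oscKernel, norm_mul, norm_mul, norm_exp_I_mul, one_mul]

/-- Read as a Fourier transform in `ζ`, the quantization decays in `y` because its amplitude is
smooth with integrable derivatives. -/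
theorem oscInt_eq_fourier (F B : V → ℂ) (y : V) :
    oscInt F B y = 𝓕 (fun ζ => F ((2 * Real.pi) • ζ) * 𝓕 B ζ) (-y) := by
  rw [Real.fourier_eq']
  refine integral_congr_ae (.of_forall fun ζ => ?_)
  simp only [oscKernel, smul_eq_mul, inner_neg_right, mul_assoc]
  rw [real_inner_comm]
  congr 2
  push_cast
  ring

theorem integrable_one_add_norm_pow_inv :
    Integrable (fun ζ : V => ((1 + ‖ζ‖) ^ (Module.finrank ℝ V + 1))⁻¹) := by
  have := integrable_one_add_norm (E := V) (μ := volume) (r := (Module.finrank ℝ V + 1 : ℕ))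
    (by push_cast; linarith)
  refine this.congr (.of_forall fun ζ => ?_)
  simp only
  rw [Real.rpow_neg (by positivity), Real.rpow_natCast]

theorem continuous_oscKernel {F B : V → ℂ} (hF : Continuous F) (h : ContDiff ℝ ∞ B)
    (hc : HasCompactSupport B) (y : V) : Continuous (oscKernel F B y) := by
  have := (contDiff_fourier_of_hasCompactSupport h hc).continuous
  unfold oscKernel
  fun_prop

omit [FiniteDimensional ℝ V] [MeasurableSpace V] [BorelSpace V] in
theorem exists_ckBound {B : V → ℂ} (h : ContDiff ℝ ∞ B) (hc : HasCompactSupport B) (k : ℕ) :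
    ∃ R b, CkBound R k b B := by
  obtain ⟨R, hR⟩ := hc.isCompact.isBounded.subset_closedBall 0
  have : ∀ j, ∃ C, ∀ y, ‖iteratedFDeriv ℝ j B y‖ ≤ C := fun j =>
    (hc.iteratedFDeriv j).exists_bound_of_continuous
      (h.continuous_iteratedFDeriv (by exact_mod_cast le_top))
  choose C hC using this
  refine ⟨R, ∑ j ∈ Finset.range (k + 1), C j, h, hR, fun j hj y => (hC j y).trans ?_⟩
  exact Finset.single_le_sum (f := C) (fun i _ => (norm_nonneg _).trans (hC i 0))
    (Finset.mem_range.2 (by omega))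

theorem fourier_decay_of_hasCompactSupport {B : V → ℂ} (h : ContDiff ℝ ∞ B)
    (hc : HasCompactSupport B) (N : ℕ) : ∃ C, 0 ≤ C ∧ ∀ ζ, ‖𝓕 B ζ‖ ≤ C * ((1 + ‖ζ‖) ^ N)⁻¹ := by
  obtain ⟨R, b, hB⟩ := exists_ckBound h hc N
  obtain ⟨C, hC0, hC⟩ := CkBound.fourier_decay (V := V) R 0 N
  refine ⟨C * b, mul_nonneg hC0 hB.nonneg, fun ζ => ?_⟩
  have := hC b B hB ζ
  rw [norm_iteratedFDeriv_zero] at this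
  rw [← div_eq_mul_inv, le_div_iff₀ (by positivity)]
  linarith

/-- Kernels with symbols of polynomial growth are integrable. -/
theorem integrable_oscKernel {F B : V → ℂ} (hF : Continuous F) {C : ℝ} {m : ℕ}
    (hFb : ∀ η, ‖F η‖ ≤ C * (1 + ‖η‖) ^ m) (h : ContDiff ℝ ∞ B)
    (hc : HasCompactSupport B) (y : V) : Integrable (oscKernel F B y) := by
  obtain ⟨C', hC'0, hC'⟩ := fourier_decay_of_hasCompactSupport h hc (m + (Module.finrank ℝ V + 1))
  refine (integrable_one_add_norm_pow_inv.const_mul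
    (C * (1 + 2 * Real.pi) ^ m * C')).mono' (continuous_oscKernel hF h hc y).aestronglyMeasurable
    (.of_forall fun ζ => ?_)
  rw [norm_oscKernel]
  have hC0 : 0 ≤ C := by simpa using (norm_nonneg _).trans (hFb 0)
  have h1 : ‖F ((2 * Real.pi) • ζ)‖ ≤ C * ((1 + 2 * Real.pi) ^ m * (1 + ‖ζ‖) ^ m) := by
    refine (hFb _).trans ?_
    rw [← mul_pow, norm_smul, Real.norm_of_nonneg (by positivity)]
    have := Real.pi_pos
    have := norm_nonneg ζ
    gcongr
    nlinarith
  calc _ ≤ C * ((1 + 2 * Real.pi) ^ m * (1 + ‖ζ‖) ^ m) *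
      (C' * ((1 + ‖ζ‖) ^ (m + (Module.finrank ℝ V + 1)))⁻¹) := by
        gcongr
        exact hC' ζ
    _ = _ := by
        rw [pow_add, mul_inv]
        have : (1 + ‖ζ‖) ^ m ≠ 0 := by positivity
        field_simp

/-- Quantizations of symbols of order one, all of whose derivatives are under control, decay
rapidly. -/
theorem norm_oscInt_le (R CF : ℝ) (K : ℕ) : ∃ C : ℝ, 0 ≤ C ∧ ∀ F : V → ℂ, ContDiff ℝ ∞ F →
    (∀ j ≤ K, ∀ η, ‖iteratedFDeriv ℝ j F η‖ ≤ CF * (1 + ‖η‖)) → ∀ (b : ℝ) (B : V → ℂ),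
    CkBound R (Module.finrank ℝ V + 2) b B → ∀ y, (1 + ‖y‖) ^ K * ‖oscInt F B y‖ ≤ C * b := by
  set d := Module.finrank ℝ V with hd
  -- Order `d + 2` leaves the integrable decay `d + 1` after the factor `1 + ‖ζ‖` of the symbol. The
  -- `K` derivatives fall on `F` and on `𝓕 B`, where they cost only moments of `B`. The number of
  -- derivatives of `B` is thus independent of `K`.
  have := fun j => CkBound.fourier_decay (V := V) R j (d + 2)
  choose D hD0 hD using this
  set A : ℝ := ∑ q ∈ Finset.range (K + 1), ∑ i ∈ Finset.range (q + 1),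
    (q.choose i : ℝ) * ((2 * Real.pi) ^ i * (|CF| * (1 + 2 * Real.pi))) * D (q - i) with hA
  have hA0 : 0 ≤ A := Finset.sum_nonneg fun q _ => Finset.sum_nonneg fun i _ => by
    have := hD0 (q - i); positivity
  set I0 : ℝ := ∫ ζ : V, ((1 + ‖ζ‖) ^ (d + 1))⁻¹
  have hI0 : 0 ≤ I0 := integral_nonneg fun ζ => by positivity
  refine ⟨2 ^ K * (2 * ((2 * Real.pi) ^ 0 * (2 * (0 : ℕ) + 2) ^ K *
        ∑ p ∈ Finset.range (0 + 1) ×ˢ Finset.range (K + 1), A * I0)), by positivity, ?_⟩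
  intro F hF hFb b B hB y
  set G : V → ℂ := fun ζ => F ((2 * Real.pi) • ζ) * 𝓕 B ζ with hG
  have hF' : ContDiff ℝ ∞ (fun ζ : V => F ((2 * Real.pi) • ζ)) := by fun_prop
  have hBs := contDiff_fourier_of_hasCompactSupport hB.smooth hB.hasCompactSupport
  have hGs : ContDiff ℝ ∞ G := hF'.mul hBs
  have hFd : ∀ j ≤ K, ∀ ζ, ‖iteratedFDeriv ℝ j (fun ζ : V => F ((2 * Real.pi) • ζ)) ζ‖ ≤
      (2 * Real.pi) ^ j * (|CF| * (1 + 2 * Real.pi)) * (1 + ‖ζ‖) := by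
    intro j hj ζ
    rw [iteratedFDeriv_comp_const_smul (i := j) _ (hF.of_le (by exact_mod_cast le_top)), norm_smul,
      norm_pow, Real.norm_of_nonneg (by positivity), mul_assoc _ (|CF| * _), mul_assoc |CF|]
    gcongr
    refine (hFb j hj _).trans ?_
    rw [norm_smul, Real.norm_of_nonneg (by positivity)]
    have := Real.pi_pos
    have := norm_nonneg ζ
    refine mul_le_mul (le_abs_self CF) ?_ (by positivity) (by positivity)
    nlinarith [mul_nonneg Real.pi_pos.le (norm_nonneg ζ)]
  have hGd : ∀ q ≤ K, ∀ ζ, ‖iteratedFDeriv ℝ q G ζ‖ ≤ A * b * ((1 + ‖ζ‖) ^ (d + 1))⁻¹ := by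
    intro q hq ζ
    refine (norm_iteratedFDeriv_mul_le hF' hBs ζ (n := q) (by exact_mod_cast le_top)).trans ?_
    calc _ ≤ ∑ i ∈ Finset.range (q + 1), (q.choose i : ℝ) *
          ((2 * Real.pi) ^ i * (|CF| * (1 + 2 * Real.pi)) * (1 + ‖ζ‖)) *
          (D (q - i) * b * ((1 + ‖ζ‖) ^ (d + 2))⁻¹) := by
            gcongr with i hi
            · exact hFd i (by simp at hi; omega) ζ
            · rw [← div_eq_mul_inv, le_div_iff₀ (by positivity)]
              linarith [hD (q - i) b B hB ζ]
      _ = (∑ i ∈ Finset.range (q + 1), (q.choose i : ℝ) *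
          ((2 * Real.pi) ^ i * (|CF| * (1 + 2 * Real.pi))) * D (q - i)) *
            (b * ((1 + ‖ζ‖) ^ (d + 1))⁻¹) := by
            rw [Finset.sum_mul]
            refine Finset.sum_congr rfl fun i _ => ?_
            rw [pow_succ (1 + ‖ζ‖) (d + 1)]
            have : (1 + ‖ζ‖) ≠ 0 := by positivity
            field_simp
      _ ≤ A * (b * ((1 + ‖ζ‖) ^ (d + 1))⁻¹) := by
            have := hB.nonneg
            gcongr
            exact Finset.single_le_sum (f := fun q => ∑ i ∈ Finset.range (q + 1),
              (q.choose i : ℝ) * ((2 * Real.pi) ^ i * (|CF| * (1 + 2 * Real.pi))) * D (q - i))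
              (fun q _ => Finset.sum_nonneg fun i _ => by have := hD0 (q - i); positivity)
              (Finset.mem_range.2 (by omega))
      _ = _ := by ring
  have hGi : ∀ q ≤ K, Integrable (fun v => ‖iteratedFDeriv ℝ q G v‖) := fun q hq =>
    (integrable_one_add_norm_pow_inv.const_mul (A * b)).mono'
      (hGs.continuous_iteratedFDeriv (by exact_mod_cast le_top)).norm.aestronglyMeasurable
      (.of_forall fun ζ => by simpa using hGd q hq ζ)
  have hmain := one_add_pow_mul_norm_iteratedFDeriv_fourier_le (f := G) 0 K
    (hGs.of_le (by exact_mod_cast le_top)) (fun p hp q hq => by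
      obtain rfl : p = 0 := by omega
      simpa using hGi q hq) (-y)
  rw [norm_iteratedFDeriv_zero, norm_neg] at hmain
  rw [oscInt_eq_fourier]
  refine hmain.trans ?_
  rw [mul_assoc (2 ^ K : ℝ), mul_assoc (2 : ℝ), mul_assoc ((2 * Real.pi) ^ 0 * (2 * ((0:ℕ):ℝ) + 2) ^ K : ℝ),
    Finset.sum_mul]
  gcongr with p hp
  obtain ⟨hp1, hp2⟩ := Finset.mem_product.1 hp
  obtain h0 : p.1 = 0 := by simpa using hp1
  have hp2' : p.2 ≤ K := by simp at hp2; omega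
  rw [h0]
  calc ∫ v, ‖v‖ ^ 0 * ‖iteratedFDeriv ℝ p.2 G v‖ ≤ ∫ ζ : V, A * b * ((1 + ‖ζ‖) ^ (d + 1))⁻¹ :=
        integral_mono (by simpa using hGi p.2 hp2') (integrable_one_add_norm_pow_inv.const_mul _)
          (fun v => by simpa using hGd p.2 hp2' v)
    _ = A * I0 * b := by
        rw [integral_const_mul]; ring

/-- The operator `-i ∂_v`. -/
def dirD (v : V) (a : V → ℂ) (y : V) : ℂ := -Complex.I * fderiv ℝ a y v

omit [FiniteDimensional ℝ V] [MeasurableSpace V] [BorelSpace V] in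
theorem contDiff_dirD (v : V) {a : V → ℂ} (h : ContDiff ℝ ∞ a) : ContDiff ℝ ∞ (dirD v a) :=
  contDiff_const.mul ((h.fderiv_right (m := ∞) le_rfl).clm_apply contDiff_const)

omit [FiniteDimensional ℝ V] [MeasurableSpace V] [BorelSpace V] in
theorem tsupport_dirD_subset (v : V) (a : V → ℂ) : tsupport (dirD v a) ⊆ tsupport a := by
  refine (closure_mono fun y hy => ?_).trans (tsupport_fderiv_subset ℝ (f := a))
  contrapose! hy
  simp only [Function.mem_support, not_not] at hy ⊢
  simp [dirD, hy]

omit [FiniteDimensional ℝ V] [MeasurableSpace V] [BorelSpace V] in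
theorem hasCompactSupport_dirD (v : V) {a : V → ℂ} (h : HasCompactSupport a) :
    HasCompactSupport (dirD v a) :=
  h.mono' ((subset_closure).trans (tsupport_dirD_subset v a))

omit [FiniteDimensional ℝ V] [MeasurableSpace V] [BorelSpace V] in
theorem CkBound.dirD {R : ℝ} {k : ℕ} {b : ℝ} {B : V → ℂ} (h : CkBound R (k + 1) b B) (v : V) :
    CkBound R k (‖v‖ * b) (dirD v B) := by
  refine ⟨contDiff_dirD v h.smooth, (tsupport_dirD_subset v B).trans h.supp, fun j hj y => ?_⟩
  have hs : ContDiff ℝ ∞ (fderiv ℝ B) := h.smooth.fderiv_right le_rfl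
  have h1 : TangentialQuasimode.dirD v B = fun y => (-Complex.I) • (fderiv ℝ B y v) := rfl
  rw [h1, iteratedFDeriv_const_smul_apply' (f := fun y => fderiv ℝ B y v)
    ((hs.clm_apply contDiff_const).contDiffAt.of_le (by exact_mod_cast le_top)), norm_smul,
    norm_neg, Complex.norm_I, one_mul]
  refine (norm_iteratedFDeriv_clm_apply_const (hs.contDiffAt) (by exact_mod_cast le_top)).trans ?_
  gcongr
  rw [norm_iteratedFDeriv_fderiv]
  exact h.bound (j + 1) (by omega) y

theorem integrable_of_contDiff_hasCompactSupport {B : V → ℂ} (h : ContDiff ℝ ∞ B)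
    (hc : HasCompactSupport B) : Integrable B :=
  h.continuous.integrable_of_hasCompactSupport hc

theorem fourier_dirD (v : V) {B : V → ℂ} (h : ContDiff ℝ ∞ B) (hc : HasCompactSupport B) (ζ : V) :
    𝓕 (dirD v B) ζ = ((inner ℝ v ((2 * Real.pi) • ζ) : ℝ) : ℂ) * 𝓕 B ζ := by
  have hi : Integrable (fderiv ℝ B) := (h.continuous_fderiv (by simp)).integrable_of_hasCompactSupport
    (hc.fderiv ℝ)
  have h1 := congrFun (Real.fourier_fderiv (integrable_of_contDiff_hasCompactSupport h hc)
    (h.differentiable (by simp)) hi) ζ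
  have h2 : 𝓕 (dirD v B) ζ = -Complex.I * (𝓕 (fderiv ℝ B) ζ) v := by
    rw [Real.fourier_eq', Real.fourier_eq', ContinuousLinearMap.integral_apply, ← integral_const_mul]
    · refine integral_congr_ae (.of_forall fun w => ?_)
      simp [dirD]
      ring
    · have := (Real.fourierIntegral_convergent_iff (V := V) (f := fderiv ℝ B) (μ := volume) ζ).2 hi
      refine this.congr (.of_forall fun w => ?_)
      simp only [Real.fourierChar_apply, Circle.smul_def]
      congr 2
      push_cast
      ring
  rw [h2, h1]
  have h3 : ((innerSL ℝ) ζ) v = inner ℝ v ζ := by rw [innerSL_apply_apply, real_inner_comm]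
  simp only [VectorFourier.fourierSMulRight_apply, smul_eq_mul, inner_smul_right, neg_apply]
  simp only [Complex.real_smul, h3, Complex.ofReal_neg, Complex.ofReal_mul,
    Complex.ofReal_ofNat]
  linear_combination (-2 * Real.pi * inner ℝ v ζ * 𝓕 B ζ) * Complex.I_sq

/-- Fourier inversion. It evaluates a quantization at `θ = 0`, where the frozen symbol no longer
depends on the frequency. -/
theorem oscInt_const (c : ℂ) {B : V → ℂ} (h : ContDiff ℝ ∞ B) (hc : HasCompactSupport B) (y : V) :
    oscInt (fun _ => c) B y = c * B y := by
  have hi : Integrable (𝓕 B) := by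
    obtain ⟨C', hC'0, hC'⟩ := fourier_decay_of_hasCompactSupport h hc (Module.finrank ℝ V + 1)
    exact (integrable_one_add_norm_pow_inv.const_mul C').mono'
      (contDiff_fourier_of_hasCompactSupport h hc).continuous.aestronglyMeasurable
      (.of_forall fun ζ => by simpa using hC' ζ)
  have := congrFun (Continuous.fourierInv_fourier_eq h.continuous
    (integrable_of_contDiff_hasCompactSupport h hc) hi) y
  rw [Real.fourierInv_eq'] at this
  rw [← this, oscInt, ← integral_const_mul]
  refine integral_congr_ae (.of_forall fun ζ => ?_)
  simp only [oscKernel, smul_eq_mul]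
  rw [real_inner_comm, mul_comm Complex.I]
  ring

end Fourier

/-! ### Conjugation by the oscillating factor and dilation in `x`. -/

section Conjugation

variable {n : ℕ}

@[simp] theorem pt_fst (t : ℝ) (x : X n) : (pt t x).fst = t := rfl

@[simp] theorem pt_snd (t : ℝ) (x : X n) : (pt t x).snd = x := rfl

@[simp] theorem pt_fst_snd (y : E n) : pt y.fst y.snd = y := rfl

theorem inner_E (y z : E n) : inner ℝ y z = y.fst * z.fst + inner ℝ y.snd z.snd := by
  rw [WithLp.prod_inner_apply]
  simp [mul_comm]

theorem E_ext {y z : E n} (h1 : y.fst = z.fst) (h2 : y.snd = z.snd) : y = z := by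
  rw [← pt_fst_snd y, ← pt_fst_snd z, h1, h2]

/-- The dilation as a linear equivalence. -/
def dilEquiv (r : ℝ) (hr : r ≠ 0) : E n ≃ₗ[ℝ] E n where
  toFun := dil r
  invFun := dil r⁻¹
  map_add' y z := E_ext (by simp [dil]) (by simp [dil])
  map_smul' c y := E_ext (by simp [dil]) (by simp [dil, smul_comm r c])
  left_inv y := E_ext (by simp [dil]) (by simp [dil, smul_smul, hr])
  right_inv y := E_ext (by simp [dil]) (by simp [dil, smul_smul, hr])

theorem dil_inv_dil {r : ℝ} (hr : r ≠ 0) (y : E n) : dil r⁻¹ (dil r y) = y :=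
  (dilEquiv r hr).left_inv y

theorem inner_dil (r : ℝ) (y z : E n) : inner ℝ (dil r y) z = inner ℝ y (dil r z) := by
  simp [dil, inner_smul_left, inner_smul_right]

/-- The Jacobian need not be computed, since it cancels in every application. -/
theorem exists_map_dil {r : ℝ} (hr : r ≠ 0) : ∃ c : ℝ, 0 < c ∧
    Measure.map (dil r) (volume : Measure (E n)) = ENNReal.ofReal c • volume ∧
    MeasurableEmbedding (dil r : E n → E n) := by
  have hdet : LinearMap.det (dilEquiv (n := n) r hr : E n →ₗ[ℝ] E n) ≠ 0 :=
    (LinearEquiv.isUnit_det' _).ne_zero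
  refine ⟨|(LinearMap.det (dilEquiv (n := n) r hr : E n →ₗ[ℝ] E n))⁻¹|, by positivity, ?_, ?_⟩
  · exact Measure.map_linearMap_addHaar_eq_smul_addHaar volume hdet
  · exact (dilEquiv (n := n) r hr).toContinuousLinearEquiv.toHomeomorph.measurableEmbedding

theorem exists_integral_dil {r : ℝ} (hr : r ≠ 0) : ∃ c : ℝ, 0 < c ∧
    ∀ g : E n → ℂ, ∫ z, g (dil r z) = c * ∫ z, g z := by
  obtain ⟨c, hc, hm, he⟩ := exists_map_dil (n := n) hr
  refine ⟨c, hc, fun g => ?_⟩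
  rw [← he.integral_map, hm, integral_smul_measure, ENNReal.toReal_ofReal hc.le, Complex.real_smul]

theorem exists_eLpNorm_dil {r : ℝ} (hr : r ≠ 0) : ∃ c : ENNReal, c ≠ 0 ∧ c ≠ ⊤ ∧
    ∀ g : E n → ℂ, eLpNorm (fun z => g (dil r z)) 2 volume = c * eLpNorm g 2 volume := by
  obtain ⟨c, hc, hm, he⟩ := exists_map_dil (n := n) hr
  have hc' : ENNReal.ofReal c ≠ 0 := by simpa using hc
  refine ⟨ENNReal.ofReal c ^ (1 / (2 : ENNReal)).toReal, ?_, ?_, fun g => ?_⟩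
  · exact (ENNReal.rpow_pos (by simpa using hc) ENNReal.ofReal_ne_top).ne'
  · exact ENNReal.rpow_ne_top_of_nonneg (by simp) ENNReal.ofReal_ne_top
  · have := he.eLpNorm_map_measure (μ := volume) (g := g) (p := 2)
    rw [hm, eLpNorm_smul_measure_of_ne_zero hc', smul_eq_mul] at this
    exact this.symm

theorem fourier_comp_dil_inv {r : ℝ} (hr : r ≠ 0) {c : ℝ} (hc : 0 < c)
    (hint : ∀ g : E n → ℂ, ∫ z, g (dil r z) = c * ∫ z, g z) (v : E n → ℂ) (ζ : E n) :
    𝓕 (fun z => v (dil r⁻¹ z)) ζ = (c : ℂ)⁻¹ * 𝓕 v (dil r ζ) := by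
  have h1 := hint fun z => Complex.exp (((-2 * Real.pi * inner ℝ z ζ : ℝ) : ℂ) * Complex.I) •
    v (dil r⁻¹ z)
  rw [Real.fourier_eq', Real.fourier_eq']
  have hc' : (c : ℂ) ≠ 0 := by exact_mod_cast hc.ne'
  simp only [dil_inv_dil hr, inner_dil] at h1
  rw [h1, inv_mul_cancel_left₀ hc']

theorem fourier_osc_mul (α : ℝ) (ξ : X n) (h : ℝ) (a : E n → ℂ) (ζ : E n) :
    𝓕 (fun z => osc α ξ h z * a z) ζ = 𝓕 a (ζ - pt 0 ((2 * Real.pi * h ^ α)⁻¹ • ξ)) := by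
  rw [Real.fourier_eq', Real.fourier_eq']
  refine integral_congr_ae (.of_forall fun z => ?_)
  simp only [osc, smul_eq_mul, ← mul_assoc, ← Complex.exp_add]
  congr 2
  rw [inner_sub_right]
  simp only [inner_E z (pt _ _), pt_fst, pt_snd, inner_smul_right]
  have := Real.pi_ne_zero
  have h1 : (2 * Real.pi * h ^ α)⁻¹ = (2 * Real.pi)⁻¹ * (h ^ α)⁻¹ := mul_inv _ _
  rw [h1]
  push_cast
  have : (Real.pi : ℂ) ≠ 0 := by exact_mod_cast this
  field_simp
  ring

theorem osc_ne_zero (α : ℝ) (ξ : X n) (h : ℝ) (y : E n) : osc α ξ h y ≠ 0 := Complex.exp_ne_zero _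

theorem norm_osc (α : ℝ) (ξ : X n) (h : ℝ) (y : E n) : ‖osc α ξ h y‖ = 1 := norm_exp_I_mul _

/-- The conjugated scaled operator as an oscillatory integral. -/
theorem conjP_eq_oscInt (q : Fin n → Fin n → E n → X n → ℝ) (b : E n → E n → ℂ) (β : ℝ) (ξ : X n)
    {h : ℝ} (hh : 0 < h) (a : E n → ℂ) (y : E n) :
    conjP q b β ξ h a y = oscInt (fun η => fullSymbol q b h (dil (h ^ (3 * β)) y)
      (pt (h * η.fst) (h ^ β • ξ + h ^ (1 - 3 * β) • η.snd))) a y := by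
  set r := h ^ (3 * β) with hr
  have hr0 : r ≠ 0 := (Real.rpow_pos_of_pos hh _).ne'
  have hri : h ^ (-(3 * β)) = r⁻¹ := Real.rpow_neg hh.le _
  obtain ⟨c, hc, hint⟩ := exists_integral_dil (n := n) hr0
  have hc' : (c : ℂ) ≠ 0 := by exact_mod_cast hc.ne'
  set w : E n := pt 0 ((2 * Real.pi * h ^ (1 - 4 * β))⁻¹ • ξ) with hw
  set v : E n → ℂ := fun z => osc (1 - 4 * β) ξ h z * a z with hv
  set p := fullSymbol q b h with hp
  unfold conjP scaledP opP opH
  rw [hri]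
  set G : E n → ℂ := fun ζ => Complex.exp (Complex.I * ((2 * Real.pi * inner ℝ y ζ : ℝ) : ℂ)) *
    p (dil r y) ((2 * Real.pi * h) • dil r⁻¹ ζ) * 𝓕 v ζ with hG
  have h1 : ∀ ζ : E n, Complex.exp (Complex.I * ((2 * Real.pi * inner ℝ (dil r y) ζ : ℝ) : ℂ)) *
      p (dil r y) ((2 * Real.pi * h) • ζ) * 𝓕 (fun z => v (dil r⁻¹ z)) ζ =
      (c : ℂ)⁻¹ * G (dil r ζ) := by
    intro ζ
    rw [fourier_comp_dil_inv hr0 hc hint v ζ, hG]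
    simp only [dil_inv_dil hr0, inner_dil]
    ring
  change (osc (1 - 4 * β) ξ h y)⁻¹ * ∫ ζ : E n,
    Complex.exp (Complex.I * ((2 * Real.pi * inner ℝ (dil r y) ζ : ℝ) : ℂ)) *
      p (dil r y) ((2 * Real.pi * h) • ζ) * 𝓕 (fun z => v (dil r⁻¹ z)) ζ = _
  simp only [h1]
  -- The Jacobian of the substitution cancels the one from the Fourier transform. The translation by
  -- `w` recentres the frequencies at that of the oscillating factor.
  rw [integral_const_mul, hint, inv_mul_cancel_left₀ hc', ← integral_add_right_eq_self G w,
    ← integral_const_mul]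
  refine integral_congr_ae (.of_forall fun ζ => ?_)
  have h2 : Complex.exp (Complex.I * ((2 * Real.pi * inner ℝ y (ζ + w) : ℝ) : ℂ)) =
      osc (1 - 4 * β) ξ h y *
        Complex.exp (Complex.I * ((2 * Real.pi * inner ℝ y ζ : ℝ) : ℂ)) := by
    rw [osc, ← Complex.exp_add, inner_add_right, hw, inner_E y (pt _ _)]
    congr 1
    rw [← mul_add, ← Complex.ofReal_add]
    congr 2
    simp only [pt_fst, pt_snd, inner_smul_right]
    have := Real.pi_ne_zero
    have := (Real.rpow_pos_of_pos hh (1 - 4 * β)).ne'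
    field_simp
    ring
  -- Here `α` and `γ` combine: $h\cdot h^{-3\beta}\cdot h^{-(1-4\beta)}=h^\beta$ is the size of the
  -- base covector.
  have h3 : (2 * Real.pi * h) • dil r⁻¹ (ζ + w) = pt (h * ((2 * Real.pi) • ζ).fst)
      (h ^ β • ξ + h ^ (1 - 3 * β) • ((2 * Real.pi) • ζ).snd) := by
    have e1 : h * r⁻¹ = h ^ (1 - 3 * β) := by
      rw [hr, Real.rpow_sub hh, Real.rpow_one, div_eq_mul_inv]
    have e2 : h ^ (1 - 3 * β) = h ^ β * h ^ (1 - 4 * β) := by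
      rw [← Real.rpow_add hh]
      ring_nf
    have e3 := (Real.rpow_pos_of_pos hh (1 - 4 * β)).ne'
    have e4 := Real.pi_ne_zero
    refine E_ext ?_ ?_
    · simp [dil, hw]
      ring
    · simp only [dil, hw, WithLp.smul_snd, pt_snd, WithLp.add_snd, smul_add, smul_smul]
      rw [add_comm]
      congr 2
      · rw [show 2 * Real.pi * h * (r⁻¹ * (2 * Real.pi * h ^ (1 - 4 * β))⁻¹) =
          (h * r⁻¹) * (2 * Real.pi * (2 * Real.pi * h ^ (1 - 4 * β))⁻¹) by ring, e1, e2]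
        field_simp
      · rw [show 2 * Real.pi * h * r⁻¹ = (h * r⁻¹) * (2 * Real.pi) by ring, e1]
  simp only [hG, h2, h3, hv, fourier_osc_mul, ← hw, add_sub_cancel_right, oscKernel]
  have := osc_ne_zero (1 - 4 * β) ξ h y
  field_simp

end Conjugation

/-! ### Symbols along scaled slices, and the exact form of the conjugated operator. -/

section Symbols

variable {n : ℕ}

theorem IsSymbol.exists_norm_le {V W F : Type*} [NormedAddCommGroup V] [NormedSpace ℝ V]
    [NormedAddCommGroup W] [NormedSpace ℝ W] [NormedAddCommGroup F] [NormedSpace ℝ F]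
    {m : ℕ} {f : V → W → F} (hf : IsSymbol m f) : ∃ C, 0 ≤ C ∧ ∀ y η, ‖f y η‖ ≤ C * (1 + ‖η‖) ^ m := by
  obtain ⟨C, hC⟩ := hf.2 0
  refine ⟨C, by simpa using (norm_nonneg _).trans (hC 0 0), fun y η => ?_⟩
  simpa using hC y η

/-- A symbol `q (y, ξ)` as a complex symbol in `(y, (τ, ξ))`. -/
def liftSymbol (q : E n → X n → ℝ) (y η : E n) : ℂ := ((q y η.snd : ℝ) : ℂ)

/-- The projection `(τ, ξ) ↦ ξ`. -/
def sndL (n : ℕ) : E n →L[ℝ] X n := WithLp.sndL 2 ℝ ℝ (X n)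

/-- Weakening the order from 0 to 1 lets one expansion serve both the `q j k` and `b`. -/
theorem isSymbol_liftSymbol {q : E n → X n → ℝ} (hq : IsSymbol 0 q) :
    IsSymbol 1 (liftSymbol q) := by
  set g : E n × E n →L[ℝ] E n × X n :=
    (ContinuousLinearMap.fst ℝ (E n) (E n)).prod ((sndL n).comp (ContinuousLinearMap.snd ℝ _ _))
    with hg
  have hgs : ContDiff ℝ ∞ (fun z : E n × E n => q z.1 z.2.snd) := hq.1.comp g.contDiff
  refine ⟨Complex.ofRealCLM.contDiff.comp hgs, fun k => ?_⟩
  obtain ⟨C, hC⟩ := hq.2 k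
  have hC0 : 0 ≤ C := by simpa using (norm_nonneg _).trans (hC 0 0)
  refine ⟨‖(Complex.ofRealCLM : ℝ →L[ℝ] ℂ)‖ * (C * ‖g‖ ^ k), fun y η => ?_⟩
  have h1 := (Complex.ofRealCLM : ℝ →L[ℝ] ℂ).norm_iteratedFDeriv_comp_left
    (f := fun z : E n × E n => q z.1 z.2.snd) (N := ∞) (x := (y, η)) hgs.contDiffAt
    (n := k) (by exact_mod_cast le_top)
  refine h1.trans ?_
  have h2 : ‖iteratedFDeriv ℝ k (fun z : E n × E n => q z.1 z.2.snd) (y, η)‖ ≤ C * ‖g‖ ^ k := by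
    have := g.iteratedFDeriv_comp_right (f := fun z : E n × X n => q z.1 z.2) hq.1 (y, η)
      (i := k) (by exact_mod_cast le_top)
    have h3 : (fun z : E n × E n => q z.1 z.2.snd) = (fun z : E n × X n => q z.1 z.2) ∘ g := rfl
    rw [h3, this]
    refine (ContinuousMultilinearMap.norm_compContinuousLinearMap_le _ _).trans ?_
    rw [Finset.prod_const, Finset.card_univ, Fintype.card_fin]
    gcongr
    exact (hC y η.snd).trans_eq (by simp)
  rw [pow_one, mul_assoc]
  gcongr
  nlinarith [norm_nonneg η, mul_nonneg (mul_nonneg hC0 (pow_nonneg (norm_nonneg g) k)) (norm_nonneg η)]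

/-- The linear map `(τ, η) ↦ (μ₁ τ, μ₂ η)`. -/
def scaleL (μ₁ μ₂ : ℝ) : E n →L[ℝ] E n :=
  LinearMap.toContinuousLinearMap
    { toFun := fun η => pt (μ₁ * η.fst) (μ₂ • η.snd)
      map_add' := fun y z => E_ext (by simp [mul_add]) (by simp)
      map_smul' := fun r y => E_ext (by simp [mul_left_comm]) (by simp [smul_comm r μ₂]) }

theorem scaleL_apply (μ₁ μ₂ : ℝ) (η : E n) : scaleL μ₁ μ₂ η = pt (μ₁ * η.fst) (μ₂ • η.snd) := rfl

theorem IsSymbol.contDiff_slice {f : E n → E n → ℂ} {m : ℕ} (hf : IsSymbol m f) (y c : E n)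
    (Λ : E n →L[ℝ] E n) : ContDiff ℝ ∞ fun η => f y (c + Λ η) :=
  hf.1.comp (contDiff_const.prodMk (contDiff_const.add Λ.contDiff))

/-- One constant covers all base points, shifts and linear maps. The uniformity in $h$ of all later
expansions rests on this. -/
theorem IsSymbol.norm_iteratedFDeriv_slice_le {f : E n → E n → ℂ} {m : ℕ} (hf : IsSymbol m f)
    (k : ℕ) : ∃ C, 0 ≤ C ∧ ∀ (y c : E n) (Λ : E n →L[ℝ] E n) (η : E n),
      ‖iteratedFDeriv ℝ k (fun η => f y (c + Λ η)) η‖ ≤ C * (1 + ‖c + Λ η‖) ^ m * ‖Λ‖ ^ k := by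
  obtain ⟨C, hC⟩ := hf.2 k
  have hC0 : 0 ≤ C := by simpa using (norm_nonneg _).trans (hC 0 0)
  refine ⟨C, hC0, fun y c Λ η => ?_⟩
  set g : E n →L[ℝ] E n × E n := (ContinuousLinearMap.inr ℝ (E n) (E n)).comp Λ with hg
  have hgn : ‖g‖ ≤ ‖Λ‖ := by
    refine g.opNorm_le_bound (norm_nonneg _) fun x => ?_
    simpa [hg] using Λ.le_opNorm x
  set f' : E n × E n → ℂ := fun z => f (z + (y, c)).1 (z + (y, c)).2 with hf'
  have hfs : ContDiff ℝ ∞ f' := hf.1.comp (contDiff_id.add contDiff_const)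
  have h3 : (fun η => f y (c + Λ η)) = f' ∘ g := by
    funext η
    simp [hf', hg, add_comm]
  rw [h3, g.iteratedFDeriv_comp_right hfs η (i := k) (by exact_mod_cast le_top)]
  refine (ContinuousMultilinearMap.norm_compContinuousLinearMap_le _ _).trans ?_
  rw [Finset.prod_const, Finset.card_univ, Fintype.card_fin]
  have h4 : iteratedFDeriv ℝ k f' (g η) =
      iteratedFDeriv ℝ k (fun z : E n × E n => f z.1 z.2) (y, c + Λ η) := by
    have := iteratedFDeriv_comp_add_right (𝕜 := ℝ) (f := fun z : E n × E n => f z.1 z.2) k (y, c)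
      (g η)
    rw [hf', this]
    simp [hg, add_comm]
  rw [h4]
  have := hC y (c + Λ η)
  gcongr

/-- The quantization of `f (t, θ x, c + θ (μ₁ τ, μ₂ η))`. -/
def scaledOp (θ μ₁ μ₂ : ℝ) (c : E n) (f : E n → E n → ℂ) (B : E n → ℂ) (y : E n) : ℂ :=
  oscInt (fun η => f (dil θ y) (c + (θ • scaleL μ₁ μ₂) η)) B y

/-- The operator `ξ_j + μ D_j`. -/
def shiftD (μ : ℝ) (ξ : X n) (j : Fin n) (a : E n → ℂ) (y : E n) : ℂ :=
  (ξ j : ℂ) * a y + (μ : ℂ) * Dx j a y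

theorem Dt_eq_dirD (a : E n → ℂ) : Dt a = dirD (pt 1 0) a := rfl

theorem Dx_eq_dirD (j : Fin n) (a : E n → ℂ) :
    Dx j a = dirD (pt 0 (EuclideanSpace.single j 1)) a := rfl

theorem contDiff_shiftD (μ : ℝ) (ξ : X n) (j : Fin n) {a : E n → ℂ} (h : ContDiff ℝ ∞ a) :
    ContDiff ℝ ∞ (shiftD μ ξ j a) :=
  (contDiff_const.mul h).add (contDiff_const.mul (contDiff_dirD _ h))

theorem hasCompactSupport_shiftD (μ : ℝ) (ξ : X n) (j : Fin n) {a : E n → ℂ}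
    (h : HasCompactSupport a) : HasCompactSupport (shiftD μ ξ j a) :=
  (h.mul_left (f := fun _ => (ξ j : ℂ))).add
    ((hasCompactSupport_dirD (pt 0 (EuclideanSpace.single j 1)) h).mul_left (f := fun _ => (μ : ℂ)))

theorem fourier_shiftD (μ : ℝ) (ξ : X n) (j : Fin n) {a : E n → ℂ} (h : ContDiff ℝ ∞ a)
    (hc : HasCompactSupport a) (ζ : E n) :
    𝓕 (shiftD μ ξ j a) ζ = ((ξ j + μ * ((2 * Real.pi) • ζ).snd j : ℝ) : ℂ) * 𝓕 a ζ := by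
  have i1 := integrable_of_contDiff_hasCompactSupport h hc
  have i2 : Integrable (Dx j a) := integrable_of_contDiff_hasCompactSupport
    (contDiff_dirD (pt 0 (EuclideanSpace.single j 1)) h) (hasCompactSupport_dirD _ hc)
  have h2 : 𝓕 (shiftD μ ξ j a) ζ = (ξ j : ℂ) * 𝓕 a ζ + (μ : ℂ) * 𝓕 (Dx j a) ζ := by
    have j1 := (Real.fourierIntegral_convergent_iff ζ).2 i1
    have j2 := (Real.fourierIntegral_convergent_iff ζ).2 i2
    simp only [Real.fourier_eq, ← integral_const_mul]
    rw [← integral_add (j1.const_mul _) (j2.const_mul _)]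
    refine integral_congr_ae (.of_forall fun z => ?_)
    simp only [shiftD, Circle.smul_def, smul_eq_mul]
    ring
  rw [h2, Dx_eq_dirD, fourier_dirD _ h hc]
  rw [inner_E]
  simp only [pt_fst, pt_snd, zero_mul, zero_add, EuclideanSpace.inner_single_left]
  push_cast
  simp
  ring

/-- The covector in $x$ factors as $h^\beta(\xi+h^{1-4\beta}\eta)$. Hence $\tau^2$ acts as
$h^2D_t^2$, and $\tau\xi_j\xi_k$ produces $h^{1+2\beta}$ with $D_t$ and two `shiftD` factors. Only
the arguments of `q j k` and `b` remain quantized. -/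
theorem conjP_eq (q : Fin n → Fin n → E n → X n → ℝ) (b : E n → E n → ℂ)
    (hq : ∀ j k, IsSymbol 0 (q j k)) (hb : IsSymbol 1 b) (β : ℝ) (ξ : X n)
    {h : ℝ} (hh : 0 < h) {a : E n → ℂ} (ha : ContDiff ℝ ∞ a) (hc : HasCompactSupport a) (y : E n) :
    conjP q b β ξ h a y = ((h ^ 2 : ℝ) : ℂ) * Dt (Dt a) y
      + ((h ^ (1 + 2 * β) : ℝ) : ℂ) * ∑ j, ∑ k,
          scaledOp (h ^ (3 * β)) (h ^ (1 - 3 * β)) (h ^ (1 - 6 * β)) (pt 0 (h ^ β • ξ))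
            (liftSymbol (q j k)) (shiftD (h ^ (1 - 4 * β)) ξ j (shiftD (h ^ (1 - 4 * β)) ξ k (Dt a))) y
      + (h : ℂ) * scaledOp (h ^ (3 * β)) (h ^ (1 - 3 * β)) (h ^ (1 - 6 * β)) (pt 0 (h ^ β • ξ)) b a y := by
  set θ := h ^ (3 * β)
  set μ₁ := h ^ (1 - 3 * β)
  set μ₂ := h ^ (1 - 6 * β)
  set μ := h ^ (1 - 4 * β)
  set c : E n := pt 0 (h ^ β • ξ)
  -- The scales $h$ of $\tau$ and $h^{1-3\beta}$ of $\eta$ are split so that each contains the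
  -- expansion parameter `θ`.
  have e1 : θ * μ₁ = h := by
    rw [← Real.rpow_add hh]; ring_nf; exact Real.rpow_one h
  have e2 : θ * μ₂ = h ^ β * μ := by
    rw [← Real.rpow_add hh, ← Real.rpow_add hh]; ring_nf
  have e3 : h ^ (1 + 2 * β) = h * h ^ β * h ^ β := by
    rw [mul_assoc, ← Real.rpow_add hh, Real.rpow_add hh, Real.rpow_one]; ring_nf
  have e4 : h ^ (1 - 3 * β) = h ^ β * μ := by
    rw [← Real.rpow_add hh]; ring_nf
  have harg : ∀ η : E n, c + (θ • scaleL μ₁ μ₂) η =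
      pt (h * η.fst) (h ^ β • ξ + h ^ (1 - 3 * β) • η.snd) := by
    intro η
    refine E_ext ?_ ?_
    · simp [c, scaleL_apply, ← mul_assoc, e1]
    · simp only [smul_apply, scaleL_apply, c, WithLp.add_snd, pt_snd, WithLp.smul_snd, smul_smul, e2, e4]
  have hD : ContDiff ℝ ∞ (Dt a) := contDiff_dirD _ ha
  have hDc : HasCompactSupport (Dt a) := hasCompactSupport_dirD _ hc
  have hDD : ContDiff ℝ ∞ (Dt (Dt a)) := contDiff_dirD _ hD
  have hDDc : HasCompactSupport (Dt (Dt a)) := hasCompactSupport_dirD _ hDc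
  have hS := fun k => contDiff_shiftD μ ξ k hD
  have hSc := fun k => hasCompactSupport_shiftD μ ξ k hDc
  have hSS := fun j k => contDiff_shiftD μ ξ j (hS k)
  have hSSc := fun j k => hasCompactSupport_shiftD μ ξ j (hSc k)
  have hgrow : ∀ f : E n → E n → ℂ, IsSymbol 1 f → ∃ C, ∀ η : E n,
      ‖f (dil θ y) (c + (θ • scaleL μ₁ μ₂) η)‖ ≤ C * (1 + ‖η‖) ^ 1 := by
    intro f hf
    obtain ⟨C, hC0, hC⟩ := hf.exists_norm_le
    refine ⟨C * (1 + ‖c‖ + ‖(θ • scaleL μ₁ μ₂ : E n →L[ℝ] E n)‖), fun η => (hC _ _).trans ?_⟩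
    have h1 := norm_add_le c ((θ • scaleL μ₁ μ₂ : E n →L[ℝ] E n) η)
    have h2 := (θ • scaleL μ₁ μ₂ : E n →L[ℝ] E n).le_opNorm η
    rw [pow_one, pow_one, mul_assoc]
    gcongr
    nlinarith [norm_nonneg η, norm_nonneg c, norm_nonneg (θ • scaleL μ₁ μ₂ : E n →L[ℝ] E n),
      mul_nonneg (norm_nonneg c) (norm_nonneg η)]
  have hcont : ∀ f : E n → E n → ℂ, IsSymbol 1 f →
      Continuous fun η : E n => f (dil θ y) (c + (θ • scaleL μ₁ μ₂) η) := fun f hf =>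
    (hf.contDiff_slice _ _ _).continuous
  have hint : ∀ f : E n → E n → ℂ, IsSymbol 1 f → ∀ B : E n → ℂ, ContDiff ℝ ∞ B →
      HasCompactSupport B → Integrable (oscKernel
        (fun η => f (dil θ y) (c + (θ • scaleL μ₁ μ₂) η)) B y) := by
    intro f hf B hB hBc
    obtain ⟨C, hC⟩ := hgrow f hf
    exact integrable_oscKernel (hcont f hf) hC hB hBc y
  have hker : ∀ ζ, oscKernel (fun η => fullSymbol q b h (dil θ y)
      (pt (h * η.fst) (h ^ β • ξ + h ^ (1 - 3 * β) • η.snd))) a y ζ =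
      ((h ^ 2 : ℝ) : ℂ) * oscKernel (fun _ => 1) (Dt (Dt a)) y ζ
      + ((h ^ (1 + 2 * β) : ℝ) : ℂ) * ∑ j, ∑ k, oscKernel
          (fun η => liftSymbol (q j k) (dil θ y) (c + (θ • scaleL μ₁ μ₂) η))
          (shiftD μ ξ j (shiftD μ ξ k (Dt a))) y ζ
      + (h : ℂ) * oscKernel (fun η => b (dil θ y) (c + (θ • scaleL μ₁ μ₂) η)) a y ζ := by
    intro ζ
    simp only [harg, oscKernel, fullSymbol, liftSymbol, pt_fst, pt_snd]
    have hF1 : ∀ j k, 𝓕 (shiftD μ ξ j (shiftD μ ξ k (Dt a))) ζ =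
      ((ξ j + μ * ((2 * Real.pi) • ζ).snd j : ℝ) : ℂ) * (((ξ k + μ * ((2 * Real.pi) • ζ).snd k : ℝ) : ℂ)
        * (((((2 * Real.pi) • ζ).fst : ℝ) : ℂ) * 𝓕 a ζ)) := by
      intro j k
      rw [fourier_shiftD μ ξ j (hS k) (hSc k), fourier_shiftD μ ξ k hD hDc, Dt_eq_dirD,
        fourier_dirD _ ha hc, inner_E]
      simp
    have hF2 : 𝓕 (Dt (Dt a)) ζ = ((((2 * Real.pi) • ζ).fst : ℝ) : ℂ) *
        (((((2 * Real.pi) • ζ).fst : ℝ) : ℂ) * 𝓕 a ζ) := by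
      rw [Dt_eq_dirD (Dt a), fourier_dirD _ hD hDc, Dt_eq_dirD, fourier_dirD _ ha hc, inner_E]
      simp
    simp only [hF1, hF2, e3, e4]
    generalize (2 * Real.pi) • ζ = η
    have hP : ∀ j, (h ^ β • ξ + (h ^ β * μ) • η.snd) j = h ^ β * (ξ j + μ * η.snd j) := by
      intro j
      simp
      ring
    simp only [hP]
    have hS1 : ∑ j, ∑ k, q j k (dil θ y) (h ^ β • ξ + (h ^ β * μ) • η.snd) *
        (h ^ β * (ξ j + μ * η.snd j)) * (h ^ β * (ξ k + μ * η.snd k)) =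
        h ^ β * h ^ β * ∑ j, ∑ k, q j k (dil θ y) (h ^ β • ξ + (h ^ β * μ) • η.snd) *
          ((ξ j + μ * η.snd j) * (ξ k + μ * η.snd k)) := by
      simp only [Finset.mul_sum]
      exact Finset.sum_congr rfl fun j _ => Finset.sum_congr rfl fun k _ => by ring
    have hS2 : ∀ A B : ℂ, ∑ j, ∑ k, A *
        ((q j k (dil θ y) (h ^ β • ξ + (h ^ β * μ) • η.snd) : ℝ) : ℂ) *
          (((ξ j + μ * η.snd j : ℝ) : ℂ) * (((ξ k + μ * η.snd k : ℝ) : ℂ) * B)) =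
        A * B * ((∑ j, ∑ k, q j k (dil θ y) (h ^ β • ξ + (h ^ β * μ) • η.snd) *
          ((ξ j + μ * η.snd j) * (ξ k + μ * η.snd k)) : ℝ) : ℂ) := by
      intro A B
      simp only [Complex.ofReal_sum, Finset.mul_sum, Complex.ofReal_mul]
      exact Finset.sum_congr rfl fun j _ => Finset.sum_congr rfl fun k _ => by ring
    rw [hS1, hS2]
    push_cast
    ring
  rw [conjP_eq_oscInt q b β ξ hh a y, oscInt, integral_congr_ae (.of_forall hker)]
  have j1 := integrable_oscKernel (F := fun _ : E n => (1 : ℂ)) (C := 1) (m := 0) continuous_const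
    (by simp) hDD hDDc y
  have j2 := fun j k => hint _ (isSymbol_liftSymbol (hq j k)) _ (hSS j k) (hSSc j k)
  have j3 := hint b hb a ha hc
  have j4 : Integrable fun ζ => ∑ j, ∑ k, oscKernel
          (fun η => liftSymbol (q j k) (dil θ y) (c + (θ • scaleL μ₁ μ₂) η))
          (shiftD μ ξ j (shiftD μ ξ k (Dt a))) y ζ :=
    integrable_finsetSum _ fun j _ => integrable_finsetSum _ fun k _ => j2 j k
  rw [integral_add (f := fun ζ => _ * _ + _ * _) ((j1.const_mul _).add (j4.const_mul _))
      (j3.const_mul _),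
    integral_add (j1.const_mul _) (j4.const_mul _), integral_const_mul, integral_const_mul,
    integral_const_mul, integral_finsetSum _ fun j _ => integrable_finsetSum _ fun k _ => j2 j k]
  simp only [integral_finsetSum _ fun k _ => j2 _ k]
  have := oscInt_const 1 hDD hDDc y
  rw [oscInt] at this
  rw [this, one_mul]
  rfl

end Symbols

/-! ### Taylor expansion of scaled quantizations in the parameter `θ`. -/

section Taylor

variable {n : ℕ}

/-- The derivative of a symbol in the direction `e`. -/
def symD (e : E n × E n) (f : E n → E n → ℂ) (y η : E n) : ℂ :=
  fderiv ℝ (fun z : E n × E n => f z.1 z.2) (y, η) e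

theorem IsSymbol.symD {m : ℕ} {f : E n → E n → ℂ} (hf : IsSymbol m f) (e : E n × E n) :
    IsSymbol m (symD e f) := by
  have hs : ContDiff ℝ ∞ (fderiv ℝ (fun z : E n × E n => f z.1 z.2)) := hf.1.fderiv_right le_rfl
  refine ⟨hs.clm_apply contDiff_const, fun k => ?_⟩
  obtain ⟨C, hC⟩ := hf.2 (k + 1)
  refine ⟨‖e‖ * C, fun y η => ?_⟩
  refine (norm_iteratedFDeriv_clm_apply_const (f := fderiv ℝ (fun z : E n × E n => f z.1 z.2))
    hs.contDiffAt (by exact_mod_cast le_top)).trans ?_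
  rw [norm_iteratedFDeriv_fderiv, mul_assoc]
  gcongr
  exact hC y η

/-- The labels of the variables `x_j`, `τ`, `ξ_k` in which symbols are expanded. -/
abbrev Label (n : ℕ) := Fin n ⊕ (Unit ⊕ Fin n)

/-- The coordinate vector of a variable. -/
def symDir : Label n → E n × E n
  | .inl j => (pt 0 (EuclideanSpace.single j 1), 0)
  | .inr (.inl _) => (0, pt 1 0)
  | .inr (.inr k) => (0, pt 0 (EuclideanSpace.single k 1))

/-- The factor in front of the quantization that corresponds to a variable. -/
def mulX : Label n → E n → ℂ
  | .inl j, y => ((y.snd j : ℝ) : ℂ)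
  | .inr _, _ => 1

/-- The differential operator that corresponds to a variable. -/
def opD (μ₁ μ₂ : ℝ) : Label n → (E n → ℂ) → E n → ℂ
  | .inl _, B => B
  | .inr (.inl _), B => fun y => (μ₁ : ℂ) * Dt B y
  | .inr (.inr k), B => fun y => (μ₂ : ℂ) * Dx k B y

/-- The derivatives with respect to `θ` of a quantization `G` of `f (t, θ x, c + θ (μ₁ τ, μ₂ η))`. -/
def taylorTerm (μ₁ μ₂ : ℝ) (G : (E n → E n → ℂ) → (E n → ℂ) → E n → ℂ) :
    ℕ → (E n → E n → ℂ) → (E n → ℂ) → E n → ℂ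
  | 0, f, B => G f B
  | j + 1, f, B => fun y => ∑ i : Label n,
      mulX i y * taylorTerm μ₁ μ₂ G j (symD (symDir i) f) (opD μ₁ μ₂ i B) y

theorem contDiff_opD (μ₁ μ₂ : ℝ) (i : Label n) {B : E n → ℂ} (h : ContDiff ℝ ∞ B) :
    ContDiff ℝ ∞ (opD μ₁ μ₂ i B) := by
  rcases i with j | _ | k
  · exact h
  · exact contDiff_const.mul (contDiff_dirD _ h)
  · exact contDiff_const.mul (contDiff_dirD _ h)

theorem hasCompactSupport_opD (μ₁ μ₂ : ℝ) (i : Label n) {B : E n → ℂ} (h : HasCompactSupport B) :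
    HasCompactSupport (opD μ₁ μ₂ i B) := by
  rcases i with j | _ | k
  · exact h
  · exact (hasCompactSupport_dirD (pt 1 0) h).mul_left (f := fun _ => (μ₁ : ℂ))
  · exact (hasCompactSupport_dirD (pt 0 (EuclideanSpace.single k 1)) h).mul_left
      (f := fun _ => (μ₂ : ℂ))

theorem norm_pt_one : ‖(pt 1 0 : E n)‖ = 1 := by
  rw [pt, WithLp.prod_norm_eq_of_L2]
  simp

theorem norm_pt_single (k : Fin n) : ‖(pt 0 (EuclideanSpace.single k 1) : E n)‖ = 1 := by
  rw [pt, WithLp.prod_norm_eq_of_L2]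
  simp

theorem norm_snd_le (y : E n) : ‖y.snd‖ ≤ ‖y‖ := by
  rw [WithLp.prod_norm_eq_of_L2]
  exact Real.le_sqrt_of_sq_le (by nlinarith [sq_nonneg ‖y.fst‖])

theorem norm_fst_le (y : E n) : ‖y.fst‖ ≤ ‖y‖ := by
  rw [WithLp.prod_norm_eq_of_L2]
  exact Real.le_sqrt_of_sq_le (by nlinarith [sq_nonneg ‖y.snd‖])

theorem CkBound.const_mul {R : ℝ} {k : ℕ} {b : ℝ} {B : E n → ℂ} (h : CkBound R k b B) (c : ℂ) :
    CkBound R k (‖c‖ * b) (fun y => c * B y) := by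
  refine ⟨contDiff_const.mul h.smooth, (tsupport_mul_subset_right (f := fun _ => c)).trans h.supp, fun j hj y => ?_⟩
  rw [show (fun y => c * B y) = fun y => c • B y from rfl,
    iteratedFDeriv_const_smul_apply' (h.smooth.contDiffAt.of_le (by exact_mod_cast le_top)), norm_smul]
  gcongr
  exact h.bound j hj y

theorem CkBound.opD {R : ℝ} {k : ℕ} {b : ℝ} {B : E n → ℂ} (h : CkBound R (k + 1) b B)
    {μ₁ μ₂ : ℝ} (h₁ : μ₁ ∈ Icc (0 : ℝ) 1) (h₂ : μ₂ ∈ Icc (0 : ℝ) 1) (i : Label n) :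
    CkBound R k b (opD μ₁ μ₂ i B) := by
  have hb := h.nonneg
  rcases i with j | _ | j
  · exact h.mono (by omega) le_rfl
  · refine ((h.dirD (pt 1 0)).const_mul (μ₁ : ℂ)).mono le_rfl ?_
    rw [norm_pt_one, one_mul, Complex.norm_real, Real.norm_of_nonneg h₁.1]
    exact mul_le_of_le_one_left hb h₁.2
  · refine ((h.dirD (pt 0 (EuclideanSpace.single j 1))).const_mul (μ₂ : ℂ)).mono le_rfl ?_
    rw [norm_pt_single, one_mul, Complex.norm_real, Real.norm_of_nonneg h₂.1]
    exact mul_le_of_le_one_left hb h₂.2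

theorem norm_mulX_le (i : Label n) (y : E n) : ‖mulX i y‖ ≤ 1 + ‖y‖ := by
  rcases i with j | _
  · rw [mulX, Complex.norm_real]
    have := PiLp.norm_apply_le y.snd j
    have := norm_snd_le y
    linarith
  · simp [mulX]

theorem norm_scaleL_le {μ₁ μ₂ : ℝ} (h₁ : μ₁ ∈ Icc (0 : ℝ) 1) (h₂ : μ₂ ∈ Icc (0 : ℝ) 1) :
    ‖(scaleL μ₁ μ₂ : E n →L[ℝ] E n)‖ ≤ 1 := by
  refine ContinuousLinearMap.opNorm_le_bound _ zero_le_one fun η => ?_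
  rw [scaleL_apply, one_mul, pt, WithLp.prod_norm_eq_of_L2, WithLp.prod_norm_eq_of_L2]
  refine Real.sqrt_le_sqrt ?_
  change ‖μ₁ * η.fst‖ ^ 2 + ‖μ₂ • η.snd‖ ^ 2 ≤ ‖η.fst‖ ^ 2 + ‖η.snd‖ ^ 2
  rw [norm_mul, norm_smul, Real.norm_of_nonneg h₁.1, Real.norm_of_nonneg h₂.1]
  have e1 : μ₁ * ‖η.fst‖ ≤ ‖η.fst‖ := mul_le_of_le_one_left (norm_nonneg _) h₁.2
  have e2 : μ₂ * ‖η.snd‖ ≤ ‖η.snd‖ := mul_le_of_le_one_left (norm_nonneg _) h₂.2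
  have := h₁.1
  have := h₂.1
  gcongr

/-- Decay of the scaled quantization of a symbol of order one, uniformly in the scaling. -/
theorem norm_scaledOp_le {f : E n → E n → ℂ} (hf : IsSymbol 1 f) (R c₀ : ℝ) (K : ℕ) :
    ∃ C, 0 ≤ C ∧ ∀ θ ∈ Icc (0 : ℝ) 1, ∀ μ₁ ∈ Icc (0 : ℝ) 1, ∀ μ₂ ∈ Icc (0 : ℝ) 1,
      ∀ c : E n, ‖c‖ ≤ c₀ → ∀ (b : ℝ) (B : E n → ℂ),
      CkBound R (Module.finrank ℝ (E n) + 2) b B → ∀ y,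
      (1 + ‖y‖) ^ K * ‖scaledOp θ μ₁ μ₂ c f B y‖ ≤ C * b := by
  have := fun k => hf.norm_iteratedFDeriv_slice_le k
  choose D hD0 hD using this
  set S := ∑ j ∈ Finset.range (K + 1), D j with hS
  have hS0 : 0 ≤ S := Finset.sum_nonneg fun j _ => hD0 j
  obtain ⟨C, hC0, hC⟩ := norm_oscInt_le (V := E n) R (S * (1 + |c₀|)) K
  refine ⟨C, hC0, fun θ hθ μ₁ h₁ μ₂ h₂ c hc b B hB y => ?_⟩
  refine hC _ (hf.contDiff_slice _ _ _) (fun j hj η => ?_) b B hB y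
  set Λ : E n →L[ℝ] E n := θ • scaleL μ₁ μ₂ with hΛ
  have hΛn : ‖Λ‖ ≤ 1 := by
    rw [hΛ, norm_smul, Real.norm_of_nonneg hθ.1]
    exact mul_le_one₀ hθ.2 (norm_nonneg _) (norm_scaleL_le h₁ h₂)
  have h3 : ‖c + Λ η‖ ≤ |c₀| + ‖η‖ := by
    refine (norm_add_le _ _).trans (add_le_add (hc.trans (le_abs_self _)) ?_)
    exact (Λ.le_opNorm η).trans (mul_le_of_le_one_left (norm_nonneg _) hΛn)
  refine (hD j _ c Λ η).trans ?_
  rw [pow_one]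
  calc D j * (1 + ‖c + Λ η‖) * ‖Λ‖ ^ j ≤ S * (1 + (|c₀| + ‖η‖)) * 1 := by
        have : D j ≤ S := Finset.single_le_sum (f := D) (fun i _ => hD0 i)
          (Finset.mem_range.2 (by omega))
        have := hD0 j
        gcongr
        exact pow_le_one₀ (norm_nonneg _) hΛn
    _ ≤ S * (1 + |c₀|) * (1 + ‖η‖) := by
        rw [mul_one, mul_assoc]
        gcongr
        nlinarith [abs_nonneg c₀, norm_nonneg η, mul_nonneg (abs_nonneg c₀) (norm_nonneg η)]

/-- Each derivative in `θ` produces at most one factor $x_j$, paid for by raising `K` by one, or one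
derivative of `B`. Hence `M` additional derivatives suffice. -/
theorem norm_taylorTerm_le (R c₀ : ℝ) (M : ℕ) : ∀ {f : E n → E n → ℂ}, IsSymbol 1 f → ∀ K : ℕ,
    ∃ C, 0 ≤ C ∧ ∀ θ ∈ Icc (0 : ℝ) 1, ∀ μ₁ ∈ Icc (0 : ℝ) 1, ∀ μ₂ ∈ Icc (0 : ℝ) 1,
      ∀ c : E n, ‖c‖ ≤ c₀ → ∀ (b : ℝ) (B : E n → ℂ),
      CkBound R (Module.finrank ℝ (E n) + 2 + M) b B → ∀ y,
      (1 + ‖y‖) ^ K * ‖taylorTerm μ₁ μ₂ (scaledOp θ μ₁ μ₂ c) M f B y‖ ≤ C * b := by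
  induction M with
  | zero => intro f hf K; exact norm_scaledOp_le hf R c₀ K
  | succ M ih =>
    intro f hf K
    have := fun i : Label n => ih (hf.symD (symDir i)) (K + 1)
    choose D hD0 hD using this
    refine ⟨∑ i, D i, Finset.sum_nonneg fun i _ => hD0 i, fun θ hθ μ₁ h₁ μ₂ h₂ c hc b B hB y => ?_⟩
    rw [Finset.sum_mul]
    calc _ ≤ (1 + ‖y‖) ^ K * ∑ i, ‖mulX i y‖ *
          ‖taylorTerm μ₁ μ₂ (scaledOp θ μ₁ μ₂ c) M (symD (symDir i) f) (opD μ₁ μ₂ i B) y‖ := by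
          gcongr
          refine (norm_sum_le _ _).trans_eq (Finset.sum_congr rfl fun i _ => norm_mul _ _)
      _ = ∑ i, (1 + ‖y‖) ^ K * (‖mulX i y‖ *
          ‖taylorTerm μ₁ μ₂ (scaledOp θ μ₁ μ₂ c) M (symD (symDir i) f) (opD μ₁ μ₂ i B) y‖) :=
          Finset.mul_sum _ _ _
      _ ≤ ∑ i, D i * b := by
          refine Finset.sum_le_sum fun i _ => ?_
          refine le_trans ?_ (hD i θ hθ μ₁ h₁ μ₂ h₂ c hc b _ (hB.opD h₁ h₂ i) y)
          rw [pow_succ, mul_assoc]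
          gcongr
          exact norm_mulX_le i y

theorem scaledOp_zero (μ₁ μ₂ : ℝ) (c : E n) (f : E n → E n → ℂ) {B : E n → ℂ}
    (h : ContDiff ℝ ∞ B) (hc : HasCompactSupport B) (y : E n) :
    scaledOp 0 μ₁ μ₂ c f B y = f (pt y.fst 0) c * B y := by
  simp [scaledOp, dil, oscInt_const _ h hc]

/-- At `θ = 0` nothing nonlocal is left: the Taylor coefficients are differential operators with
coefficients polynomial in $x$. -/
theorem taylorTerm_scaledOp_zero (μ₁ μ₂ : ℝ) (c : E n) (j : ℕ) : ∀ (f : E n → E n → ℂ) {B : E n → ℂ},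
    ContDiff ℝ ∞ B → HasCompactSupport B → ∀ y : E n,
    taylorTerm μ₁ μ₂ (scaledOp 0 μ₁ μ₂ c) j f B y =
      taylorTerm μ₁ μ₂ (fun f B y => f (pt y.fst 0) c * B y) j f B y := by
  induction j with
  | zero => intro f B h hc y; exact scaledOp_zero μ₁ μ₂ c f h hc y
  | succ j ih =>
    intro f B h hc y
    simp only [taylorTerm]
    exact Finset.sum_congr rfl fun i _ => by
      rw [ih _ (contDiff_opD μ₁ μ₂ i h) (hasCompactSupport_opD μ₁ μ₂ i hc)]

theorem sum_coord_symDir (x : X n) (η : E n) (μ₁ μ₂ : ℝ) (ℓ : E n × E n →L[ℝ] ℂ) :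
    ℓ (pt 0 x, scaleL μ₁ μ₂ η) = (∑ j, ((x j : ℝ) : ℂ) * ℓ (symDir (.inl j))) +
      (((μ₁ * η.fst : ℝ) : ℂ) * ℓ (symDir (.inr (.inl ()))) +
      ∑ k, ((μ₂ * η.snd k : ℝ) : ℂ) * ℓ (symDir (.inr (.inr k)))) := by
  have hx : ∀ x : X n, x = ∑ j, x j • EuclideanSpace.single j (1 : ℝ) := by
    intro x
    ext i
    simp [Finset.sum_apply, Pi.single_apply]
  have hpt : ∀ x : X n, (pt 0 x : E n) = ∑ j, x j • pt 0 (EuclideanSpace.single j (1 : ℝ)) := by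
    intro x
    refine E_ext ?_ ?_
    · have := map_sum (WithLp.fstL 2 ℝ ℝ (X n)) (fun j => x j • pt 0 (EuclideanSpace.single j (1 : ℝ))) Finset.univ
      refine Eq.trans ?_ this.symm
      simp
    · have := map_sum (WithLp.sndL 2 ℝ ℝ (X n)) (fun j => x j • pt 0 (EuclideanSpace.single j (1 : ℝ))) Finset.univ
      refine Eq.trans ?_ this.symm
      simpa using hx x
  have hdec : ((pt 0 x, scaleL μ₁ μ₂ η) : E n × E n) = (∑ j, x j • symDir (.inl j)) +
      ((μ₁ * η.fst) • symDir (.inr (.inl ())) + ∑ k, (μ₂ * η.snd k) • symDir (.inr (.inr k))) := by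
    refine Prod.ext ?_ ?_
    · simp [symDir, Prod.fst_sum, hpt x]
    · have h1 : (scaleL μ₁ μ₂ η : E n) = (μ₁ * η.fst) • pt 1 0 + pt 0 (μ₂ • η.snd) :=
        E_ext (by simp [scaleL_apply]) (by simp [scaleL_apply])
      simp [symDir, Prod.snd_sum, h1, hpt (μ₂ • η.snd)]
  rw [hdec]
  simp only [map_add, map_sum, map_smul, Complex.real_smul]

theorem fourier_const_mul (c : ℂ) (B : E n → ℂ) (ζ : E n) :
    𝓕 (fun y => c * B y) ζ = c * 𝓕 B ζ := by
  simp only [Real.fourier_eq, ← integral_const_mul]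
  refine integral_congr_ae (.of_forall fun z => ?_)
  simp only [Circle.smul_def, smul_eq_mul]
  ring

/-- Differentiation under the integral along the path $(\theta x, c+\theta\Lambda\eta)$. The chain
rule brings out the components of $\eta$ as factors, which the Fourier transform converts into
derivatives of `B`. -/
theorem hasDerivAt_scaledOp {f : E n → E n → ℂ} (hf : IsSymbol 1 f) (μ₁ μ₂ : ℝ) (c : E n)
    {B : E n → ℂ} (h : ContDiff ℝ ∞ B) (hc : HasCompactSupport B) (y : E n) (θ : ℝ) :
    HasDerivAt (fun θ => scaledOp θ μ₁ μ₂ c f B y)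
      (taylorTerm μ₁ μ₂ (scaledOp θ μ₁ μ₂ c) 1 f B y) θ := by
  set F' : ℝ → E n → ℂ := fun θ ζ => ∑ i : Label n, mulX i y * oscKernel
    (fun η => symD (symDir i) f (dil θ y) (c + (θ • scaleL μ₁ μ₂) η)) (opD μ₁ μ₂ i B) y ζ with hF'
  have hgrow : ∀ g : E n → E n → ℂ, IsSymbol 1 g → ∃ C, 0 ≤ C ∧ ∀ θ' ∈ Metric.ball θ 1, ∀ η : E n,
      ‖g (dil θ' y) (c + (θ' • scaleL μ₁ μ₂) η)‖ ≤ C * (1 + ‖η‖) ^ 1 := by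
    intro g hg
    obtain ⟨C, hC0, hC⟩ := hg.exists_norm_le
    set s := ‖(scaleL μ₁ μ₂ : E n →L[ℝ] E n)‖
    refine ⟨C * (1 + ‖c‖ + (|θ| + 1) * s), by positivity, fun θ' hθ' η => (hC _ _).trans ?_⟩
    have h1 := norm_add_le c ((θ' • scaleL μ₁ μ₂ : E n →L[ℝ] E n) η)
    have h2 := (scaleL μ₁ μ₂ : E n →L[ℝ] E n).le_opNorm η
    have h3 : ‖(θ' • scaleL μ₁ μ₂ : E n →L[ℝ] E n) η‖ ≤ (|θ| + 1) * (s * ‖η‖) := by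
      rw [smul_apply, norm_smul]
      gcongr
      rw [Metric.mem_ball, Real.dist_eq] at hθ'
      have := abs_sub_abs_le_abs_sub θ' θ
      rw [Real.norm_eq_abs]
      linarith
    rw [pow_one, pow_one, mul_assoc]
    have hs : 0 ≤ s := norm_nonneg _
    gcongr
    nlinarith [norm_nonneg η, norm_nonneg c, mul_nonneg (norm_nonneg c) (norm_nonneg η),
      mul_nonneg (by positivity : 0 ≤ |θ| + 1) hs]
  have hcont : ∀ g : E n → E n → ℂ, IsSymbol 1 g → ∀ θ' : ℝ,
      Continuous fun η : E n => g (dil θ' y) (c + (θ' • scaleL μ₁ μ₂) η) := fun g hg θ' =>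
    (hg.contDiff_slice _ _ _).continuous
  have := fun i => hgrow _ (hf.symD (symDir i))
  choose D hD0 hD using this
  obtain ⟨C, hC0, hC⟩ := hgrow f hf
  have hθ : θ ∈ Metric.ball θ 1 := Metric.mem_ball_self one_pos
  have hpos : Metric.ball θ 1 ∈ nhds θ := Metric.ball_mem_nhds θ one_pos
  -- The majorants `D i * (1 + ‖η‖)` hold for all parameters within distance one of `θ`; the
  -- corresponding kernels are integrable since `𝓕` of each `opD` term decays rapidly.
  set bound : E n → ℝ := fun ζ => ∑ i : Label n, ‖mulX i y‖ *
    ‖oscKernel (fun η => ((D i * (1 + ‖η‖) ^ 1 : ℝ) : ℂ)) (opD μ₁ μ₂ i B) y ζ‖ with hbound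
  have hmain := hasDerivAt_integral_of_dominated_loc_of_deriv_le (μ := volume) (bound := bound)
    (F := fun θ ζ => oscKernel (fun η => f (dil θ y) (c + (θ • scaleL μ₁ μ₂) η)) B y ζ)
    (F' := F') (x₀ := θ) hpos
    (.of_forall fun θ' => (continuous_oscKernel (hcont f hf θ') h hc y).aestronglyMeasurable)
    (integrable_oscKernel (hcont f hf θ) (hC θ hθ) h hc y)
    ?_ ?_ ?_ ?_
  · refine hmain.2.congr_deriv ?_
    simp only [hF', taylorTerm]
    rw [integral_finsetSum]
    · exact Finset.sum_congr rfl fun i _ => integral_const_mul _ _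
    · exact fun i _ => (integrable_oscKernel (hcont _ (hf.symD _) θ) (hD i θ hθ)
        (contDiff_opD μ₁ μ₂ i h) (hasCompactSupport_opD μ₁ μ₂ i hc) y).const_mul _
  · refine Continuous.aestronglyMeasurable ?_
    exact continuous_finsetSum _ fun i _ => continuous_const.mul
      (continuous_oscKernel (hcont _ (hf.symD _) θ) (contDiff_opD μ₁ μ₂ i h)
        (hasCompactSupport_opD μ₁ μ₂ i hc) y)
  · refine .of_forall fun ζ θ' hθ' => ?_
    refine (norm_sum_le _ _).trans (Finset.sum_le_sum fun i _ => ?_)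
    rw [norm_mul, norm_oscKernel, norm_oscKernel, Complex.norm_real, Real.norm_of_nonneg
      (by have := hD0 i; positivity)]
    gcongr
    exact hD i θ' hθ' _
  · refine integrable_finsetSum _ fun i _ => (Integrable.norm ?_).const_mul _
    refine integrable_oscKernel (C := D i) (m := 1) (by fun_prop) (fun η => ?_)
      (contDiff_opD μ₁ μ₂ i h) (hasCompactSupport_opD μ₁ μ₂ i hc) y
    rw [Complex.norm_real, Real.norm_of_nonneg (by have := hD0 i; positivity)]
  · refine .of_forall fun ζ θ' _ => ?_
    simp only [oscKernel, hF']
    set η := (2 * Real.pi) • ζ with hη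
    have hpath : HasDerivAt (fun θ : ℝ => (dil θ y, c + (θ • scaleL μ₁ μ₂) η))
        (pt 0 y.snd, scaleL μ₁ μ₂ η) θ' := by
      refine HasDerivAt.prodMk ?_ ?_
      · have h1 : (fun θ : ℝ => dil θ y) = fun θ => pt y.fst 0 + θ • pt 0 y.snd := by
          funext θ
          exact E_ext (by simp [dil]) (by simp [dil])
        rw [h1]
        simpa using ((hasDerivAt_id θ').smul_const (pt 0 y.snd)).const_add (pt y.fst 0)
      · simpa using ((hasDerivAt_id θ').smul_const (scaleL μ₁ μ₂ η)).const_add c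
    have hfd := ((hf.1.differentiable (by simp)) (dil θ' y, c + (θ' • scaleL μ₁ μ₂) η)).hasFDerivAt
    have h2 := hfd.comp_hasDerivAt θ' hpath
    have h3 := (h2.const_mul (Complex.exp (Complex.I * ((2 * Real.pi * inner ℝ y ζ : ℝ) : ℂ)))).mul_const
      (𝓕 B ζ)
    refine h3.congr_deriv ?_
    rw [sum_coord_symDir]
    simp only [Fintype.sum_sum_type, Finset.univ_unique, Finset.sum_singleton, mulX, opD, symD,
      fourier_const_mul, Dt_eq_dirD, Dx_eq_dirD, fourier_dirD _ h hc, ← hη]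
    simp only [inner_E, pt_fst, pt_snd, inner_zero_left, EuclideanSpace.inner_single_left]
    simp only [mul_add, add_mul, Finset.mul_sum, Finset.sum_mul]
    congr 1
    · exact Finset.sum_congr rfl fun j _ => by ring
    · congr 1
      · simp; ring
      · refine Finset.sum_congr rfl fun j _ => ?_
        simp
        ring

theorem hasDerivAt_taylorTerm (μ₁ μ₂ : ℝ) (c : E n) (y : E n) (θ : ℝ) (j : ℕ) :
    ∀ {f : E n → E n → ℂ}, IsSymbol 1 f → ∀ {B : E n → ℂ}, ContDiff ℝ ∞ B → HasCompactSupport B →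
    HasDerivAt (fun θ => taylorTerm μ₁ μ₂ (scaledOp θ μ₁ μ₂ c) j f B y)
      (taylorTerm μ₁ μ₂ (scaledOp θ μ₁ μ₂ c) (j + 1) f B y) θ := by
  induction j with
  | zero => intro f hf B h hc; exact hasDerivAt_scaledOp hf μ₁ μ₂ c h hc y θ
  | succ j ih =>
    intro f hf B h hc
    exact HasDerivAt.fun_sum fun i _ => (ih (hf.symD _) (contDiff_opD μ₁ μ₂ i h)
      (hasCompactSupport_opD μ₁ μ₂ i hc)).const_mul _

/-- Taylor's formula at `0` for a sequence of successive derivatives. -/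
theorem norm_sub_taylor_le {C : ℝ} (M : ℕ) : ∀ (g : ℕ → ℝ → ℂ),
    (∀ j < M, ∀ θ, HasDerivAt (g j) (g (j + 1) θ) θ) → (∀ θ ∈ Icc (0 : ℝ) 1, ‖g M θ‖ ≤ C) →
    ∀ θ ∈ Icc (0 : ℝ) 1,
      ‖g 0 θ - ∑ j ∈ Finset.range M, ((θ ^ j / j.factorial : ℝ) : ℂ) * g j 0‖ ≤ C * θ ^ M := by
  induction M with
  | zero => intro g _ hC θ hθ; simpa using hC θ hθ
  | succ M ih =>
    intro g hg hC θ hθ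
    set G : ℝ → ℂ := fun s => g 0 s - ∑ j ∈ Finset.range (M + 1), ((s ^ j / j.factorial : ℝ) : ℂ) * g j 0
    set G' : ℝ → ℂ := fun s => g 1 s -
      ∑ j ∈ Finset.range M, ((s ^ j / j.factorial : ℝ) : ℂ) * g (j + 1) 0
    have hder : ∀ s, HasDerivAt G (G' s) s := by
      intro s
      refine (hg 0 (by omega) s).sub ?_
      have : ∀ j ∈ Finset.range (M + 1), HasDerivAt (fun s : ℝ => ((s ^ j / j.factorial : ℝ) : ℂ) * g j 0)
          (((j * s ^ (j - 1) / j.factorial : ℝ) : ℂ) * g j 0) s := fun j _ =>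
        (((hasDerivAt_pow j s).div_const _).ofReal_comp).mul_const _
      refine (HasDerivAt.fun_sum this).congr_deriv ?_
      rw [Finset.sum_range_succ']
      simp only [Nat.cast_zero, zero_mul, zero_div, Complex.ofReal_zero, add_zero]
      refine Finset.sum_congr rfl fun j _ => ?_
      congr 2
      rw [Nat.factorial_succ, Nat.add_sub_cancel]
      push_cast
      have : (j : ℝ) + 1 ≠ 0 := by positivity
      have : (j.factorial : ℝ) ≠ 0 := by positivity
      field_simp
    have hG0 : G 0 = 0 := by
      simp only [G]
      rw [Finset.sum_range_succ']
      simp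
    -- The derivative of the remainder is the remainder of the shifted sequence. Bounding it by a
    -- constant on `[0, θ]` loses the usual factorial, which is not needed.
    have hbd : ∀ s ∈ Icc (0 : ℝ) θ, ‖G' s‖ ≤ C * θ ^ M := by
      intro s hs
      have hs1 : s ∈ Icc (0 : ℝ) 1 := ⟨hs.1, hs.2.trans hθ.2⟩
      refine (ih (fun j => g (j + 1)) (fun j hj => hg (j + 1) (by omega)) hC s hs1).trans ?_
      have : 0 ≤ C := (norm_nonneg _).trans (hC 0 (by simp))
      have := hs.1
      gcongr
      exact hs.2
    have := (convex_Icc (0 : ℝ) θ).norm_image_sub_le_of_norm_hasDerivWithin_le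
      (fun s _ => (hder s).hasDerivWithinAt) hbd (left_mem_Icc.2 hθ.1) (right_mem_Icc.2 hθ.1)
    rw [hG0, sub_zero, sub_zero, Real.norm_of_nonneg hθ.1] at this
    refine this.trans_eq ?_
    rw [pow_succ, mul_assoc]

/-- The expansion of the scaled quantization in powers of `θ`. -/
theorem scaledOp_taylor {f : E n → E n → ℂ} (hf : IsSymbol 1 f) (R c₀ : ℝ) (M K : ℕ) :
    ∃ C, 0 ≤ C ∧ ∀ θ ∈ Icc (0 : ℝ) 1, ∀ μ₁ ∈ Icc (0 : ℝ) 1, ∀ μ₂ ∈ Icc (0 : ℝ) 1,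
      ∀ c : E n, ‖c‖ ≤ c₀ → ∀ (b : ℝ) (B : E n → ℂ),
      CkBound R (Module.finrank ℝ (E n) + 2 + M) b B → ∀ y,
      ‖scaledOp θ μ₁ μ₂ c f B y - ∑ j ∈ Finset.range M, ((θ ^ j / j.factorial : ℝ) : ℂ) *
        taylorTerm μ₁ μ₂ (fun f B y => f (pt y.fst 0) c * B y) j f B y‖ ≤
          C * b * θ ^ M * ((1 + ‖y‖) ^ K)⁻¹ := by
  obtain ⟨C, hC0, hC⟩ := norm_taylorTerm_le (n := n) R c₀ M hf K
  refine ⟨C, hC0, fun θ hθ μ₁ h₁ μ₂ h₂ c hc b B hB y => ?_⟩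
  have := norm_sub_taylor_le (C := C * b * ((1 + ‖y‖) ^ K)⁻¹) M
    (fun j θ => taylorTerm μ₁ μ₂ (scaledOp θ μ₁ μ₂ c) j f B y)
    (fun j _ θ => hasDerivAt_taylorTerm μ₁ μ₂ c y θ j hf hB.smooth hB.hasCompactSupport)
    (fun θ' hθ' => by
      rw [← div_eq_mul_inv, le_div_iff₀ (by positivity), mul_comm]
      exact hC θ' hθ' μ₁ h₁ μ₂ h₂ c hc b B hB y) θ hθ
  simp only [taylorTerm_scaledOp_zero μ₁ μ₂ c _ f hB.smooth hB.hasCompactSupport] at this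
  refine this.trans_eq ?_
  ring

end Taylor

/-! ### Non-degenerate covectors and the transport system. -/

section Transport

variable {n : ℕ}

/-- Pointwise decay gives square integrability. -/
theorem exists_eLpNorm_le (n : ℕ) : ∃ C : ℝ, 0 ≤ C ∧ ∀ A : ℝ, 0 ≤ A → ∀ f : E n → ℂ,
    (∀ y, ‖f y‖ ≤ A * ((1 + ‖y‖) ^ (Module.finrank ℝ (E n) + 1))⁻¹) →
    eLpNorm f 2 volume ≤ ENNReal.ofReal (C * A) := by
  set g : E n → ℝ := fun y => ((1 + ‖y‖) ^ (Module.finrank ℝ (E n) + 1))⁻¹ with hg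
  have hgi : Integrable g := integrable_one_add_norm_pow_inv
  have hg1 : ∀ y, g y ≤ 1 := fun y => inv_le_one_of_one_le₀ (one_le_pow₀ (by linarith [norm_nonneg y]))
  have hg0 : ∀ y, 0 ≤ g y := fun y => by positivity
  have hmem : MemLp g 2 volume := by
    rw [memLp_two_iff_integrable_sq hgi.aestronglyMeasurable]
    refine hgi.mono' (hgi.aestronglyMeasurable.pow 2) (.of_forall fun y => ?_)
    rw [Real.norm_of_nonneg (by positivity), pow_two]
    exact mul_le_of_le_one_left (hg0 y) (hg1 y)
  refine ⟨(eLpNorm g 2 volume).toReal, ENNReal.toReal_nonneg, fun A hA f hf => ?_⟩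
  have h1 : eLpNorm f 2 volume ≤ eLpNorm (A • g) 2 volume :=
    eLpNorm_mono_real (fun y => by simpa using hf y)
  refine h1.trans_eq ?_
  rw [eLpNorm_const_smul, mul_comm, ENNReal.ofReal_mul ENNReal.toReal_nonneg,
    ENNReal.ofReal_toReal hmem.eLpNorm_ne_top, Real.enorm_of_nonneg hA]

/-- A symmetric bilinear form that vanishes on the diagonal vanishes identically, by polarization,
and then its matrix is zero. -/
theorem exists_q0_ne_zero (hn : 0 < n) (q : Fin n → Fin n → E n → X n → ℝ)
    (hsymm : ∀ j k y ξ, q j k y ξ = q k j y ξ)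
    (hnondeg : (Matrix.of fun j k => q j k (pt 0 0) 0).det ≠ 0) : ∃ ξ : X n, q0 q ξ 0 ≠ 0 := by
  by_contra! hall
  have hsum : ∀ (v w : X n), ∑ j, ∑ k, q j k (pt 0 0) 0 * v j * w k =
      ∑ j, ∑ k, q j k (pt 0 0) 0 * w j * v k := by
    intro v w
    rw [Finset.sum_comm]
    refine Finset.sum_congr rfl fun j _ => Finset.sum_congr rfl fun k _ => ?_
    rw [hsymm]
    ring
  have hbil : ∀ v w : X n, ∑ j, ∑ k, q j k (pt 0 0) 0 * v j * w k = 0 := by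
    intro v w
    have h1 := hall (v + w)
    have h2 := hall v
    have h3 := hall w
    have h4 := hsum v w
    simp only [q0, PiLp.add_apply, mul_add, add_mul, Finset.sum_add_distrib] at h1 h2 h3
    linarith
  apply hnondeg
  have hzero : (Matrix.of fun j k => q j k (pt 0 0) 0) = 0 := by
    ext j k
    have := hbil (EuclideanSpace.single j 1) (EuclideanSpace.single k 1)
    simpa [Pi.single_apply] using this
  -- The empty matrix has determinant one, so positivity of `n` enters here.
  have : Nonempty (Fin n) := ⟨⟨0, hn⟩⟩
  rw [hzero, Matrix.det_zero]

theorem contDiff_pt {F : Type*} [NormedAddCommGroup F] [NormedSpace ℝ F] {f : F → ℝ} {g : F → X n}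
    (hf : ContDiff ℝ ∞ f) (hg : ContDiff ℝ ∞ g) : ContDiff ℝ ∞ fun z => (pt (f z) (g z) : E n) :=
  ((WithLp.prodContinuousLinearEquiv 2 ℝ ℝ (X n)).symm.contDiff).comp (hf.prodMk hg)

theorem contDiff_fst_E : ContDiff ℝ ∞ fun y : E n => y.fst := (WithLp.fstL 2 ℝ ℝ (X n)).contDiff

theorem contDiff_snd_E : ContDiff ℝ ∞ fun y : E n => y.snd := (WithLp.sndL 2 ℝ ℝ (X n)).contDiff

theorem contDiff_q0 {q : Fin n → Fin n → E n → X n → ℝ} (hq : ∀ j k, IsSymbol 0 (q j k)) (ξ : X n) :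
    ContDiff ℝ ∞ (q0 q ξ) := by
  refine ContDiff.sum fun j _ => ContDiff.sum fun k _ => ?_
  refine ContDiff.mul (ContDiff.mul ?_ contDiff_const) contDiff_const
  exact (hq j k).1.comp ((contDiff_pt contDiff_id contDiff_const).prodMk contDiff_const)

theorem exists_q0_ne_zero_near (hn : 0 < n) (q : Fin n → Fin n → E n → X n → ℝ)
    (hq : ∀ j k, IsSymbol 0 (q j k)) (hsymm : ∀ j k y ξ, q j k y ξ = q k j y ξ)
    (hnondeg : (Matrix.of fun j k => q j k (pt 0 0) 0).det ≠ 0) :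
    ∃ ξ : X n, ∃ δ > 0, ∀ t ∈ Icc (-δ) δ, q0 q ξ t ≠ 0 := by
  obtain ⟨ξ, hξ⟩ := exists_q0_ne_zero hn q hsymm hnondeg
  have hev := ((contDiff_q0 hq ξ).continuous.tendsto 0).eventually_ne hξ
  obtain ⟨δ, hδ, h⟩ := Metric.eventually_nhds_iff.1 hev
  refine ⟨ξ, δ / 2, by positivity, fun t ht => h ?_⟩
  rw [Real.dist_eq, sub_zero]
  exact (abs_le.2 ⟨ht.1, ht.2⟩).trans_lt (by linarith)

/-- Controls the cost, of order $h^\beta$, of replacing the covector $h^\beta\xi$ by $0$ in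
$q_{jk}$. -/
theorem IsSymbol.norm_sub_zero_le {f : E n → E n → ℂ} (hf : IsSymbol 1 f) :
    ∃ C, 0 ≤ C ∧ ∀ y c : E n, ‖f y c - f y 0‖ ≤ C * (1 + ‖c‖) * ‖c‖ := by
  obtain ⟨C, hC0, hC⟩ := hf.norm_iteratedFDeriv_slice_le 1
  refine ⟨C, hC0, fun y c => ?_⟩
  have hs : ContDiff ℝ ∞ fun η => f y η := hf.1.comp (contDiff_const.prodMk contDiff_id)
  have hb : ∀ η ∈ Metric.closedBall (0 : E n) ‖c‖, ‖fderiv ℝ (fun η => f y η) η‖ ≤ C * (1 + ‖c‖) := by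
    intro η hη
    have h1 := hC y 0 (ContinuousLinearMap.id ℝ (E n)) η
    simp only [zero_add, ContinuousLinearMap.id_apply, norm_iteratedFDeriv_one] at h1
    refine h1.trans ?_
    have h2 : ‖ContinuousLinearMap.id ℝ (E n)‖ ≤ 1 := ContinuousLinearMap.norm_id_le
    have h3 : ‖η‖ ≤ ‖c‖ := mem_closedBall_zero_iff.1 hη
    calc C * (1 + ‖η‖) ^ 1 * ‖ContinuousLinearMap.id ℝ (E n)‖ ^ 1 ≤ C * (1 + ‖c‖) ^ 1 * 1 ^ 1 := by
          gcongr
      _ = _ := by ring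
  have := (convex_closedBall (0 : E n) ‖c‖).norm_image_sub_le_of_norm_fderiv_le
    (fun η _ => (hs.differentiable (by simp)) η) hb (Metric.mem_closedBall_self (norm_nonneg c))
    (mem_closedBall_zero_iff.2 le_rfl)
  simpa using this

theorem CkBound.add {R : ℝ} {k : ℕ} {b c : ℝ} {A B : E n → ℂ} (hA : CkBound R k b A)
    (hB : CkBound R k c B) : CkBound R k (b + c) (fun y => A y + B y) := by
  refine ⟨hA.smooth.add hB.smooth, (tsupport_add A B).trans (union_subset hA.supp hB.supp),
    fun j hj y => ?_⟩
  rw [fun_iteratedFDeriv_add_apply (hA.smooth.contDiffAt.of_le (by exact_mod_cast le_top))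
    (hB.smooth.contDiffAt.of_le (by exact_mod_cast le_top))]
  exact (norm_add_le _ _).trans (add_le_add (hA.bound j hj y) (hB.bound j hj y))

theorem CkBound.shiftD {R : ℝ} {k : ℕ} {b : ℝ} {B : E n → ℂ} (h : CkBound R (k + 1) b B)
    {μ : ℝ} (hμ : μ ∈ Icc (0 : ℝ) 1) (ξ : X n) (j : Fin n) :
    CkBound R k ((‖ξ‖ + 1) * b) (shiftD μ ξ j B) := by
  have hb := h.nonneg
  refine (((h.mono (Nat.le_succ k) le_rfl).const_mul (ξ j : ℂ)).add ((h.dirD (pt 0 (EuclideanSpace.single j 1))).const_mul (μ : ℂ))).mono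
    le_rfl ?_
  rw [norm_pt_single, one_mul, Complex.norm_real, Complex.norm_real, Real.norm_of_nonneg hμ.1, add_mul]
  have := PiLp.norm_apply_le ξ j
  have := hμ.2
  gcongr

theorem CkBound.norm_le {R : ℝ} {k : ℕ} {b : ℝ} {B : E n → ℂ} (h : CkBound R k b B) (K : ℕ) (y : E n) :
    ‖B y‖ ≤ b * (1 + |R|) ^ K * ((1 + ‖y‖) ^ K)⁻¹ := by
  have hb := h.nonneg
  by_cases hy : y ∈ tsupport B
  · have h1 : ‖y‖ ≤ |R| := (mem_closedBall_zero_iff.1 (h.supp hy)).trans (le_abs_self R)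
    rw [← div_eq_mul_inv, le_div_iff₀ (by positivity)]
    have h2 : ‖B y‖ ≤ b := by simpa using h.bound 0 (Nat.zero_le _) y
    gcongr
  · rw [image_eq_zero_of_notMem_tsupport hy, norm_zero]
    positivity

theorem Dx_shiftD (μ : ℝ) (ξ : X n) (j k : Fin n) {v : E n → ℂ} (h : ContDiff ℝ ∞ v) (y : E n) :
    Dx j (shiftD μ ξ k v) y = (ξ k : ℂ) * Dx j v y + (μ : ℂ) * Dx j (Dx k v) y := by
  have h1 : DifferentiableAt ℝ v y := (h.differentiable (by simp)) y
  have h2 : DifferentiableAt ℝ (Dx k v) y := ((contDiff_dirD (pt 0 (EuclideanSpace.single k 1)) h).differentiable (by simp)) y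
  have : fderiv ℝ (shiftD μ ξ k v) y = (ξ k : ℂ) • fderiv ℝ v y + (μ : ℂ) • fderiv ℝ (Dx k v) y := by
    unfold shiftD
    rw [fderiv_fun_add (h1.const_mul _) (h2.const_mul _), fderiv_const_mul h1, fderiv_const_mul h2]
  rw [Dx, this]
  simp only [add_apply, smul_apply, smul_eq_mul, Dx]
  ring

/-- Symmetry of `q` makes the two mixed terms equal, whence the factor 2 in front of `q1`. -/
theorem sum_q_shiftD {q : Fin n → Fin n → E n → X n → ℝ}
    (hsymm : ∀ j k y ξ, q j k y ξ = q k j y ξ) (μ : ℝ) (ξ : X n) {v : E n → ℂ} (h : ContDiff ℝ ∞ v)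
    (y : E n) :
    ∑ j, ∑ k, ((q j k (pt y.fst 0) 0 : ℝ) : ℂ) * shiftD μ ξ j (shiftD μ ξ k v) y =
      (q0 q ξ y.fst : ℂ) * v y + 2 * (μ : ℂ) * q1 q ξ v y + (μ : ℂ) ^ 2 * q2 q v y := by
  have hsw : ∑ j, ∑ k, ((q j k (pt y.fst 0) 0 : ℝ) : ℂ) * (ξ k : ℂ) * Dx j v y = q1 q ξ v y := by
    rw [q1, Finset.sum_comm]
    refine Finset.sum_congr rfl fun j _ => Finset.sum_congr rfl fun k _ => ?_
    rw [hsymm]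
    push_cast
    ring
  have h1 : ∀ j k, ((q j k (pt y.fst 0) 0 : ℝ) : ℂ) * shiftD μ ξ j (shiftD μ ξ k v) y =
      ((q j k (pt y.fst 0) 0 * ξ j * ξ k : ℝ) : ℂ) * v y +
      (μ : ℂ) * (((q j k (pt y.fst 0) 0 * ξ j : ℝ) : ℂ) * Dx k v y) +
      (μ : ℂ) * (((q j k (pt y.fst 0) 0 : ℝ) : ℂ) * (ξ k : ℂ) * Dx j v y) +
      (μ : ℂ) ^ 2 * (((q j k (pt y.fst 0) 0 : ℝ) : ℂ) * Dx j (Dx k v) y) := by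
    intro j k
    rw [shiftD, Dx_shiftD μ ξ j k h, shiftD]
    push_cast
    ring
  simp only [h1, Finset.sum_add_distrib, ← Finset.mul_sum]
  rw [hsw]
  simp only [q0, q1, q2, Complex.ofReal_sum, Finset.sum_mul]
  ring

theorem BoundedFamily.exists_ckBound {a : ℝ → E n → ℂ} (ha : BoundedFamily a) (k : ℕ) :
    ∃ R b, 0 ≤ b ∧ ∀ h ∈ Ioc (0 : ℝ) 1, CkBound R k b (a h) := by
  obtain ⟨⟨K, hK, hsupp⟩, hs, hb⟩ := ha
  obtain ⟨R, hR⟩ := hK.isBounded.subset_closedBall 0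
  choose C hC using hb
  have hC0 : ∀ j, 0 ≤ C j := fun j =>
    (norm_nonneg _).trans (hC j 1 (by simp) 0)
  refine ⟨R, ∑ j ∈ Finset.range (k + 1), C j, Finset.sum_nonneg fun j _ => hC0 j, fun h hh =>
    ⟨hs h hh, (hsupp h hh).trans hR, fun j hj y => (hC j h hh y).trans ?_⟩⟩
  exact Finset.single_le_sum (f := C) (fun i _ => hC0 i) (Finset.mem_range.2 (by omega))

theorem rpow_mem_Icc {h : ℝ} (hh : h ∈ Ioc (0 : ℝ) 1) {r : ℝ} (hr : 0 ≤ r) : h ^ r ∈ Icc (0 : ℝ) 1 :=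
  ⟨(Real.rpow_pos_of_pos hh.1 r).le, Real.rpow_le_one hh.1.le hh.2 hr⟩

theorem norm_pt_zero (x : X n) : ‖(pt 0 x : E n)‖ = ‖x‖ := by
  rw [pt, WithLp.prod_norm_eq_of_L2]
  simp

/-- The remainder in the transport system, with its decay. -/
theorem conjP_sub_transport {q : Fin n → Fin n → E n → X n → ℝ} {b : E n → E n → ℂ}
    (hq : ∀ j k, IsSymbol 0 (q j k)) (hsymm : ∀ j k y ξ, q j k y ξ = q k j y ξ)
    (hb : IsSymbol 1 b) {β : ℝ} (hβ : 0 < β) (hβ' : β ≤ 1 / 6) (ξ : X n) {a : ℝ → E n → ℂ}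
    (ha : BoundedFamily a) (K : ℕ) :
    ∃ C : ℝ, 0 ≤ C ∧ ∀ h ∈ Ioc (0 : ℝ) 1, ∀ y,
      ‖conjP q b β ξ h (a h) y - ((h ^ (1 + 2 * β) : ℝ) : ℂ) * transport q b β ξ h (a h) y‖
          ≤ C * (h ^ (1 + 2 * β) * h ^ β) * ((1 + ‖y‖) ^ K)⁻¹ := by
  -- The count is `finrank + 2` for the decay, one for the first order Taylor remainder, and three
  -- for `Dt` and the two `shiftD`.
  obtain ⟨R, b₀, hb₀, hA⟩ := ha.exists_ckBound (Module.finrank ℝ (E n) + 2 + 1 + 1 + 1 + 1)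
  have := fun j k => scaledOp_taylor (isSymbol_liftSymbol (hq j k)) R ‖ξ‖ 1 K
  choose D hD0 hD using this
  obtain ⟨D', hD'0, hD'⟩ := scaledOp_taylor hb R ‖ξ‖ 1 K
  have := fun j k => (isSymbol_liftSymbol (hq j k)).norm_sub_zero_le
  choose G hG0 hG using this
  set b₁ := (‖ξ‖ + 1) * ((‖ξ‖ + 1) * b₀) with hb₁
  have hb₁0 : 0 ≤ b₁ := by positivity
  refine ⟨(∑ j, ∑ k, (D j k * b₁ + G j k * (1 + ‖ξ‖) * ‖ξ‖ * (b₁ * (1 + |R|) ^ K))) + D' * b₀,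
    add_nonneg (Finset.sum_nonneg fun j _ => Finset.sum_nonneg fun k _ => ?_) (by positivity),
    fun h hh y => ?_⟩
  · have := hD0 j k
    have := hG0 j k
    positivity
  set μ := h ^ (1 - 4 * β) with hμ
  set c : E n := pt 0 (h ^ β • ξ) with hc
  set W := ((1 + ‖y‖) ^ K)⁻¹ with hW
  have hW0 : 0 ≤ W := by positivity
  have hμ1 : μ ∈ Icc (0 : ℝ) 1 := rpow_mem_Icc hh (by linarith)
  have hθ := rpow_mem_Icc hh (r := 3 * β) (by linarith)
  have hm₁ := rpow_mem_Icc hh (r := 1 - 3 * β) (by linarith)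
  -- Nonnegativity of this exponent is the condition $\beta\le1/6$.
  have hm₂ := rpow_mem_Icc hh (r := 1 - 6 * β) (by linarith)
  have hhb := rpow_mem_Icc hh hβ.le
  have hcn : ‖c‖ ≤ h ^ β * ‖ξ‖ := by
    rw [hc, norm_pt_zero, norm_smul, Real.norm_of_nonneg hhb.1]
  have hcn' : ‖c‖ ≤ ‖ξ‖ := hcn.trans (mul_le_of_le_one_left (norm_nonneg _) hhb.2)
  have hA' := hA h hh
  have hDt : CkBound R (Module.finrank ℝ (E n) + 2 + 1 + 1 + 1) b₀ (Dt (a h)) :=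
    (hA'.dirD (pt 1 0)).mono le_rfl (by rw [norm_pt_one, one_mul])
  have hB : ∀ j k, CkBound R (Module.finrank ℝ (E n) + 2 + 1) b₁
      (shiftD μ ξ j (shiftD μ ξ k (Dt (a h)))) := fun j k => (hDt.shiftD hμ1 ξ k).shiftD hμ1 ξ j
  have h3β : h ^ (3 * β) ≤ h ^ β := Real.rpow_le_rpow_of_exponent_ge hh.1 hh.2 (by linarith)
  have hqest : ∀ j k, ‖scaledOp (h ^ (3 * β)) (h ^ (1 - 3 * β)) (h ^ (1 - 6 * β)) c
      (liftSymbol (q j k)) (shiftD μ ξ j (shiftD μ ξ k (Dt (a h)))) y -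
      ((q j k (pt y.fst 0) 0 : ℝ) : ℂ) * shiftD μ ξ j (shiftD μ ξ k (Dt (a h))) y‖ ≤
      (D j k * b₁ + G j k * (1 + ‖ξ‖) * ‖ξ‖ * (b₁ * (1 + |R|) ^ K)) * (h ^ β * W) := by
    intro j k
    have h1 := hD j k _ hθ _ hm₁ _ hm₂ c hcn' _ _ (hB j k) y
    simp only [Finset.range_one, Finset.sum_singleton, pow_zero, Nat.factorial_zero, Nat.cast_one,
      div_one, Complex.ofReal_one, one_mul, pow_one, taylorTerm] at h1
    have h2 := hG j k (pt y.fst 0) c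
    have h3 := (hB j k).norm_le K y
    have h4 : liftSymbol (q j k) (pt y.fst 0) 0 = ((q j k (pt y.fst 0) 0 : ℝ) : ℂ) := rfl
    rw [← h4]
    set Bv := shiftD μ ξ j (shiftD μ ξ k (Dt (a h))) y
    have h5 : ‖(liftSymbol (q j k) (pt y.fst 0) c - liftSymbol (q j k) (pt y.fst 0) 0) * Bv‖ ≤
        G j k * (1 + ‖ξ‖) * (h ^ β * ‖ξ‖) * (b₁ * (1 + |R|) ^ K * W) := by
      rw [norm_mul]
      have := hG0 j k
      refine mul_le_mul (h2.trans ?_) h3 (norm_nonneg _) (by have := hhb.1; positivity)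
      gcongr
    have h6 := (norm_add_le _ _).trans (add_le_add h1 h5)
    have h7 : D j k * b₁ * h ^ (3 * β) * W ≤ D j k * b₁ * h ^ β * W := by
      have := hD0 j k
      gcongr
    refine le_trans (le_of_eq ?_) (h6.trans ((add_le_add_left h7 _).trans_eq ?_))
    · congr 1
      ring
    · ring
  have hbest : ‖scaledOp (h ^ (3 * β)) (h ^ (1 - 3 * β)) (h ^ (1 - 6 * β)) c b (a h) y -
      bh b β ξ h y.fst * a h y‖ ≤ D' * b₀ * h ^ (3 * β) * W := by
    have h1 := hD' _ hθ _ hm₁ _ hm₂ c hcn' _ _ (hA'.mono (l := Module.finrank ℝ (E n) + 2 + 1) (by omega) le_rfl) y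
    simp only [Finset.range_one, Finset.sum_singleton, pow_zero, Nat.factorial_zero, Nat.cast_one,
      div_one, Complex.ofReal_one, one_mul, pow_one, taylorTerm] at h1
    exact h1
  have hexp : conjP q b β ξ h (a h) y - ((h ^ (1 + 2 * β) : ℝ) : ℂ) * transport q b β ξ h (a h) y =
      ((h ^ (1 + 2 * β) : ℝ) : ℂ) * (∑ j, ∑ k, (scaledOp (h ^ (3 * β)) (h ^ (1 - 3 * β)) (h ^ (1 - 6 * β)) c
      (liftSymbol (q j k)) (shiftD μ ξ j (shiftD μ ξ k (Dt (a h)))) y -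
      ((q j k (pt y.fst 0) 0 : ℝ) : ℂ) * shiftD μ ξ j (shiftD μ ξ k (Dt (a h))) y)) +
      (h : ℂ) * (scaledOp (h ^ (3 * β)) (h ^ (1 - 3 * β)) (h ^ (1 - 6 * β)) c b (a h) y -
        bh b β ξ h y.fst * a h y) := by
    rw [conjP_eq q b hq hb β ξ hh.1 hA'.smooth hA'.hasCompactSupport y]
    simp only [Finset.sum_sub_distrib]
    rw [sum_q_shiftD hsymm μ ξ hDt.smooth y, transport]
    have e1 : ((h ^ (1 + 2 * β) : ℝ) : ℂ) * ((h ^ (1 - 2 * β) : ℝ) : ℂ) = ((h ^ 2 : ℝ) : ℂ) := by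
      rw [← Complex.ofReal_mul, ← Real.rpow_add hh.1]
      congr 1
      rw [← Real.rpow_natCast]
      congr 1
      push_cast
      ring
    have e2 : ((h ^ (1 + 2 * β) : ℝ) : ℂ) * ((h ^ (-2 * β) : ℝ) : ℂ) = (h : ℂ) := by
      rw [← Complex.ofReal_mul, ← Real.rpow_add hh.1]
      congr 1
      rw [show 1 + 2 * β + -2 * β = 1 by ring, Real.rpow_one]
    have e3 : h ^ (2 * (1 - 4 * β)) = μ ^ 2 := by
      rw [hμ, ← Real.rpow_natCast, ← Real.rpow_mul hh.1.le]
      congr 1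
      push_cast
      ring
    rw [e3, ← hμ, ← e1]
    push_cast at e2 ⊢
    linear_combination (- (bh b β ξ h y.fst * a h y)) * e2
  rw [hexp]
  refine (norm_add_le _ _).trans ?_
  rw [norm_mul, norm_mul, Complex.norm_real, Complex.norm_real, Real.norm_of_nonneg hh.1.le,
    Real.norm_of_nonneg (Real.rpow_pos_of_pos hh.1 _).le]
  have hs : ‖∑ j, ∑ k, (scaledOp (h ^ (3 * β)) (h ^ (1 - 3 * β)) (h ^ (1 - 6 * β)) c
      (liftSymbol (q j k)) (shiftD μ ξ j (shiftD μ ξ k (Dt (a h)))) y -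
      ((q j k (pt y.fst 0) 0 : ℝ) : ℂ) * shiftD μ ξ j (shiftD μ ξ k (Dt (a h))) y)‖ ≤
      (∑ j, ∑ k, (D j k * b₁ + G j k * (1 + ‖ξ‖) * ‖ξ‖ * (b₁ * (1 + |R|) ^ K))) * (h ^ β * W) := by
    simp only [Finset.sum_mul]
    exact (norm_sum_le _ _).trans (Finset.sum_le_sum fun j _ => (norm_sum_le _ _).trans
      (Finset.sum_le_sum fun k _ => hqest j k))
  -- The term with $b$ has the prefactor $h$ only. Its Taylor error $h^{3\beta}$ supplies the
  -- missing $h^{2\beta}$ and leaves $h^\beta$. Replacing $h^\beta\xi$ by $0$ in $b$ as well could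
  -- cost $h^{1+\beta}$, which is too much, so $b_h$ keeps this covector.
  have e4 : h * h ^ (3 * β) = h ^ (1 + 2 * β) * h ^ β := by
    rw [← Real.rpow_add hh.1]
    nth_rewrite 1 [← Real.rpow_one h]
    rw [← Real.rpow_add hh.1]
    ring_nf
  have hp := (Real.rpow_pos_of_pos hh.1 (1 + 2 * β)).le
  have f1 := mul_le_mul_of_nonneg_left hs hp
  have f2 := mul_le_mul_of_nonneg_left hbest hh.1.le
  refine (add_le_add f1 f2).trans_eq ?_
  rw [show h * (D' * b₀ * h ^ (3 * β) * W) = D' * b₀ * (h * h ^ (3 * β)) * W by ring, e4]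
  ring

/-- The weight of order `finrank + 1` is at most one and square integrable, so a single decay
estimate yields both norms. -/
theorem conjP_transport_bounds {q : Fin n → Fin n → E n → X n → ℝ} {b : E n → E n → ℂ}
    (hq : ∀ j k, IsSymbol 0 (q j k)) (hsymm : ∀ j k y ξ, q j k y ξ = q k j y ξ)
    (hb : IsSymbol 1 b) {β : ℝ} (hβ : 0 < β) (hβ' : β ≤ 1 / 6) (ξ : X n) {a : ℝ → E n → ℂ}
    (ha : BoundedFamily a) :
    ∃ C : ℝ, ∀ h ∈ Ioc (0 : ℝ) 1,
        (∀ y, ‖conjP q b β ξ h (a h) y - ((h ^ (1 + 2 * β) : ℝ) : ℂ) * transport q b β ξ h (a h) y‖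
          ≤ C * (h ^ (1 + 2 * β) * h ^ β)) ∧
        eLpNorm (fun y => conjP q b β ξ h (a h) y
            - ((h ^ (1 + 2 * β) : ℝ) : ℂ) * transport q b β ξ h (a h) y) 2 volume
          ≤ ENNReal.ofReal (C * (h ^ (1 + 2 * β) * h ^ β)) := by
  obtain ⟨C, hC0, hC⟩ := conjP_sub_transport hq hsymm hb hβ hβ' ξ ha (Module.finrank ℝ (E n) + 1)
  obtain ⟨D, hD0, hD⟩ := exists_eLpNorm_le n
  refine ⟨C + D * C, fun h hh => ?_⟩
  have hp : 0 ≤ h ^ (1 + 2 * β) * h ^ β := by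
    have := (Real.rpow_pos_of_pos hh.1 (1 + 2 * β)).le
    have := (Real.rpow_pos_of_pos hh.1 β).le
    positivity
  refine ⟨fun y => (hC h hh y).trans ?_, (hD _ (by positivity) _ (hC h hh)).trans ?_⟩
  · have h1 : ((1 + ‖y‖) ^ (Module.finrank ℝ (E n) + 1))⁻¹ ≤ 1 :=
      inv_le_one_of_one_le₀ (one_le_pow₀ (by linarith [norm_nonneg y]))
    calc _ ≤ C * (h ^ (1 + 2 * β) * h ^ β) * 1 := by gcongr
      _ ≤ _ := by
        rw [mul_one]
        gcongr
        exact le_add_of_nonneg_right (by positivity)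
  · apply ENNReal.ofReal_le_ofReal
    rw [← mul_assoc]
    gcongr
    exact le_add_of_nonneg_left (by positivity)

end Transport

/-! ### The explicit solution of the first transport equation. -/

section SolutionFormula

variable {n : ℕ}

theorem fderiv_mul_separated {φ : X n → ℂ} {g : ℝ → ℂ} {y : E n} {g' : ℂ}
    (hφ : DifferentiableAt ℝ φ y.snd) (hg : HasDerivAt g g' y.fst) (v : E n) :
    fderiv ℝ (fun z : E n => φ z.snd * g z.fst) y v =
      φ y.snd * (v.fst * g') + fderiv ℝ φ y.snd v.snd * g y.fst := by
  have h1 : HasFDerivAt (fun z : E n => φ z.snd) ((fderiv ℝ φ y.snd).comp (WithLp.sndL 2 ℝ ℝ (X n))) y :=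
    HasFDerivAt.comp (f := fun z : E n => z.snd) y hφ.hasFDerivAt (WithLp.sndL 2 ℝ ℝ (X n)).hasFDerivAt
  have h2 : HasFDerivAt (fun z : E n => g z.fst) ((ContinuousLinearMap.toSpanSingleton ℝ g').comp
      (WithLp.fstL 2 ℝ ℝ (X n))) y :=
    HasFDerivAt.comp (f := fun z : E n => z.fst) y hg.hasFDerivAt (WithLp.fstL 2 ℝ ℝ (X n)).hasFDerivAt
  rw [(h1.fun_mul h2).fderiv]
  simp
  ring

/-- The function `-i ∂_k φ` on `ℝⁿ`. -/
def Dcoord (k : Fin n) (φ : X n → ℂ) : X n → ℂ := dirD (EuclideanSpace.single k 1) φ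

theorem Dt_separated {φ : X n → ℂ} {g : ℝ → ℂ} {y : E n} {g' : ℂ}
    (hφ : DifferentiableAt ℝ φ y.snd) (hg : HasDerivAt g g' y.fst) :
    Dt (fun z : E n => φ z.snd * g z.fst) y = φ y.snd * (-Complex.I * g') := by
  rw [Dt, fderiv_mul_separated hφ hg]
  simp
  ring

theorem Dx_separated {φ : X n → ℂ} {g : ℝ → ℂ} {y : E n} {g' : ℂ}
    (hφ : DifferentiableAt ℝ φ y.snd) (hg : HasDerivAt g g' y.fst) (k : Fin n) :
    Dx k (fun z : E n => φ z.snd * g z.fst) y = Dcoord k φ y.snd * g y.fst := by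
  rw [Dx, fderiv_mul_separated hφ hg, Dcoord, dirD]
  simp
  ring

theorem Dt_congr {a a' : E n → ℂ} {y : E n} (h : a =ᶠ[nhds y] a') : Dt a y = Dt a' y := by
  rw [Dt, Dt, h.fderiv_eq]

theorem Dx_congr {a a' : E n → ℂ} {y : E n} (h : a =ᶠ[nhds y] a') (k : Fin n) :
    Dx k a y = Dx k a' y := by
  rw [Dx, Dx, h.fderiv_eq]

theorem eventually_fst_mem {t₁ t₂ : ℝ} {y : E n} (hy : y.fst ∈ Ioo t₁ t₂) :
    ∀ᶠ z in nhds y, z.fst ∈ Ioo t₁ t₂ :=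
  (contDiff_fst_E (n := n)).continuous.continuousAt.eventually_mem (isOpen_Ioo.mem_nhds hy)

theorem hasDerivAt_intervalIntegral_of_continuousOn {r : ℝ → ℂ} {t₁ t₂ t₀ t : ℝ}
    (hr : ContinuousOn r (Icc t₁ t₂)) (h0 : t₀ ∈ Icc t₁ t₂) (ht : t ∈ Ioo t₁ t₂) :
    HasDerivAt (fun t => ∫ s in t₀..t, r s) (r t) t := by
  have hsub : uIcc t₀ t ⊆ Icc t₁ t₂ := uIcc_subset_Icc h0 (Ioo_subset_Icc_self ht)
  refine intervalIntegral.integral_hasDerivAt_right (hr.mono hsub).intervalIntegrable ?_ ?_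
  · exact (hr.mono Ioo_subset_Icc_self).stronglyMeasurableAtFilter isOpen_Ioo t ht
  · exact hr.continuousAt (Icc_mem_nhds ht.1 ht.2)

/-- The symbol `b (t, 0, 0, s ξ)` as a function of `(s, t)`. -/
def bCurve (b : E n → E n → ℂ) (ξ : X n) (p : ℝ × ℝ) : ℂ := b (pt p.2 0) (pt 0 (p.1 • ξ))

theorem contDiff_bCurve {b : E n → E n → ℂ} (hb : IsSymbol 1 b) (ξ : X n) :
    ContDiff ℝ ∞ (bCurve b ξ) :=
  hb.1.comp ((contDiff_pt contDiff_snd contDiff_const).prodMk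
    (contDiff_pt contDiff_const (contDiff_fst.smul contDiff_const)))

/-- The logarithmic derivative of the exponential is built to cancel the first two terms. In the
others each $D_t$ costs $h^{-2\beta}$, while derivatives in $x$ fall on `φ` alone and cost nothing.
-/
theorem solution_formula {q : Fin n → Fin n → E n → X n → ℝ} {b : E n → E n → ℂ}
    (hq : ∀ j k, IsSymbol 0 (q j k)) (hb : IsSymbol 1 b) {β : ℝ} (hβ : 0 < β) (hβ' : β ≤ 1 / 7)
    (ξ : X n) {t₁ t₂ : ℝ} (hq0 : ∀ t ∈ Icc t₁ t₂, q0 q ξ t ≠ 0) {t₀ : ℝ} (ht₀ : t₀ ∈ Icc t₁ t₂)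
    {φ : X n → ℂ} (hφ : ContDiff ℝ ∞ φ) (hφc : HasCompactSupport φ) :
    ∃ C : ℝ, ∀ h ∈ Ioc (0 : ℝ) 1, ∀ y : E n, y.fst ∈ Ioo t₁ t₂ →
        let a : E n → ℂ := fun z => φ z.snd * expFactor q b β ξ t₀ h z.fst
        ((h ^ (-2 * β) : ℝ) : ℂ) * bh b β ξ h y.fst * a y + (q0 q ξ y.fst : ℂ) * Dt a y = 0 ∧
        ‖transport q b β ξ h a y‖ ≤ C * h ^ β * ‖expFactor q b β ξ t₀ h y.fst‖ := by
  have hBs := contDiff_bCurve hb ξ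
  have hQs := contDiff_q0 hq ξ
  set B' : ℝ × ℝ → ℂ := fun p => fderiv ℝ (bCurve b ξ) p (0, 1) with hB'
  have hB's : Continuous B' := (hBs.continuous_fderiv (by simp)).clm_apply continuous_const
  set ρ : ℝ × ℝ → ℂ := fun p => bCurve b ξ p / (q0 q ξ p.2 : ℂ) with hρ
  set ρ' : ℝ × ℝ → ℂ := fun p => (B' p * (q0 q ξ p.2 : ℂ) - bCurve b ξ p * ((deriv (q0 q ξ) p.2 : ℝ) : ℂ)) /
    (q0 q ξ p.2 : ℂ) ^ 2 with hρ'
  have hQc : Continuous fun p : ℝ × ℝ => (q0 q ξ p.2 : ℂ) :=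
    Complex.continuous_ofReal.comp (hQs.continuous.comp continuous_snd)
  have hQ'c : Continuous fun p : ℝ × ℝ => ((deriv (q0 q ξ) p.2 : ℝ) : ℂ) :=
    Complex.continuous_ofReal.comp ((hQs.continuous_deriv (by simp)).comp continuous_snd)
  have hne : ∀ p ∈ Icc (0 : ℝ) 1 ×ˢ Icc t₁ t₂, (q0 q ξ p.2 : ℂ) ≠ 0 := fun p hp => by
    exact_mod_cast hq0 p.2 hp.2
  have hρc : ContinuousOn ρ (Icc (0 : ℝ) 1 ×ˢ Icc t₁ t₂) :=
    hBs.continuous.continuousOn.div hQc.continuousOn hne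
  have hρ'c : ContinuousOn ρ' (Icc (0 : ℝ) 1 ×ˢ Icc t₁ t₂) :=
    ((hB's.mul hQc).sub (hBs.continuous.mul hQ'c)).continuousOn.div (hQc.pow 2).continuousOn
      fun p hp => pow_ne_zero 2 (hne p hp)
  -- Treating $h^\beta\in[0,1]$ as a further compact variable makes the bounds for $b_h/q_0$ and its
  -- derivative in $t$ uniform in $h$.
  have hcomp : IsCompact (Icc (0 : ℝ) 1 ×ˢ Icc t₁ t₂) := isCompact_Icc.prod isCompact_Icc
  obtain ⟨C₀, hC₀⟩ := hcomp.exists_bound_of_continuousOn hρc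
  obtain ⟨C₁, hC₁⟩ := hcomp.exists_bound_of_continuousOn hρ'c
  have hφ1 : ∀ k, ContDiff ℝ ∞ (Dcoord k φ) := fun k => contDiff_dirD _ hφ
  have hφ1c : ∀ k, HasCompactSupport (Dcoord k φ) := fun k => hasCompactSupport_dirD _ hφc
  have hφ2 : ∀ j k, ContDiff ℝ ∞ (Dcoord j (Dcoord k φ)) := fun j k => contDiff_dirD _ (hφ1 k)
  have hφ2c : ∀ j k, HasCompactSupport (Dcoord j (Dcoord k φ)) := fun j k =>
    hasCompactSupport_dirD _ (hφ1c k)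
  obtain ⟨P₀, hP₀⟩ := hφc.exists_bound_of_continuous hφ.continuous
  have := fun k => (hφ1c k).exists_bound_of_continuous (hφ1 k).continuous
  choose P₁ hP₁ using this
  have := fun j k => (hφ2c j k).exists_bound_of_continuous (hφ2 j k).continuous
  choose P₂ hP₂ using this
  have := fun j k => (hq j k).exists_norm_le
  choose Q hQ0 hQ using this
  have hQ1 : ∀ j k t, ‖((q j k (pt t 0) 0 : ℝ) : ℂ)‖ ≤ Q j k := fun j k t => by
    have := hQ j k (pt t 0) 0
    rw [Complex.norm_real]
    simpa using this
  have hQb : ∀ j k t, ‖((q j k (pt t 0) 0 * ξ j : ℝ) : ℂ)‖ ≤ Q j k * ‖ξ‖ := fun j k t => by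
    have h1 := hQ1 j k t
    rw [Complex.norm_real] at h1 ⊢
    rw [norm_mul]
    exact mul_le_mul h1 (PiLp.norm_apply_le ξ j) (norm_nonneg _) (hQ0 j k)
  have hP₀0 : 0 ≤ P₀ := (norm_nonneg _).trans (hP₀ 0)
  have hP₁0 : ∀ k, 0 ≤ P₁ k := fun k => (norm_nonneg _).trans (hP₁ k 0)
  have hP₂0 : ∀ j k, 0 ≤ P₂ j k := fun j k => (norm_nonneg _).trans (hP₂ j k 0)
  set S₁ := ∑ j, ∑ k, Q j k * ‖ξ‖ * P₁ k with hS₁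
  set S₂ := ∑ j, ∑ k, Q j k * P₂ j k with hS₂
  have hS₁0 : 0 ≤ S₁ := Finset.sum_nonneg fun j _ => Finset.sum_nonneg fun k _ => by
    have := hQ0 j k; have := hP₁0 k; positivity
  have hS₂0 : 0 ≤ S₂ := Finset.sum_nonneg fun j _ => Finset.sum_nonneg fun k _ => by
    have := hQ0 j k; have := hP₂0 j k; positivity
  refine ⟨P₀ * (C₁ + C₀ * C₀) + 2 * S₁ * C₀ + S₂ * C₀, fun h hh y hy => ?_⟩
  intro a
  have hs : h ^ β ∈ Icc (0 : ℝ) 1 := rpow_mem_Icc hh hβ.le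
  have hmem : ∀ t ∈ Ioo t₁ t₂, (h ^ β, t) ∈ Icc (0 : ℝ) 1 ×ˢ Icc t₁ t₂ := fun t ht =>
    ⟨hs, Ioo_subset_Icc_self ht⟩
  have hC₀0 : 0 ≤ C₀ := (norm_nonneg _).trans (hC₀ _ (hmem _ hy))
  have hC₁0 : 0 ≤ C₁ := (norm_nonneg _).trans (hC₁ _ (hmem _ hy))
  set e := expFactor q b β ξ t₀ h with he
  set k2 : ℝ := h ^ (-2 * β) with hk2
  have hk2pos : 0 < k2 := Real.rpow_pos_of_pos hh.1 _
  set r : ℝ → ℂ := fun t => ρ (h ^ β, t) with hr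
  have hrc : ContinuousOn r (Icc t₁ t₂) :=
    hρc.comp (by fun_prop) fun t ht => ⟨hs, ht⟩
  have hed : ∀ t ∈ Ioo t₁ t₂, HasDerivAt e (-Complex.I * (k2 : ℂ) * r t * e t) t := by
    intro t ht
    have h1 := hasDerivAt_intervalIntegral_of_continuousOn hrc ht₀ ht
    have h2 := (h1.const_mul (-Complex.I * (k2 : ℂ))).cexp
    refine h2.congr_deriv ?_
    simp only [he, expFactor]
    rw [mul_comm]
    rfl
  have hrd : ∀ t ∈ Ioo t₁ t₂, HasDerivAt r (ρ' (h ^ β, t)) t := by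
    intro t ht
    have h1 : HasDerivAt (fun t : ℝ => ((h ^ β, t) : ℝ × ℝ)) (0, 1) t :=
      (hasDerivAt_const t (h ^ β)).prodMk (hasDerivAt_id t)
    have h2 := ((hBs.differentiable (by simp)) (h ^ β, t)).hasFDerivAt.comp_hasDerivAt t h1
    have h3 := (((hQs.differentiable (by simp)) t).hasDerivAt).ofReal_comp
    exact h2.div h3 (hne _ (hmem t ht))
  set G : ℝ → ℂ := fun t => -(k2 : ℂ) * r t * e t with hG
  set G' : ℝ → ℂ := fun t => -(k2 : ℂ) * (ρ' (h ^ β, t) - Complex.I * (k2 : ℂ) * r t * r t) * e t with hG'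
  have hGd : ∀ t ∈ Ioo t₁ t₂, HasDerivAt G (G' t) t := by
    intro t ht
    refine (((hrd t ht).const_mul (-(k2 : ℂ))).mul (hed t ht)).congr_deriv ?_
    simp only [hG']
    ring
  have hφd : ∀ x, DifferentiableAt ℝ φ x := hφ.differentiable (by simp)
  have hDa : ∀ z : E n, z.fst ∈ Ioo t₁ t₂ → Dt a z = φ z.snd * G z.fst := by
    intro z hz
    rw [Dt_separated (hφd _) (hed _ hz)]
    simp only [hG]
    linear_combination (φ z.snd * k2 * r z.fst * e z.fst) * Complex.I_sq
  have hDa' : ∀ z : E n, z.fst ∈ Ioo t₁ t₂ → Dt a =ᶠ[nhds z] fun z => φ z.snd * G z.fst :=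
    fun z hz => (eventually_fst_mem hz).mono hDa
  have hDD : Dt (Dt a) y = φ y.snd * (-Complex.I * G' y.fst) := by
    rw [Dt_congr (hDa' y hy), Dt_separated (hφd _) (hGd _ hy)]
  have hDx : ∀ k, ∀ z : E n, z.fst ∈ Ioo t₁ t₂ → Dx k (Dt a) z = Dcoord k φ z.snd * G z.fst := by
    intro k z hz
    rw [Dx_congr (hDa' z hz), Dx_separated (hφd _) (hGd _ hz)]
  have hDxx : ∀ j k, Dx j (Dx k (Dt a)) y = Dcoord j (Dcoord k φ) y.snd * G y.fst := by
    intro j k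
    rw [Dx_congr ((eventually_fst_mem hy).mono (hDx k)),
      Dx_separated ((hφ1 k).differentiable (by simp) _) (hGd _ hy)]
  have hfirst : (k2 : ℂ) * bh b β ξ h y.fst * a y + (q0 q ξ y.fst : ℂ) * Dt a y = 0 := by
    have hqn := hne _ (hmem _ hy)
    have hbb : bh b β ξ h y.fst = r y.fst * (q0 q ξ y.fst : ℂ) := by
      simp only [hr, hρ]
      rw [div_mul_cancel₀ _ hqn]
      rfl
    rw [hDa y hy, hbb]
    simp only [hG, a]
    ring
  refine ⟨hfirst, ?_⟩
  set t := y.fst with ht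
  set N := ‖e t‖ with hN
  have hN0 : 0 ≤ N := norm_nonneg _
  have hGn : ‖G t‖ ≤ k2 * C₀ * N := by
    simp only [hG, norm_mul, norm_neg, Complex.norm_real, Real.norm_of_nonneg hk2pos.le]
    gcongr
    exact hC₀ _ (hmem _ hy)
  have hk21 : 1 ≤ k2 := Real.one_le_rpow_of_pos_of_le_one_of_nonpos hh.1 hh.2 (by linarith)
  have hG'n : ‖G' t‖ ≤ k2 * k2 * (C₁ + C₀ * C₀) * N := by
    simp only [hG', norm_mul, norm_neg, Complex.norm_real, Real.norm_of_nonneg hk2pos.le]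
    rw [mul_assoc k2 k2]
    gcongr
    refine (norm_sub_le _ _).trans ?_
    simp only [norm_mul, Complex.norm_I, Complex.norm_real, Real.norm_of_nonneg hk2pos.le, one_mul]
    have h1 := hC₁ _ (hmem _ hy)
    have h0 : ‖r t‖ ≤ C₀ := hC₀ _ (hmem _ hy)
    have h2 : k2 * ‖r t‖ * ‖r t‖ ≤ k2 * C₀ * C₀ := by gcongr
    nlinarith
  have hq1 : ‖q1 q ξ (Dt a) y‖ ≤ S₁ * (k2 * C₀ * N) := by
    rw [q1, hS₁, Finset.sum_mul]
    refine (norm_sum_le _ _).trans (Finset.sum_le_sum fun j _ => ?_)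
    rw [Finset.sum_mul]
    refine (norm_sum_le _ _).trans (Finset.sum_le_sum fun k _ => ?_)
    rw [norm_mul, hDx k y hy, norm_mul, ← mul_assoc]
    have := hQ0 j k
    have := hP₁0 k
    gcongr
    · exact hQb j k _
    · exact hP₁ k _
  have hq2 : ‖q2 q (Dt a) y‖ ≤ S₂ * (k2 * C₀ * N) := by
    rw [q2, hS₂, Finset.sum_mul]
    refine (norm_sum_le _ _).trans (Finset.sum_le_sum fun j _ => ?_)
    rw [Finset.sum_mul]
    refine (norm_sum_le _ _).trans (Finset.sum_le_sum fun k _ => ?_)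
    rw [norm_mul, hDxx, norm_mul, ← mul_assoc]
    have := hQ0 j k
    have := hP₂0 j k
    gcongr
    · exact hQ1 j k _
    · exact hP₂ j k _
  have hDDn : ‖Dt (Dt a) y‖ ≤ P₀ * (k2 * k2 * (C₁ + C₀ * C₀) * N) := by
    rw [hDD]
    simp only [norm_mul, norm_neg, Complex.norm_I, one_mul]
    gcongr
    exact hP₀ _
  have p1 : 0 < h ^ (1 - 2 * β) := Real.rpow_pos_of_pos hh.1 _
  have p2 : 0 < h ^ (1 - 4 * β) := Real.rpow_pos_of_pos hh.1 _
  have p3 : 0 < h ^ (2 * (1 - 4 * β)) := Real.rpow_pos_of_pos hh.1 _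
  -- The powers are $h^{1-6\beta}$ for $D_1^2$ and for $q_1D_1$, and $h^{2-10\beta}$ for $q_2D_1$.
  -- The first two are at most $h^\beta$ exactly because $\beta\le1/7$.
  have x1 : h ^ (1 - 2 * β) * (k2 * k2) ≤ h ^ β := by
    rw [← Real.rpow_add hh.1, ← Real.rpow_add hh.1]
    exact Real.rpow_le_rpow_of_exponent_ge hh.1 hh.2 (by linarith)
  have x2 : h ^ (1 - 4 * β) * k2 ≤ h ^ β := by
    rw [← Real.rpow_add hh.1]
    exact Real.rpow_le_rpow_of_exponent_ge hh.1 hh.2 (by linarith)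
  have x3 : h ^ (2 * (1 - 4 * β)) * k2 ≤ h ^ β := by
    rw [← Real.rpow_add hh.1]
    exact Real.rpow_le_rpow_of_exponent_ge hh.1 hh.2 (by linarith)
  rw [transport, hfirst, zero_add]
  refine (norm_add₃_le).trans ?_
  simp only [norm_mul, Complex.norm_real]
  rw [Real.norm_of_nonneg p1.le, Real.norm_of_nonneg p3.le, Real.norm_of_nonneg p2.le,
    Real.norm_of_nonneg (by norm_num : (0 : ℝ) ≤ 2)]
  have y1 := mul_le_mul_of_nonneg_left hDDn p1.le
  have y2 := mul_le_mul_of_nonneg_left hq1 (by positivity : 0 ≤ 2 * h ^ (1 - 4 * β))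
  have y3 := mul_le_mul_of_nonneg_left hq2 p3.le
  have z1 := mul_le_mul_of_nonneg_right x1 (by positivity : 0 ≤ P₀ * (C₁ + C₀ * C₀) * N)
  have z2 := mul_le_mul_of_nonneg_right x2 (by positivity : 0 ≤ 2 * S₁ * C₀ * N)
  have z3 := mul_le_mul_of_nonneg_right x3 (by positivity : 0 ≤ S₂ * C₀ * N)
  refine (add_le_add (add_le_add y1 y2) y3).trans ?_
  linarith

end SolutionFormula

/-! ### Smooth families in a parameter, differential operators, and conjugation by a phase. -/

section Families

variable {n : ℕ}

/-- Induction on the order by differentiating under the integral. The target space is quantified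
inside the induction, because the derivative takes values in `H →L[ℝ] F`. -/
theorem contDiff_nat_intervalIntegral {H : Type} [NormedAddCommGroup H] [NormedSpace ℝ H]
    [FiniteDimensional ℝ H] (m : ℕ) : ∀ {F : Type} [NormedAddCommGroup F] [NormedSpace ℝ F]
    [CompleteSpace F] {g : H × ℝ → F}, ContDiff ℝ m g →
    ContDiff ℝ m fun z => ∫ r in (0 : ℝ)..1, g (z, r) := by
  induction m with
  | zero =>
    intro F _ _ _ g hg
    rw [Nat.cast_zero, contDiff_zero] at hg ⊢
    exact intervalIntegral.continuous_parametric_intervalIntegral_of_continuous'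
      (f := fun z r => g (z, r)) hg 0 1
  | succ m ih =>
    intro F _ _ _ g hg
    have hfd : ContDiff ℝ m (fderiv ℝ g) := hg.fderiv_right (by norm_cast)
    set g' : H × ℝ → H →L[ℝ] F := fun p => (fderiv ℝ g p).comp (ContinuousLinearMap.inl ℝ H ℝ) with hg'
    have hg's : ContDiff ℝ m g' := hfd.clm_comp contDiff_const
    have hdiff : Differentiable ℝ g := hg.differentiable (by norm_cast)
    have hder : ∀ z, HasFDerivAt (fun z => ∫ r in (0 : ℝ)..1, g (z, r))
        (∫ r in (0 : ℝ)..1, g' (z, r)) z := by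
      intro z₀
      have hK : IsCompact (Metric.closedBall z₀ 1 ×ˢ Icc (0 : ℝ) 1) :=
        (isCompact_closedBall z₀ 1).prod isCompact_Icc
      obtain ⟨C, hC⟩ := hK.exists_bound_of_continuousOn hg's.continuous.continuousOn
      refine intervalIntegral.hasFDerivAt_integral_of_dominated_of_fderiv_le
        (F := fun z r => g (z, r)) (F' := fun z r => g' (z, r)) (bound := fun _ => C)
        (Metric.closedBall_mem_nhds z₀ one_pos) ?_ ?_ ?_ ?_ ?_ ?_
      · exact .of_forall fun z => (hg.continuous.comp (by fun_prop)).aestronglyMeasurable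
      · exact (hg.continuous.comp (by fun_prop : Continuous fun r : ℝ => (z₀, r))).intervalIntegrable _ _
      · exact (hg's.continuous.comp (by fun_prop : Continuous fun r : ℝ => (z₀, r))).aestronglyMeasurable
      · refine .of_forall fun r hr z hz => hC (z, r) ⟨hz, ?_⟩
        rw [uIoc_of_le zero_le_one] at hr
        exact ⟨hr.1.le, hr.2⟩
      · exact intervalIntegrable_const
      · refine .of_forall fun r _ z _ => ?_
        exact (hdiff (z, r)).hasFDerivAt.comp z (hasFDerivAt_prodMk_left z r)
    rw [Nat.cast_succ, contDiff_succ_iff_fderiv]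
    refine ⟨fun z => (hder z).differentiableAt, by simp, ?_⟩
    rw [show fderiv ℝ (fun z => ∫ r in (0 : ℝ)..1, g (z, r)) =
      fun z => ∫ r in (0 : ℝ)..1, g' (z, r) from funext fun z => (hder z).fderiv]
    exact ih hg's

theorem contDiff_intervalIntegral {H : Type} [NormedAddCommGroup H] [NormedSpace ℝ H]
    [FiniteDimensional ℝ H] {F : Type} [NormedAddCommGroup F] [NormedSpace ℝ F]
    [CompleteSpace F] {g : H × ℝ → F} (hg : ContDiff ℝ ∞ g) :
    ContDiff ℝ ∞ fun z => ∫ r in (0 : ℝ)..1, g (z, r) :=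
  contDiff_infty.2 fun m => contDiff_nat_intervalIntegral m (contDiff_infty.1 hg m)

/-- The primitive in `t` that vanishes at `t₁`, of a family of functions of `(t, x)` that depends
on a parameter. -/
def timePrimitive (t₁ : ℝ) (g : ℝ × E n → ℂ) (z : ℝ × E n) : ℂ :=
  ∫ r in (0 : ℝ)..1, ((z.2.fst - t₁ : ℝ) : ℂ) * g (z.1, pt (t₁ + (z.2.fst - t₁) * r) z.2.snd)

/-- The primitive is an integral over the fixed interval $[0,1]$, so smoothness in its upper limit
and in the parameter is a single instance of differentiation under the integral. -/
theorem contDiff_timePrimitive (t₁ : ℝ) {g : ℝ × E n → ℂ} (hg : ContDiff ℝ ∞ g) :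
    ContDiff ℝ ∞ (timePrimitive t₁ g) := by
  refine contDiff_intervalIntegral (g := fun p : (ℝ × E n) × ℝ =>
    ((p.1.2.fst - t₁ : ℝ) : ℂ) * g (p.1.1, pt (t₁ + (p.1.2.fst - t₁) * p.2) p.1.2.snd)) ?_
  have h1 : ContDiff ℝ ∞ fun p : (ℝ × E n) × ℝ => p.1.2.fst :=
    contDiff_fst_E.comp (contDiff_snd.comp contDiff_fst)
  have h2 : ContDiff ℝ ∞ fun p : (ℝ × E n) × ℝ => p.1.2.snd :=
    contDiff_snd_E.comp (contDiff_snd.comp contDiff_fst)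
  refine (Complex.ofRealCLM.contDiff.comp (h1.sub contDiff_const)).mul (hg.comp ?_)
  exact (contDiff_fst.comp contDiff_fst).prodMk
    (contDiff_pt (contDiff_const.add ((h1.sub contDiff_const).mul contDiff_snd)) h2)

theorem timePrimitive_eq (t₁ : ℝ) (g : ℝ × E n → ℂ) (s : ℝ) (y : E n) :
    timePrimitive t₁ g (s, y) = ∫ r in t₁..y.fst, g (s, pt r y.snd) := by
  have := intervalIntegral.smul_integral_comp_add_mul (a := 0) (b := 1)
    (fun r => g (s, pt r y.snd)) (y.fst - t₁) t₁
  simp only [mul_zero, add_zero, mul_one, add_sub_cancel] at this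
  rw [← this, timePrimitive, intervalIntegral.integral_const_mul, Complex.real_smul]

/-- The operator `-i ∂_v` on families of functions. -/
def famD (v : E n) (a : ℝ × E n → ℂ) (z : ℝ × E n) : ℂ := -Complex.I * fderiv ℝ a z (0, v)

theorem contDiff_famD (v : E n) {a : ℝ × E n → ℂ} (h : ContDiff ℝ ∞ a) : ContDiff ℝ ∞ (famD v a) :=
  contDiff_const.mul ((h.fderiv_right (m := ∞) le_rfl).clm_apply contDiff_const)

theorem hasFDerivAt_slice {F : Type*} [NormedAddCommGroup F] [NormedSpace ℝ F] {a : ℝ × E n → F}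
    (h : ContDiff ℝ ∞ a) (s : ℝ) (y : E n) :
    HasFDerivAt (fun y => a (s, y)) ((fderiv ℝ a (s, y)).comp (ContinuousLinearMap.inr ℝ ℝ (E n))) y :=
  ((h.differentiable (by simp)) (s, y)).hasFDerivAt.comp y (hasFDerivAt_prodMk_right s y)

theorem famD_eq_dirD (v : E n) {a : ℝ × E n → ℂ} (h : ContDiff ℝ ∞ a) (s : ℝ) (y : E n) :
    famD v a (s, y) = dirD v (fun y => a (s, y)) y := by
  rw [dirD, (hasFDerivAt_slice h s y).fderiv]
  rfl

theorem famD_timePrimitive_pt (t₁ : ℝ) {g : ℝ × E n → ℂ} (hg : ContDiff ℝ ∞ g) (z : ℝ × E n) :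
    famD (pt 1 0) (timePrimitive t₁ g) z = -Complex.I * g z := by
  obtain ⟨s, y⟩ := z
  rw [famD_eq_dirD _ (contDiff_timePrimitive t₁ hg), dirD]
  congr 1
  have h1 := (hasFDerivAt_slice (contDiff_timePrimitive t₁ hg) s y).differentiableAt
  have h2 : HasDerivAt (fun r : ℝ => y + r • (pt 1 0 : E n)) (pt 1 0) 0 := by
    simpa using ((hasDerivAt_id (0 : ℝ)).smul_const (pt 1 0 : E n)).const_add y
  have h1' : HasFDerivAt (fun y => timePrimitive t₁ g (s, y))
      (fderiv ℝ (fun y => timePrimitive t₁ g (s, y)) y) (y + (0 : ℝ) • pt 1 0) := by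
    rw [zero_smul, add_zero]
    exact h1.hasFDerivAt
  have h3 := h1'.comp_hasDerivAt (0 : ℝ) h2
  have hcont : Continuous fun r : ℝ => g (s, pt r y.snd) :=
    hg.continuous.comp (continuous_const.prodMk (contDiff_pt contDiff_id contDiff_const).continuous)
  have h4 : HasDerivAt (fun r : ℝ => ∫ τ in t₁..(y.fst + r), g (s, pt τ y.snd)) (g (s, y)) 0 := by
    have h5 := (intervalIntegral.integral_hasDerivAt_right (hcont.intervalIntegrable t₁ (y.fst + 0))
      (hcont.stronglyMeasurableAtFilter _ _) hcont.continuousAt).comp_const_add y.fst 0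
    simpa using h5
  have h6 : (fun y => timePrimitive t₁ g (s, y)) ∘ (fun r : ℝ => y + r • (pt 1 0 : E n)) =
      fun r : ℝ => ∫ τ in t₁..(y.fst + r), g (s, pt τ y.snd) := by
    funext r
    simp [timePrimitive_eq]
  rw [h6] at h3
  exact h3.unique h4

theorem famD_eq_zero_of_const {a : ℝ × E n → ℂ} (v : X n)
    (h : ∀ s t (x x' : X n), a (s, pt t x) = a (s, pt t x')) (z : ℝ × E n) (hd : DifferentiableAt ℝ a z) :
    famD (pt 0 v) a z = 0 := by
  obtain ⟨s, y⟩ := z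
  have h2 : HasDerivAt (fun r : ℝ => ((s, y) : ℝ × E n) + r • ((0, pt 0 v) : ℝ × E n)) (0, pt 0 v) 0 := by
    simpa using ((hasDerivAt_id (0 : ℝ)).smul_const ((0, pt 0 v) : ℝ × E n)).const_add (s, y)
  have h1' : HasFDerivAt a (fderiv ℝ a (s, y)) ((s, y) + (0 : ℝ) • ((0, pt 0 v) : ℝ × E n)) := by
    simpa using hd.hasFDerivAt
  have h3 := h1'.comp_hasDerivAt (0 : ℝ) h2
  have h6 : a ∘ (fun r : ℝ => ((s, y) : ℝ × E n) + r • ((0, pt 0 v) : ℝ × E n)) = fun _ => a (s, y) := by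
    funext r
    have e1 : ((s, y) : ℝ × E n) + r • ((0, pt 0 v) : ℝ × E n) = (s, pt y.fst (y.snd + r • v)) :=
      Prod.ext (by simp) (E_ext (by simp) (by simp))
    simp only [Function.comp, e1]
    rw [h s y.fst (y.snd + r • v) y.snd, pt_fst_snd]
  rw [h6] at h3
  rw [famD, h3.unique (hasDerivAt_const 0 _), mul_zero]

/-- Linear differential operators in `(t, x)`, with coefficients that depend smoothly on a
parameter. -/
inductive IsDiffOp : ((ℝ × E n → ℂ) → ℝ × E n → ℂ) → Prop
  | mul (g : ℝ × E n → ℂ) (hg : ContDiff ℝ ∞ g) : IsDiffOp fun a z => g z * a z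
  | deriv (v : E n) : IsDiffOp (famD v)
  | add {P Q : (ℝ × E n → ℂ) → ℝ × E n → ℂ} : IsDiffOp P → IsDiffOp Q →
      IsDiffOp fun a z => P a z + Q a z
  | comp {P Q : (ℝ × E n → ℂ) → ℝ × E n → ℂ} : IsDiffOp P → IsDiffOp Q → IsDiffOp fun a => P (Q a)

namespace IsDiffOp

variable {P : (ℝ × E n → ℂ) → ℝ × E n → ℂ}

theorem contDiff (hP : IsDiffOp P) : ∀ {a : ℝ × E n → ℂ}, ContDiff ℝ ∞ a → ContDiff ℝ ∞ (P a) := by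
  induction hP with
  | mul g hg => exact fun h => hg.mul h
  | deriv v => exact fun h => contDiff_famD v h
  | add _ _ h1 h2 => exact fun h => (h1 h).add (h2 h)
  | comp _ _ h1 h2 => exact fun h => h1 (h2 h)

/-- Locality is what permits cutoffs: where a cutoff equals one, or a family vanishes nearby, the
operator sees no difference. -/
theorem congr (hP : IsDiffOp P) : ∀ {a a' : ℝ × E n → ℂ} {z : ℝ × E n}, a =ᶠ[nhds z] a' →
    P a =ᶠ[nhds z] P a' := by
  induction hP with
  | mul g hg => exact fun h => h.mono fun w hw => by simp only [hw]
  | deriv v => exact fun h => (h.fderiv (𝕜 := ℝ)).mono fun w hw => by simp only [famD, hw]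
  | add _ _ h1 h2 =>
    intro a a' z h
    filter_upwards [h1 h, h2 h] with w e1 e2
    rw [e1, e2]
  | comp _ _ h1 h2 => exact fun h => h1 (h2 h)

theorem map_add (hP : IsDiffOp P) : ∀ {a a' : ℝ × E n → ℂ}, ContDiff ℝ ∞ a → ContDiff ℝ ∞ a' →
    P (fun z => a z + a' z) = fun z => P a z + P a' z := by
  induction hP with
  | mul g hg => exact fun _ _ => funext fun z => by ring
  | deriv v =>
    intro a a' h h'
    funext z
    simp only [famD]
    rw [fderiv_fun_add (h.differentiable (by simp) z) (h'.differentiable (by simp) z), add_apply,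
      mul_add]
  | add _ _ h1 h2 =>
    intro a a' h h'
    funext z
    simp only [h1 h h', h2 h h']
    ring
  | comp _ hQ h1 h2 =>
    intro a a' h h'
    beta_reduce
    rw [h2 h h', h1 (hQ.contDiff h) (hQ.contDiff h')]

/-- The parameter is never differentiated, so functions of it, in particular powers of $s$, pass
through. -/
theorem map_param_mul (hP : IsDiffOp P) {c : ℝ → ℂ} (hc : ContDiff ℝ ∞ c) :
    ∀ {a : ℝ × E n → ℂ}, ContDiff ℝ ∞ a → P (fun z => c z.1 * a z) = fun z => c z.1 * P a z := by
  have hc' : ContDiff ℝ ∞ fun z : ℝ × E n => c z.1 := hc.comp contDiff_fst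
  induction hP with
  | mul g hg => exact fun _ => funext fun z => by ring
  | deriv v =>
    intro a h
    funext z
    have h1 : fderiv ℝ (fun z : ℝ × E n => c z.1) z (0, v) = 0 := by
      have := ((hc.differentiable (by simp)) z.1).hasFDerivAt.comp z hasFDerivAt_fst
      rw [show (fun z : ℝ × E n => c z.1) = c ∘ Prod.fst from rfl, this.fderiv]
      simp
    simp only [famD]
    rw [fderiv_fun_mul (hc'.differentiable (by simp) z) (h.differentiable (by simp) z)]
    simp only [add_apply, smul_apply, h1, smul_eq_mul]
    ring
  | add _ _ h1 h2 =>
    intro a h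
    funext z
    simp only [h1 h, h2 h]
    ring
  | comp _ hQ h1 h2 =>
    intro a h
    beta_reduce
    rw [h2 h, h1 (hQ.contDiff h)]

theorem map_zero (hP : IsDiffOp P) : P (fun _ => 0) = fun _ => 0 := by
  have := hP.map_param_mul (c := fun _ => 0) contDiff_const (a := fun _ => 0) contDiff_const
  simpa using this

theorem id : IsDiffOp fun a : ℝ × E n → ℂ => a := by
  have := IsDiffOp.mul (fun _ : ℝ × E n => (1 : ℂ)) contDiff_const
  simpa using this

theorem mul_left (hP : IsDiffOp P) {g : ℝ × E n → ℂ} (hg : ContDiff ℝ ∞ g) :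
    IsDiffOp fun a z => g z * P a z :=
  (IsDiffOp.mul g hg).comp hP

theorem sum {ι : Type*} (s : Finset ι) {P : ι → (ℝ × E n → ℂ) → ℝ × E n → ℂ}
    (hP : ∀ i ∈ s, IsDiffOp (P i)) : IsDiffOp fun a z => ∑ i ∈ s, P i a z := by
  classical
  induction s using Finset.induction_on with
  | empty =>
    have := IsDiffOp.mul (fun _ : ℝ × E n => (0 : ℂ)) contDiff_const
    simpa using this
  | insert i s hi ih =>
    simp only [Finset.sum_insert hi]
    exact (hP i (Finset.mem_insert_self i s)).add (ih fun j hj => hP j (Finset.mem_insert_of_mem hj))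

theorem map_sum_pow (hP : IsDiffOp P) {c : ℕ → ℝ × E n → ℂ} (hc : ∀ k, ContDiff ℝ ∞ (c k)) (K : ℕ) :
    P (fun z => ∑ k ∈ Finset.range K, ((z.1 ^ k : ℝ) : ℂ) * c k z) =
      fun z => ∑ k ∈ Finset.range K, ((z.1 ^ k : ℝ) : ℂ) * P (c k) z := by
  have hpow : ∀ k : ℕ, ContDiff ℝ ∞ fun s : ℝ => ((s ^ k : ℝ) : ℂ) := fun k =>
    Complex.ofRealCLM.contDiff.comp (contDiff_id.pow k)
  have hterm : ∀ k, ContDiff ℝ ∞ fun z : ℝ × E n => ((z.1 ^ k : ℝ) : ℂ) * c k z := fun k =>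
    ((hpow k).comp contDiff_fst).mul (hc k)
  induction K with
  | zero => simpa using hP.map_zero
  | succ K ih =>
    simp only [Finset.sum_range_succ]
    rw [hP.map_add (ContDiff.sum fun k _ => hterm k) (hterm K), ih, hP.map_param_mul (hpow K) (hc K)]

end IsDiffOp

/-- The slice at the parameter `s` of the family `e^{φ / s² - γ} a`. -/
def wkb (φ : ℝ × E n → ℂ) (γ : ℂ) (s : ℝ) (a : ℝ × E n → ℂ) (y : E n) : ℂ :=
  Complex.exp (((s ^ 2)⁻¹ : ℝ) * φ (s, y) - γ) * a (s, y)

theorem contDiff_slice {F : Type*} [NormedAddCommGroup F] [NormedSpace ℝ F] {a : ℝ × E n → F}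
    (h : ContDiff ℝ ∞ a) (s : ℝ) : ContDiff ℝ ∞ fun y => a (s, y) :=
  h.comp (contDiff_prodMk_right s)

theorem contDiff_wkb {φ a : ℝ × E n → ℂ} (hφ : ContDiff ℝ ∞ φ) (γ : ℂ) (s : ℝ)
    (h : ContDiff ℝ ∞ a) : ContDiff ℝ ∞ (wkb φ γ s a) :=
  (((contDiff_const.mul (contDiff_slice hφ s)).sub contDiff_const).cexp).mul (contDiff_slice h s)

/-- The operator `s² D_v + D_v φ`, which is `s² D_v` conjugated with `e^{φ / s²}`. -/
def conjD (φ : ℝ × E n → ℂ) (v : E n) (a : ℝ × E n → ℂ) (z : ℝ × E n) : ℂ :=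
  ((z.1 ^ 2 : ℝ) : ℂ) * famD v a z + famD v φ z * a z

theorem contDiff_param_pow (k : ℕ) : ContDiff ℝ ∞ fun z : ℝ × E n => ((z.1 ^ k : ℝ) : ℂ) :=
  Complex.ofRealCLM.contDiff.comp (contDiff_fst.pow k)

theorem isDiffOp_conjD {φ : ℝ × E n → ℂ} (hφ : ContDiff ℝ ∞ φ) (v : E n) : IsDiffOp (conjD φ v) :=
  ((IsDiffOp.deriv v).mul_left (contDiff_param_pow 2)).add (IsDiffOp.mul _ (contDiff_famD v hφ))

/-- The singular factor $s^{-2}$ stays outside `conjD`, whose coefficients are smooth at $s=0$. -/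
theorem dirD_wkb {φ a : ℝ × E n → ℂ} (hφ : ContDiff ℝ ∞ φ) (h : ContDiff ℝ ∞ a) (γ : ℂ) {s : ℝ}
    (hs : s ≠ 0) (v : E n) :
    dirD v (wkb φ γ s a) = wkb φ γ s (fun z => (((s ^ 2)⁻¹ : ℝ) : ℂ) * conjD φ v a z) := by
  funext y
  have h1 := (((hasFDerivAt_slice hφ s y).const_mul ((((s ^ 2)⁻¹ : ℝ) : ℂ))).sub_const γ).cexp
  have h2 := h1.mul (hasFDerivAt_slice h s y)
  have hs' : (s : ℂ) ≠ 0 := by exact_mod_cast hs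
  rw [dirD, show fderiv ℝ (wkb φ γ s a) y = _ from h2.fderiv]
  simp only [wkb, conjD, famD]
  simp
  field_simp
  ring

theorem dirD_wkb_of_eq_zero {φ a : ℝ × E n → ℂ} (hφ : ContDiff ℝ ∞ φ) (h : ContDiff ℝ ∞ a) (γ : ℂ)
    {s : ℝ} (hs : s ≠ 0) {v : E n} (hv : ∀ z, famD v φ z = 0) :
    dirD v (wkb φ γ s a) = wkb φ γ s (famD v a) := by
  rw [dirD_wkb hφ h γ hs]
  funext y
  have hs' : (s : ℂ) ≠ 0 := by exact_mod_cast hs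
  simp only [wkb, conjD, hv]
  push_cast
  field_simp
  ring

end Families

/-! ### Action of the expanded operator on oscillating families, for `β = 1/7`. -/

section WkbExpansion

variable {n : ℕ}

/-- The quantization of `f (t, 0, c)`. -/
def frozenOp (c : E n) (f : E n → E n → ℂ) (B : E n → ℂ) (y : E n) : ℂ := f (pt y.fst 0) c * B y

/-- The coefficient `f (t, 0, 0, s ξ)`. -/
def symFam (ξ : X n) (f : E n → E n → ℂ) (z : ℝ × E n) : ℂ := bCurve f ξ (z.1, z.2.fst)

theorem contDiff_symFam {f : E n → E n → ℂ} (hf : IsSymbol 1 f) (ξ : X n) :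
    ContDiff ℝ ∞ (symFam ξ f) :=
  (contDiff_bCurve hf ξ).comp (contDiff_fst.prodMk (contDiff_fst_E.comp contDiff_snd))

theorem Dt_wkb {φ a : ℝ × E n → ℂ} (hφ : ContDiff ℝ ∞ φ) (h : ContDiff ℝ ∞ a) (γ : ℂ) {s : ℝ}
    (hs : s ≠ 0) : Dt (wkb φ γ s a) =
      wkb φ γ s (fun z => (((s ^ 2)⁻¹ : ℝ) : ℂ) * conjD φ (pt 1 0) a z) := by
  rw [Dt_eq_dirD, dirD_wkb hφ h γ hs]

theorem Dx_wkb {φ a : ℝ × E n → ℂ} (hφ : ContDiff ℝ ∞ φ)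
    (hφ0 : ∀ (v : X n) z, famD (pt 0 v) φ z = 0) (h : ContDiff ℝ ∞ a) (γ : ℂ) {s : ℝ}
    (hs : s ≠ 0) (j : Fin n) : Dx j (wkb φ γ s a) =
      wkb φ γ s (famD (pt 0 (EuclideanSpace.single j 1)) a) := by
  rw [Dx_eq_dirD, dirD_wkb_of_eq_zero hφ h γ hs (hφ0 _)]

theorem contDiff_mulX (i : Label n) : ContDiff ℝ ∞ (mulX i : E n → ℂ) := by
  rcases i with j | _
  · exact Complex.ofRealCLM.contDiff.comp ((EuclideanSpace.proj j).contDiff.comp contDiff_snd_E)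
  · exact contDiff_const

/-- The variable $\tau$ brings $s^4D_t$, which becomes $s^2$ times `conjD`; the variable $\xi_k$
brings $sD_k$, which does not see the phase. No negative power of $s$ remains, and `P` is one
operator for all $s$ and $\gamma$. -/
theorem exists_isDiffOp_opD {φ : ℝ × E n → ℂ} (hφ : ContDiff ℝ ∞ φ)
    (hφ0 : ∀ (v : X n) z, famD (pt 0 v) φ z = 0) (i : Label n) :
    ∃ P, IsDiffOp P ∧ ∀ s ≠ 0, ∀ γ, ∀ a : ℝ × E n → ℂ, ContDiff ℝ ∞ a →
      opD (s ^ 4) s i (wkb φ γ s a) = wkb φ γ s (P a) := by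
  rcases i with j | _ | k
  · exact ⟨_, IsDiffOp.id, fun s hs γ a ha => rfl⟩
  · refine ⟨_, (isDiffOp_conjD hφ (pt 1 0)).mul_left (contDiff_param_pow 2), fun s hs γ a ha => ?_⟩
    funext y
    have hs' : (s : ℂ) ≠ 0 := by exact_mod_cast hs
    simp only [opD, Dt_wkb hφ ha γ hs, wkb]
    push_cast
    field_simp
  · refine ⟨_, (IsDiffOp.deriv (pt 0 (EuclideanSpace.single k 1))).mul_left (contDiff_param_pow 1),
      fun s hs γ a ha => ?_⟩
    funext y
    simp only [opD, Dx_wkb hφ hφ0 ha γ hs, wkb]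
    push_cast
    ring

theorem exists_isDiffOp_taylorTerm {φ : ℝ × E n → ℂ} (hφ : ContDiff ℝ ∞ φ)
    (hφ0 : ∀ (v : X n) z, famD (pt 0 v) φ z = 0) (ξ : X n) (j : ℕ) :
    ∀ f : E n → E n → ℂ, IsSymbol 1 f →
    ∃ P, IsDiffOp P ∧ ∀ s ≠ 0, ∀ γ, ∀ a : ℝ × E n → ℂ, ContDiff ℝ ∞ a →
      taylorTerm (s ^ 4) s (frozenOp (pt 0 (s • ξ))) j f (wkb φ γ s a) = wkb φ γ s (P a) := by
  induction j with
  | zero =>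
    refine fun f hf => ⟨_, IsDiffOp.mul _ (contDiff_symFam hf ξ), fun s hs γ a ha => ?_⟩
    funext y
    simp only [taylorTerm, frozenOp, wkb, symFam, bCurve]
    ring
  | succ j ih =>
    intro f hf
    choose P hP hPe using fun i : Label n => ih _ (hf.symD (symDir i))
    choose O hO hOe using fun i : Label n => exists_isDiffOp_opD hφ hφ0 i
    refine ⟨_, IsDiffOp.sum Finset.univ fun i _ => ((hP i).comp (hO i)).mul_left
      ((contDiff_mulX i).comp contDiff_snd), fun s hs γ a ha => ?_⟩
    funext y
    simp only [taylorTerm]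
    rw [wkb, Finset.mul_sum]
    refine Finset.sum_congr rfl fun i _ => ?_
    rw [hOe i s hs γ a ha, hPe i s hs γ _ ((hO i).contDiff ha), wkb, Function.comp]
    ring

/-- The operator `ξ_j + s³ D_j` on families of functions. -/
def shiftFam (ξ : X n) (j : Fin n) (a : ℝ × E n → ℂ) (z : ℝ × E n) : ℂ :=
  (ξ j : ℂ) * a z + ((z.1 ^ 3 : ℝ) : ℂ) * famD (pt 0 (EuclideanSpace.single j 1)) a z

theorem isDiffOp_shiftFam (ξ : X n) (j : Fin n) : IsDiffOp (shiftFam ξ j) :=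
  (IsDiffOp.id.mul_left contDiff_const).add ((IsDiffOp.deriv _).mul_left (contDiff_param_pow 3))

theorem shiftD_wkb {φ a : ℝ × E n → ℂ} (hφ : ContDiff ℝ ∞ φ)
    (hφ0 : ∀ (v : X n) z, famD (pt 0 v) φ z = 0) (h : ContDiff ℝ ∞ a) (γ : ℂ) {s : ℝ}
    (hs : s ≠ 0) (ξ : X n) (j : Fin n) :
    shiftD (s ^ 3) ξ j (wkb φ γ s a) = wkb φ γ s (shiftFam ξ j a) := by
  funext y
  simp only [shiftD, Dx_wkb hφ hφ0 h γ hs, wkb, shiftFam]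
  ring

/-- The expansion to order `M + 1` of the conjugated operator, for `β = 1/7` and `h = s⁷`. -/
def conjExpansion (q : Fin n → Fin n → E n → X n → ℝ) (b : E n → E n → ℂ) (ξ : X n) (M : ℕ) (s : ℝ)
    (A : E n → ℂ) (y : E n) : ℂ :=
  ((s ^ 14 : ℝ) : ℂ) * Dt (Dt A) y
    + ((s ^ 9 : ℝ) : ℂ) * (∑ j, ∑ k, ∑ i ∈ Finset.range (M + 1),
        ((((s ^ 3) ^ i / i.factorial : ℝ)) : ℂ) *
        taylorTerm (s ^ 4) s (frozenOp (pt 0 (s • ξ))) i (liftSymbol (q j k))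
          (shiftD (s ^ 3) ξ j (shiftD (s ^ 3) ξ k (Dt A))) y)
    + ((s ^ 7 : ℝ) : ℂ) * ∑ i ∈ Finset.range (M + 1), ((((s ^ 3) ^ i / i.factorial : ℝ)) : ℂ) *
        taylorTerm (s ^ 4) s (frozenOp (pt 0 (s • ξ))) i b A y

/-- The coefficient `∑ q_{jk}(t, 0, s ξ) ξ_j ξ_k`. -/
def qCurve (q : Fin n → Fin n → E n → X n → ℝ) (ξ : X n) (p : ℝ × ℝ) : ℝ :=
  ∑ j, ∑ k, q j k (pt p.2 0) (p.1 • ξ) * ξ j * ξ k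

/-- A count of powers. The leading terms are $s^9q\,s^{-2}(s^2D_ta+(D_t\varphi)a)$ and $s^7ba$.
Everything else carries $s^{10}$: $s^{14}D_t^2$ loses $s^4$; in the $q$ terms both the derivatives
in $x$ and the higher Taylor terms gain $s^3$ over $s^7$; and so do the higher Taylor terms of $b$.
These make up $s\,R$. -/
theorem exists_isDiffOp_conjExpansion {q : Fin n → Fin n → E n → X n → ℝ} {b : E n → E n → ℂ}
    (hq : ∀ j k, IsSymbol 1 (liftSymbol (q j k))) (hb : IsSymbol 1 b) (ξ : X n) (M : ℕ)
    {φ : ℝ × E n → ℂ} (hφ : ContDiff ℝ ∞ φ) (hφ0 : ∀ (v : X n) z, famD (pt 0 v) φ z = 0) :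
    ∃ R, IsDiffOp R ∧ ∀ s ≠ 0, ∀ γ, ∀ a : ℝ × E n → ℂ, ContDiff ℝ ∞ a → ∀ y,
      conjExpansion q b ξ M s (wkb φ γ s a) y =
        ((s ^ 9 : ℝ) : ℂ) * wkb φ γ s (fun z => (qCurve q ξ (z.1, z.2.fst) : ℂ) * famD (pt 1 0) a z +
          (z.1 : ℂ) * R a z) y +
        ((s ^ 7 : ℝ) : ℂ) * wkb φ γ s (fun z => ((qCurve q ξ (z.1, z.2.fst) : ℂ) * famD (pt 1 0) φ z +
          symFam ξ b z) * a z) y := by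
  choose P hP hPe using fun (f : {f : E n → E n → ℂ // IsSymbol 1 f}) (j : ℕ) =>
    exists_isDiffOp_taylorTerm hφ hφ0 ξ j f.1 f.2
  set B : {f : E n → E n → ℂ // IsSymbol 1 f} := ⟨b, hb⟩
  set Q : Fin n → Fin n → {f : E n → E n → ℂ // IsSymbol 1 f} := fun j k => ⟨_, hq j k⟩
  set 𝓓 := conjD φ (pt 1 0) with h𝓓
  have hD : IsDiffOp 𝓓 := isDiffOp_conjD hφ _
  set w : ℕ → ℝ × E n → ℂ := fun i z => ((z.1 ^ (3 * i) : ℝ) : ℂ) * (((i + 1).factorial : ℝ) : ℂ)⁻¹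
  have hw : ∀ i, ContDiff ℝ ∞ (w i) := fun i => (contDiff_param_pow _).mul contDiff_const
  set T : Fin n → Fin n → (ℝ × E n → ℂ) → ℝ × E n → ℂ := fun j k a z =>
    (ξ j : ℂ) * famD (pt 0 (EuclideanSpace.single k 1)) a z +
      famD (pt 0 (EuclideanSpace.single j 1)) (shiftFam ξ k a) z with hT
  have hTo : ∀ j k, IsDiffOp (T j k) := fun j k =>
    ((IsDiffOp.deriv _).mul_left contDiff_const).add ((IsDiffOp.deriv _).comp (isDiffOp_shiftFam ξ k))
  set Rq : Fin n → Fin n → (ℝ × E n → ℂ) → ℝ × E n → ℂ := fun j k a z =>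
    symFam ξ (Q j k).1 z * T j k (𝓓 a) z + ∑ i ∈ Finset.range M, w i z *
      P (Q j k) (i + 1) (shiftFam ξ j (shiftFam ξ k (𝓓 a))) z with hRq
  have hRqo : ∀ j k, IsDiffOp (Rq j k) := fun j k =>
    (((hTo j k).comp hD).mul_left (contDiff_symFam (Q j k).2 ξ)).add
      (IsDiffOp.sum _ fun i _ => (((hP _ _).comp ((isDiffOp_shiftFam ξ j).comp
        ((isDiffOp_shiftFam ξ k).comp hD))).mul_left (hw i)))
  refine ⟨fun a z => (𝓓 (𝓓 a) z + ∑ j, ∑ k, Rq j k a z) +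
    ∑ i ∈ Finset.range M, w i z * P B (i + 1) a z, ?_, ?_⟩
  · exact ((hD.comp hD).add (IsDiffOp.sum _ fun j _ => IsDiffOp.sum _ fun k _ => hRqo j k)).add
      (IsDiffOp.sum _ fun i _ => (hP _ _).mul_left (hw i))
  · intro s hs γ a ha y
    have hs' : (s : ℂ) ≠ 0 := by exact_mod_cast hs
    have hc : ContDiff ℝ ∞ fun _ : ℝ => (((s ^ 2)⁻¹ : ℝ) : ℂ) := contDiff_const
    have hDa := hD.contDiff ha
    have hcD : ContDiff ℝ ∞ fun z => (((s ^ 2)⁻¹ : ℝ) : ℂ) * 𝓓 a z := contDiff_const.mul hDa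
    have e1 : Dt (wkb φ γ s a) = wkb φ γ s (fun z => (((s ^ 2)⁻¹ : ℝ) : ℂ) * 𝓓 a z) :=
      Dt_wkb hφ ha γ hs
    have e2 : Dt (Dt (wkb φ γ s a)) y = (((s ^ 2)⁻¹ : ℝ) : ℂ) ^ 2 * wkb φ γ s (𝓓 (𝓓 a)) y := by
      rw [e1, Dt_wkb hφ hcD γ hs, ← h𝓓, hD.map_param_mul hc hDa]
      simp only [wkb]
      ring
    have e3 : ∀ j k, shiftD (s ^ 3) ξ j (shiftD (s ^ 3) ξ k (Dt (wkb φ γ s a))) =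
        wkb φ γ s (fun z => (((s ^ 2)⁻¹ : ℝ) : ℂ) * shiftFam ξ j (shiftFam ξ k (𝓓 a)) z) := by
      intro j k
      have hk := (isDiffOp_shiftFam ξ k).contDiff hDa
      rw [e1, shiftD_wkb hφ hφ0 hcD γ hs, (isDiffOp_shiftFam ξ k).map_param_mul hc hDa,
        shiftD_wkb hφ hφ0 (contDiff_const.mul hk) γ hs, (isDiffOp_shiftFam ξ j).map_param_mul hc hk]
    have e4 : ∀ j k z, shiftFam ξ j (shiftFam ξ k (𝓓 a)) z = (ξ j : ℂ) * ξ k * 𝓓 a z +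
        ((z.1 ^ 3 : ℝ) : ℂ) * T j k (𝓓 a) z := by
      intro j k z
      rw [shiftFam, hT]
      conv_lhs => rw [show shiftFam ξ k (𝓓 a) z = _ from rfl, shiftFam]
      ring
    set e := Complex.exp (((s ^ 2)⁻¹ : ℝ) * φ (s, y) - γ) with he
    have e5 : ∀ (f : {f : E n → E n → ℂ // IsSymbol 1 f}) (g : ℝ × E n → ℂ), ContDiff ℝ ∞ g →
        ∑ i ∈ Finset.range (M + 1), ((((s ^ 3) ^ i / i.factorial : ℝ)) : ℂ) *
        taylorTerm (s ^ 4) s (frozenOp (pt 0 (s • ξ))) i f.1 (wkb φ γ s g) y =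
        e * (symFam ξ f.1 (s, y) * g (s, y) + ((s ^ 3 : ℝ) : ℂ) *
          ∑ i ∈ Finset.range M, w i (s, y) * P f (i + 1) g (s, y)) := by
      intro f g hg
      rw [Finset.sum_range_succ', mul_add, Finset.mul_sum, Finset.mul_sum, add_comm]
      congr 1
      · simp only [taylorTerm, frozenOp, wkb, symFam, bCurve, ← he]
        simp
        ring
      · refine Finset.sum_congr rfl fun i _ => ?_
        rw [hPe f (i + 1) s hs γ g hg, wkb, ← he]
        simp only [w]
        push_cast
        ring
    have e6 : ∀ j k, ((s ^ 9 : ℝ) : ℂ) * (∑ i ∈ Finset.range (M + 1),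
        ((((s ^ 3) ^ i / i.factorial : ℝ)) : ℂ) *
        taylorTerm (s ^ 4) s (frozenOp (pt 0 (s • ξ))) i (liftSymbol (q j k))
          (shiftD (s ^ 3) ξ j (shiftD (s ^ 3) ξ k (Dt (wkb φ γ s a)))) y) =
        e * ((s : ℂ) ^ 7 * ((q j k (pt y.fst 0) (s • ξ) * ξ j * ξ k : ℝ) : ℂ) * 𝓓 a (s, y) +
          (s : ℂ) ^ 10 * Rq j k a (s, y)) := by
      intro j k
      have hjk := (isDiffOp_shiftFam ξ j).contDiff ((isDiffOp_shiftFam ξ k).contDiff hDa)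
      have := e5 (Q j k) _ (contDiff_const.mul hjk : ContDiff ℝ ∞ fun z => (((s ^ 2)⁻¹ : ℝ) : ℂ) *
        shiftFam ξ j (shiftFam ξ k (𝓓 a)) z)
      rw [e3, this]
      have h1 : ∀ i, P (Q j k) (i + 1) (fun z => (((s ^ 2)⁻¹ : ℝ) : ℂ) *
          shiftFam ξ j (shiftFam ξ k (𝓓 a)) z) (s, y) = (((s ^ 2)⁻¹ : ℝ) : ℂ) *
          P (Q j k) (i + 1) (shiftFam ξ j (shiftFam ξ k (𝓓 a))) (s, y) := fun i => by
        rw [(hP _ _).map_param_mul hc hjk]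
      have h2 : ∑ i ∈ Finset.range M, w i (s, y) * P (Q j k) (i + 1) (fun z => (((s ^ 2)⁻¹ : ℝ) : ℂ) *
          shiftFam ξ j (shiftFam ξ k (𝓓 a)) z) (s, y) = (((s ^ 2)⁻¹ : ℝ) : ℂ) *
          ∑ i ∈ Finset.range M, w i (s, y) *
            P (Q j k) (i + 1) (shiftFam ξ j (shiftFam ξ k (𝓓 a))) (s, y) := by
        rw [Finset.mul_sum]
        exact Finset.sum_congr rfl fun i _ => by rw [h1]; ring
      rw [h2, e4]
      simp only [hRq]
      have h3 : symFam ξ (Q j k).1 (s, y) = ((q j k (pt y.fst 0) (s • ξ) : ℝ) : ℂ) := rfl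
      rw [h3]
      push_cast
      field_simp
      ring
    rw [conjExpansion, e2, Finset.mul_sum]
    simp only [Finset.mul_sum ((Finset.univ : Finset (Fin n)))]
    simp only [e6]
    rw [e5 B a ha]
    have hq' : (qCurve q ξ (s, y.fst) : ℂ) = ∑ j, ∑ k,
        ((q j k (pt y.fst 0) (s • ξ) * ξ j * ξ k : ℝ) : ℂ) := by
      simp only [qCurve, Complex.ofReal_sum]
    simp only [← Finset.mul_sum, Finset.sum_add_distrib, ← Finset.sum_mul, ← hq', wkb, ← he]
    have h4 : 𝓓 a (s, y) = ((s ^ 2 : ℝ) : ℂ) * famD (pt 1 0) a (s, y) + famD (pt 1 0) φ (s, y) * a (s, y) :=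
      rfl
    rw [h4]
    push_cast
    field_simp
    ring

end WkbExpansion

/-! ### Uniform estimates for oscillating families and for the Taylor remainder. -/

section WkbEstimates

variable {n : ℕ}

theorem norm_iteratedFDeriv_family_le {a : ℝ × E n → ℂ} (ha : ContDiff ℝ ∞ a) (k : ℕ) (s : ℝ)
    (y : E n) : ‖iteratedFDeriv ℝ k (fun y => a (s, y)) y‖ ≤ ‖iteratedFDeriv ℝ k a (s, y)‖ := by
  set g : E n →L[ℝ] ℝ × E n := ContinuousLinearMap.inr ℝ ℝ (E n) with hg
  set a' : ℝ × E n → ℂ := fun z => a (z + (s, 0)) with ha'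
  have hs : ContDiff ℝ ∞ a' := ha.comp (contDiff_id.add contDiff_const)
  have h3 : (fun y => a (s, y)) = a' ∘ g := by
    funext y
    simp [ha', hg]
  rw [h3, g.iteratedFDeriv_comp_right hs y (i := k) (by exact_mod_cast le_top)]
  refine (ContinuousMultilinearMap.norm_compContinuousLinearMap_le _ _).trans ?_
  rw [Finset.prod_const, Finset.card_univ, Fintype.card_fin, ha',
    iteratedFDeriv_comp_add_right (𝕜 := ℝ) (f := a) k (s, 0) (g y)]
  have h4 : g y + (s, 0) = (s, y) := by simp [hg]
  rw [h4]
  refine mul_le_of_le_one_right (norm_nonneg _) (pow_le_one₀ (norm_nonneg _) ?_)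
  exact ContinuousLinearMap.opNorm_le_bound _ zero_le_one fun x => by simp [hg]

theorem exists_norm_iteratedFDeriv_family_le {a : ℝ × E n → ℂ} (ha : ContDiff ℝ ∞ a) {K : Set (E n)}
    (hK : IsCompact K) (k : ℕ) : ∃ C, 0 ≤ C ∧ ∀ j ≤ k, ∀ s ∈ Icc (0 : ℝ) 1, ∀ y ∈ K,
      ‖iteratedFDeriv ℝ j (fun y => a (s, y)) y‖ ≤ C := by
  have : ∀ j, ∃ C, ∀ z ∈ Icc (0 : ℝ) 1 ×ˢ K, ‖iteratedFDeriv ℝ j a z‖ ≤ C := fun j =>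
    (isCompact_Icc.prod hK).exists_bound_of_continuousOn
      (ha.continuous_iteratedFDeriv (m := j) (by exact_mod_cast le_top)).continuousOn
  choose C hC using this
  refine ⟨∑ j ∈ Finset.range (k + 1), |C j|, Finset.sum_nonneg fun j _ => abs_nonneg _,
    fun j hj s hs y hy => ?_⟩
  refine (norm_iteratedFDeriv_family_le ha j s y).trans ((hC j (s, y) ⟨hs, hy⟩).trans ?_)
  exact (le_abs_self _).trans (Finset.single_le_sum (f := fun j => |C j|) (fun i _ => abs_nonneg _)
    (Finset.mem_range.2 (by omega)))

/-- Subtracting the value at `y` from the exponent moves the derivatives of `exp` to the point 0,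
and the factor taken out has modulus at most one. The constant in the chain rule bound is then
independent of the value of `f`. -/
theorem norm_iteratedFDeriv_cexp_le {V : Type*} [NormedAddCommGroup V] [NormedSpace ℝ V] {f : V → ℂ}
    (hf : ContDiff ℝ ∞ f) (k : ℕ) {y : V} {D : ℝ} (hre : (f y).re ≤ 0)
    (hD : ∀ i, 1 ≤ i → i ≤ k → ‖iteratedFDeriv ℝ i f y‖ ≤ D ^ i) {j : ℕ} (hj : j ≤ k) :
    ‖iteratedFDeriv ℝ j (fun y => Complex.exp (f y)) y‖ ≤
      j.factorial * (∑ i ∈ Finset.range (k + 1), ‖iteratedFDeriv ℝ i Complex.exp 0‖) * D ^ j := by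
  have hf' : ContDiff ℝ ∞ fun z => f z - f y := hf.sub contDiff_const
  have h1 : (fun z => Complex.exp (f z)) =
      fun z => Complex.exp (f y) • (Complex.exp ∘ fun z => f z - f y) z := by
    funext z
    rw [Function.comp, smul_eq_mul, ← Complex.exp_add]
    ring_nf
  have hs : ContDiff ℝ ∞ (Complex.exp ∘ fun z => f z - f y) := hf'.cexp
  rw [h1, iteratedFDeriv_const_smul_apply' (hs.contDiffAt.of_le (by exact_mod_cast le_top)), norm_smul,
    Complex.norm_exp]
  refine (mul_le_of_le_one_left (norm_nonneg _) (Real.exp_le_one_iff.2 hre)).trans ?_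
  refine norm_iteratedFDeriv_comp_le (N := j) (Complex.contDiff_exp) (hf'.of_le (by exact_mod_cast le_top)) le_rfl y
    (fun i hi => ?_) (fun i hi hij => ?_)
  · rw [sub_self]
    exact Finset.single_le_sum (f := fun i => ‖iteratedFDeriv ℝ i Complex.exp 0‖)
      (fun i _ => norm_nonneg _) (Finset.mem_range.2 (by omega))
  · rw [fun_iteratedFDeriv_sub_apply (hf.contDiffAt.of_le (by exact_mod_cast le_top))
      contDiffAt_const, iteratedFDeriv_const_of_ne (by omega)]
    simpa using hD i hi (hij.trans hj)

/-- Bounds for the derivatives of oscillating families. -/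
theorem exists_ckBound_wkb {φ a : ℝ × E n → ℂ} (hφ : ContDiff ℝ ∞ φ) (ha : ContDiff ℝ ∞ a)
    {K : Set (E n)} (hK : IsCompact K) {R : ℝ} (hKR : K ⊆ Metric.closedBall 0 R)
    (hsupp : ∀ s, ∀ y ∉ K, a (s, y) = 0) (k : ℕ) :
    ∃ C, 0 ≤ C ∧ ∀ s ∈ Ioc (0 : ℝ) 1, ∀ m : ℝ, (∀ y ∈ K, (s ^ 2)⁻¹ * (φ (s, y)).re - m ≤ 0) →
      CkBound R k (C * ((s ^ 2)⁻¹) ^ k) (wkb φ (m : ℂ) s a) := by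
  obtain ⟨D₀, hD₀0, hD₀⟩ := exists_norm_iteratedFDeriv_family_le hφ hK k
  obtain ⟨A, hA0, hA⟩ := exists_norm_iteratedFDeriv_family_le ha hK k
  -- The added one makes $Ds^{-2}\ge1$, so that a bound linear in it may be weakened to any positive
  -- power.
  set D := D₀ + 1
  set Ce := ∑ i ∈ Finset.range (k + 1), ‖iteratedFDeriv ℝ i Complex.exp (0 : ℂ)‖ with hCe
  have hCe0 : 0 ≤ Ce := Finset.sum_nonneg fun i _ => norm_nonneg _
  have hD1 : 1 ≤ D := by simp only [D]; linarith
  refine ⟨2 ^ k * (k.factorial * Ce * D ^ k) * A, by positivity, fun s hs m hm => ?_⟩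
  have hs2 : 1 ≤ (s ^ 2)⁻¹ := (one_le_inv₀ (by have := hs.1; positivity)).2
    (pow_le_one₀ hs.1.le hs.2)
  have hts : tsupport (wkb φ (m : ℂ) s a) ⊆ K := by
    refine closure_minimal (fun y hy => ?_) hK.isClosed
    by_contra h
    exact hy (by rw [wkb, hsupp s y h, mul_zero])
  refine ⟨contDiff_wkb hφ _ s ha, hts.trans hKR, fun j hj y => ?_⟩
  by_cases hy : y ∈ K
  swap
  · have : iteratedFDeriv ℝ j (wkb φ (m : ℂ) s a) y = 0 := by
      by_contra h
      exact hy (hts (support_iteratedFDeriv_subset j h))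
    rw [this, norm_zero]
    positivity
  set f : E n → ℂ := fun y => ((s ^ 2)⁻¹ : ℝ) * φ (s, y) - m with hf
  have hg : ContDiff ℝ ∞ fun y => (((s ^ 2)⁻¹ : ℝ) : ℂ) • φ (s, y) :=
    (contDiff_const (c := (((s ^ 2)⁻¹ : ℝ) : ℂ))).mul (contDiff_slice hφ s)
  have hfs : ContDiff ℝ ∞ f := hg.sub contDiff_const
  have hsI : s ∈ Icc (0 : ℝ) 1 := ⟨hs.1.le, hs.2⟩
  have hre : (f y).re ≤ 0 := by
    have := hm y hy
    simp only [hf, Complex.sub_re, Complex.re_ofReal_mul, Complex.ofReal_re]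
    exact this
  have hDs : 1 ≤ D * (s ^ 2)⁻¹ := one_le_mul_of_one_le_of_one_le hD1 hs2
  have hfd : ∀ i, 1 ≤ i → i ≤ k → ‖iteratedFDeriv ℝ i f y‖ ≤ (D * (s ^ 2)⁻¹) ^ i := by
    intro i hi hik
    have h1 : iteratedFDeriv ℝ i f y = iteratedFDeriv ℝ i (fun y => (((s ^ 2)⁻¹ : ℝ) : ℂ) • φ (s, y)) y := by
      rw [hf]
      have := fun_iteratedFDeriv_sub_apply (i := i) (x := y)
        (hg.contDiffAt.of_le (by exact_mod_cast le_top))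
        (contDiffAt_const (c := (m : ℂ)))
      rw [iteratedFDeriv_const_of_ne (by omega)] at this
      simpa using this
    rw [h1, iteratedFDeriv_const_smul_apply' ((contDiff_slice hφ s).contDiffAt.of_le
      (by exact_mod_cast le_top)), norm_smul, Complex.norm_real, Real.norm_of_nonneg (by positivity)]
    refine le_trans ?_ (le_self_pow₀ hDs (by omega))
    rw [mul_comm]
    gcongr
    exact (hD₀ i hik s hsI y hy).trans (by simp [D])
  have hmul := norm_iteratedFDeriv_mul_le (N := ∞) hfs.cexp (contDiff_slice ha s) y (n := j)
    (by exact_mod_cast le_top)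
  refine hmul.trans ?_
  calc _ ≤ ∑ i ∈ Finset.range (j + 1), (j.choose i : ℝ) *
        (k.factorial * Ce * (D * (s ^ 2)⁻¹) ^ k) * A := by
        refine Finset.sum_le_sum fun i hi => ?_
        have hij : i ≤ j := by simpa [Nat.lt_succ_iff] using hi
        have h1 := norm_iteratedFDeriv_cexp_le hfs k hre hfd (hij.trans hj)
        have h2 := hA (j - i) (by omega) s hsI y hy
        have h3 : (i.factorial : ℝ) * Ce * (D * (s ^ 2)⁻¹) ^ i ≤ k.factorial * Ce * (D * (s ^ 2)⁻¹) ^ k := by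
          have : i.factorial ≤ k.factorial := Nat.factorial_le (hij.trans hj)
          gcongr
          exact hij.trans hj
        have h4 := h1.trans h3
        gcongr
    _ = 2 ^ j * (k.factorial * Ce * (D * (s ^ 2)⁻¹) ^ k) * A := by
        rw [← Finset.sum_mul, ← Finset.sum_mul]
        congr 2
        exact_mod_cast Nat.sum_range_choose j
    _ ≤ 2 ^ k * (k.factorial * Ce * (D * (s ^ 2)⁻¹) ^ k) * A := by
        gcongr
        norm_num
    _ = _ := by rw [mul_pow]; ring

theorem rpow_seventh {s : ℝ} (hs : 0 < s) {r : ℝ} {k : ℕ} (h : 7 * r = k) : (s ^ 7) ^ r = s ^ k := by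
  rw [← Real.rpow_natCast s 7, ← Real.rpow_mul hs.le, ← Real.rpow_natCast]
  congr 1

/-- The remainder of the expansion of the conjugated operator. -/
theorem exists_conjP_sub_conjExpansion_le {q : Fin n → Fin n → E n → X n → ℝ} {b : E n → E n → ℂ}
    (hq : ∀ j k, IsSymbol 0 (q j k)) (hb : IsSymbol 1 b) (ξ : X n) (R : ℝ) (M K : ℕ) :
    ∃ C : ℝ, 0 ≤ C ∧ ∀ s ∈ Ioc (0 : ℝ) 1, ∀ (c : ℝ) (A : E n → ℂ),
      CkBound R (Module.finrank ℝ (E n) + 2 + (M + 1) + 1 + 1 + 1) c A → ∀ y,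
      ‖conjP q b (1 / 7) ξ (s ^ 7) A y - conjExpansion q b ξ M s A y‖ ≤
        C * c * s ^ (3 * (M + 1)) * ((1 + ‖y‖) ^ K)⁻¹ := by
  have := fun j k => scaledOp_taylor (isSymbol_liftSymbol (hq j k)) R ‖ξ‖ (M + 1) K
  choose D hD0 hD using this
  obtain ⟨D', hD'0, hD'⟩ := scaledOp_taylor hb R ‖ξ‖ (M + 1) K
  refine ⟨(∑ j, ∑ k, D j k * ((‖ξ‖ + 1) * (‖ξ‖ + 1))) + D',
    add_nonneg (Finset.sum_nonneg fun j _ => Finset.sum_nonneg fun k _ => ?_) hD'0, fun s hs c A hA y => ?_⟩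
  · have := hD0 j k
    positivity
  have hsI : s ∈ Icc (0 : ℝ) 1 := ⟨hs.1.le, hs.2⟩
  have hpow : ∀ k : ℕ, s ^ k ∈ Icc (0 : ℝ) 1 := fun k => ⟨by have := hs.1; positivity, pow_le_one₀ hs.1.le hs.2⟩
  have hc0 := hA.nonneg
  have hDt : CkBound R (Module.finrank ℝ (E n) + 2 + (M + 1) + 1 + 1) c (Dt A) :=
    (hA.dirD (pt 1 0)).mono le_rfl (by rw [norm_pt_one, one_mul])
  have hB : ∀ j k, CkBound R (Module.finrank ℝ (E n) + 2 + (M + 1)) ((‖ξ‖ + 1) * ((‖ξ‖ + 1) * c))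
      (shiftD (s ^ 3) ξ j (shiftD (s ^ 3) ξ k (Dt A))) := fun j k =>
    (hDt.shiftD (hpow 3) ξ k).shiftD (hpow 3) ξ j
  have hcn : ‖(pt 0 (s • ξ) : E n)‖ ≤ ‖ξ‖ := by
    rw [norm_pt_zero, norm_smul, Real.norm_of_nonneg hs.1.le]
    exact mul_le_of_le_one_left (norm_nonneg _) hs.2
  have h1 := fun j k => hD j k _ (hpow 3) _ (hpow 4) s hsI _ hcn _ _ (hB j k) y
  have h2 := hD' _ (hpow 3) _ (hpow 4) s hsI _ hcn _ _ (hA.mono (by omega) le_rfl) y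
  rw [conjP_eq q b hq hb (1 / 7) ξ (pow_pos hs.1 7) hA.smooth hA.hasCompactSupport y,
    rpow_seventh hs.1 (r := 3 * (1 / 7)) (k := 3) (by norm_num),
    rpow_seventh hs.1 (r := 1 - 3 * (1 / 7)) (k := 4) (by norm_num),
    rpow_seventh hs.1 (r := 1 - 6 * (1 / 7)) (k := 1) (by norm_num),
    rpow_seventh hs.1 (r := 1 - 4 * (1 / 7)) (k := 3) (by norm_num),
    rpow_seventh hs.1 (r := 1 + 2 * (1 / 7)) (k := 9) (by norm_num),
    rpow_seventh hs.1 (r := 1 / 7) (k := 1) (by norm_num), pow_one,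
    conjExpansion, ← pow_mul]
  set W := ((1 + ‖y‖) ^ K)⁻¹
  have hW : 0 ≤ W := by positivity
  set Z : Fin n → Fin n → ℂ := fun j k => scaledOp (s ^ 3) (s ^ 4) s (pt 0 (s • ξ)) (liftSymbol (q j k))
    (shiftD (s ^ 3) ξ j (shiftD (s ^ 3) ξ k (Dt A))) y
  set Z' : Fin n → Fin n → ℂ := fun j k => ∑ i ∈ Finset.range (M + 1),
    ((((s ^ 3) ^ i / i.factorial : ℝ)) : ℂ) * taylorTerm (s ^ 4) s (frozenOp (pt 0 (s • ξ))) i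
      (liftSymbol (q j k)) (shiftD (s ^ 3) ξ j (shiftD (s ^ 3) ξ k (Dt A))) y
  set Y := scaledOp (s ^ 3) (s ^ 4) s (pt 0 (s • ξ)) b A y
  set Y' := ∑ i ∈ Finset.range (M + 1), ((((s ^ 3) ^ i / i.factorial : ℝ)) : ℂ) *
    taylorTerm (s ^ 4) s (frozenOp (pt 0 (s • ξ))) i b A y
  have e1 : ((s ^ (7 * 2) : ℝ) : ℂ) * Dt (Dt A) y + ((s ^ 9 : ℝ) : ℂ) * ∑ j, ∑ k, Z j k +
      ((s ^ 7 : ℝ) : ℂ) * Y - (((s ^ 14 : ℝ) : ℂ) * Dt (Dt A) y +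
      ((s ^ 9 : ℝ) : ℂ) * ∑ j, ∑ k, Z' j k + ((s ^ 7 : ℝ) : ℂ) * Y') =
      ((s ^ 9 : ℝ) : ℂ) * (∑ j, ∑ k, (Z j k - Z' j k)) + ((s ^ 7 : ℝ) : ℂ) * (Y - Y') := by
    simp only [Finset.sum_sub_distrib]
    ring
  rw [e1]
  have h3 : ‖∑ j, ∑ k, (Z j k - Z' j k)‖ ≤
      (∑ j, ∑ k, D j k * ((‖ξ‖ + 1) * (‖ξ‖ + 1))) * (c * (s ^ 3) ^ (M + 1) * W) := by
    simp only [Finset.sum_mul]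
    refine (norm_sum_le _ _).trans (Finset.sum_le_sum fun j _ => (norm_sum_le _ _).trans
      (Finset.sum_le_sum fun k _ => (h1 j k).trans_eq (by ring)))
  refine (norm_add_le _ _).trans ?_
  rw [norm_mul, norm_mul, Complex.norm_real, Complex.norm_real, Real.norm_of_nonneg (hpow 9).1,
    Real.norm_of_nonneg (hpow 7).1]
  refine (add_le_add ((mul_le_of_le_one_left (norm_nonneg _) (hpow 9).2).trans h3)
    ((mul_le_of_le_one_left (norm_nonneg _) (hpow 7).2).trans h2)).trans_eq ?_
  rw [← pow_mul]
  ring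

end WkbEstimates

/-! ### The phase function and the location of its maximum. -/

section Phase

variable {n : ℕ}

/-- The calculus of families needs coefficients smooth for all $(s,t,x)$, whereas $q$ is known to be
nonzero only for small $s$ and $t\in[t_1,t_2]$. This replaces $1/q$ by a global function. -/
theorem exists_contDiff_eq_inv {r : ℝ} (hr : 0 < r) :
    ∃ Θ : ℝ → ℝ, ContDiff ℝ ∞ Θ ∧ ∀ x, r ≤ |x| → Θ x = x⁻¹ := by
  have hpos : ∀ x : ℝ, x ^ 2 + Real.smoothTransition (1 - x ^ 2 / r ^ 2) ≠ 0 := by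
    intro x
    rcases eq_or_ne x 0 with rfl | hx
    · simp
    · have := Real.smoothTransition.nonneg (1 - x ^ 2 / r ^ 2)
      positivity
  refine ⟨fun x => x / (x ^ 2 + Real.smoothTransition (1 - x ^ 2 / r ^ 2)), ?_, fun x hx => ?_⟩
  · exact contDiff_id.div ((contDiff_id.pow 2).add (Real.smoothTransition.contDiff.comp
      (contDiff_const.sub ((contDiff_id.pow 2).div_const _)))) hpos
  · have h1 : r ^ 2 ≤ x ^ 2 := by
      rw [← sq_abs x]
      gcongr
    have h2 : 1 - x ^ 2 / r ^ 2 ≤ 0 := by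
      rw [sub_nonpos, one_le_div (by positivity)]
      exact h1
    have hx0 : x ≠ 0 := by
      rintro rfl
      simp only [abs_zero] at hx
      linarith
    beta_reduce
    rw [Real.smoothTransition.zero_of_nonpos h2]
    field_simp
    simp

theorem contDiff_qCurve {q : Fin n → Fin n → E n → X n → ℝ} (hq : ∀ j k, IsSymbol 0 (q j k))
    (ξ : X n) : ContDiff ℝ ∞ (qCurve q ξ) := by
  have h : ContDiff ℝ ∞ fun p : ℝ × ℝ => ((pt p.2 0, p.1 • ξ) : E n × X n) :=
    (contDiff_pt contDiff_snd contDiff_const).prodMk (contDiff_fst.smul contDiff_const)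
  exact ContDiff.sum fun j _ => ContDiff.sum fun k _ =>
    (((hq j k).1.comp h).mul contDiff_const).mul contDiff_const

/-- The primitive of a function that changes its sign from `+` to `-` has its maxima inside. -/
theorem exists_interior_max {F σ : ℝ → ℝ} (hF : ∀ t, HasDerivAt F (σ t) t) {t₁ t₂ ρ c C : ℝ}
    (hρ : 0 < ρ) (hc : 0 < c) (hρt : 4 * ρ ≤ t₂ - t₁) (h₁ : ∀ t ∈ Icc t₁ (t₁ + 2 * ρ), c ≤ σ t)
    (h₂ : ∀ t ∈ Icc (t₂ - 2 * ρ) t₂, σ t ≤ -c) (hC : ∀ t ∈ Icc t₁ t₂, |σ t| ≤ C) :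
    ∃ T ∈ Icc (t₁ + ρ) (t₂ - ρ), ∀ t ∈ Icc t₁ t₂, F t ≤ F T ∧
      (t ∉ Icc (t₁ + ρ) (t₂ - ρ) → F t ≤ F T - c * ρ) ∧ F T - C * |t - T| ≤ F t := by
  have hcont : Continuous F := continuous_iff_continuousAt.2 fun t => (hF t).continuousAt
  have hdiff : Differentiable ℝ F := fun t => (hF t).differentiableAt
  obtain ⟨T, hT, hmax⟩ := isCompact_Icc.exists_isMaxOn (⟨t₁, by constructor <;> linarith⟩ : (Icc t₁ t₂).Nonempty)
    hcont.continuousOn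
  have hmax' : ∀ t ∈ Icc t₁ t₂, F t ≤ F T := hmax
  -- The strips have width `2ρ`, so a point outside the inner interval is at distance at least `ρ`
  -- from the inner edge of its strip. The slope bound `c` there gives the drop `c * ρ`.
  have hout : ∀ t ∈ Icc t₁ t₂, t ∉ Icc (t₁ + ρ) (t₂ - ρ) → F t ≤ F T - c * ρ := by
    intro t ht hout
    rw [mem_Icc, not_and_or, not_le, not_le] at hout
    rcases hout with h | h
    · have := (convex_Icc t₁ (t₁ + 2 * ρ)).mul_sub_le_image_sub_of_le_deriv hcont.continuousOn
        hdiff.differentiableOn (C := c) (fun x hx => by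
          rw [(hF x).deriv]; exact h₁ x (interior_subset hx)) t ⟨ht.1, by linarith⟩
        (t₁ + 2 * ρ) ⟨by linarith, le_rfl⟩ (by linarith)
      have h3 := hmax' (t₁ + 2 * ρ) ⟨by linarith, by linarith⟩
      nlinarith
    · have := (convex_Icc (t₂ - 2 * ρ) t₂).image_sub_le_mul_sub_of_deriv_le hcont.continuousOn
        hdiff.differentiableOn (C := -c) (fun x hx => by
          rw [(hF x).deriv]; exact h₂ x (interior_subset hx)) (t₂ - 2 * ρ) ⟨le_rfl, by linarith⟩
        t ⟨by linarith, ht.2⟩ (by linarith)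
      have h3 := hmax' (t₂ - 2 * ρ) ⟨by linarith, by linarith⟩
      nlinarith
  refine ⟨T, ?_, fun t ht => ⟨hmax' t ht, hout t ht, ?_⟩⟩
  · by_contra h
    have := hout T hT h
    nlinarith
  · have := (convex_Icc t₁ t₂).norm_image_sub_le_of_norm_hasDerivWithin_le
      (fun x _ => (hF x).hasDerivWithinAt) (C := C) (fun x hx => hC x hx) hT ht
    rw [Real.norm_eq_abs, Real.norm_eq_abs] at this
    have := neg_abs_le (F t - F T)
    linarith

/-- The phase function of the quasimodes, and where its real part is large. -/
theorem exists_phase {q : Fin n → Fin n → E n → X n → ℝ} {b : E n → E n → ℂ}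
    (hq : ∀ j k, IsSymbol 0 (q j k)) (hb : IsSymbol 1 b) (ξ : X n) {t₁ t₂ : ℝ} (ht : t₁ < t₂)
    (hq0 : ∀ t ∈ Icc t₁ t₂, q0 q ξ t ≠ 0) (h₁ : 0 < (b (pt t₁ 0) (pt 0 0)).im / q0 q ξ t₁)
    (h₂ : (b (pt t₂ 0) (pt 0 0)).im / q0 q ξ t₂ < 0) :
    ∃ κ φ : ℝ × E n → ℂ, ContDiff ℝ ∞ κ ∧ ContDiff ℝ ∞ φ ∧ (∀ (v : X n) z, famD (pt 0 v) φ z = 0) ∧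
      ∃ s₁ ∈ Ioc (0 : ℝ) 1, ∃ ρ > 0, ∃ c > 0, ∃ C, 0 ≤ C ∧ 4 * ρ ≤ t₂ - t₁ ∧
      (∀ s ∈ Icc 0 s₁, ∀ y : E n, y.fst ∈ Icc t₁ t₂ → (qCurve q ξ (s, y.fst) : ℂ) * κ (s, y) = 1 ∧
        (qCurve q ξ (s, y.fst) : ℂ) * famD (pt 1 0) φ (s, y) + symFam ξ b (s, y) = 0) ∧
      ∃ T m : ℝ → ℝ, ∀ s ∈ Icc 0 s₁, T s ∈ Icc (t₁ + ρ) (t₂ - ρ) ∧ ∀ y : E n, y.fst ∈ Icc t₁ t₂ →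
        (φ (s, y)).re ≤ m s ∧ (y.fst ∉ Icc (t₁ + ρ) (t₂ - ρ) → (φ (s, y)).re ≤ m s - c) ∧
        m s - C * |y.fst - T s| ≤ (φ (s, y)).re := by
  have hQ := contDiff_qCurve hq ξ
  have hB := contDiff_bCurve hb ξ
  have hQ0 : ∀ t, qCurve q ξ (0, t) = q0 q ξ t := fun t => by simp [qCurve, q0]
  have hB0 : ∀ t, bCurve b ξ (0, t) = b (pt t 0) (pt 0 0) := fun t => by simp [bCurve]
  have hI1 : t₁ ∈ Icc t₁ t₂ := left_mem_Icc.2 ht.le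
  have hI2 : t₂ ∈ Icc t₁ t₂ := right_mem_Icc.2 ht.le
  obtain ⟨r, hr, hrq⟩ : ∃ r > 0, ∀ t ∈ Icc t₁ t₂, r < |qCurve q ξ (0, t)| := by
    obtain ⟨x, hx, hmin⟩ := isCompact_Icc.exists_isMinOn ⟨t₁, hI1⟩
      ((contDiff_q0 hq ξ).continuous.abs.continuousOn (s := Icc t₁ t₂))
    have hmin' : ∀ t ∈ Icc t₁ t₂, |q0 q ξ x| ≤ |q0 q ξ t| := hmin
    have hx0 : 0 < |q0 q ξ x| := abs_pos.2 (hq0 x hx)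
    exact ⟨|q0 q ξ x| / 2, by positivity, fun t ht => by
      rw [hQ0]; exact lt_of_lt_of_le (by linarith) (hmin' t ht)⟩
  obtain ⟨δ₀, hδ₀, hδ₀q⟩ : ∃ δ > 0, ∀ s, |s| < δ → ∀ t ∈ Icc t₁ t₂, r < |qCurve q ξ (s, t)| := by
    have := isCompact_Icc.eventually_forall_of_forall_eventually (x₀ := (0 : ℝ)) (K := Icc t₁ t₂)
      (P := fun s t => r < |qCurve q ξ (s, t)|) (fun t ht =>
        (hQ.continuous.abs.continuousAt (x := ((0 : ℝ), t))).eventually (lt_mem_nhds (hrq t ht)))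
    obtain ⟨δ, hδ, h⟩ := Metric.eventually_nhds_iff.1 this
    exact ⟨δ, hδ, fun s hs => h (by simpa [Real.dist_eq] using hs)⟩
  obtain ⟨Θ, hΘ, hΘr⟩ := exists_contDiff_eq_inv hr
  set κ : ℝ × E n → ℂ := fun z => (Θ (qCurve q ξ (z.1, z.2.fst)) : ℂ) with hκ
  have hκs : ContDiff ℝ ∞ κ := Complex.ofRealCLM.contDiff.comp (hΘ.comp (hQ.comp
    (contDiff_fst.prodMk (contDiff_fst_E.comp contDiff_snd))))
  -- With this integrand $D_t\varphi=-ig=-b\kappa$, which solves the eikonal equation, and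
  -- $\partial_t\operatorname{Re}\varphi=\kappa\operatorname{Im}b$ has the sign of the hypotheses.
  set g : ℝ × E n → ℂ := fun z => -Complex.I * (symFam ξ b z * κ z) with hg
  have hgs : ContDiff ℝ ∞ g := contDiff_const.mul ((contDiff_symFam hb ξ).mul hκs)
  set φ := timePrimitive t₁ g with hφ
  have hφs : ContDiff ℝ ∞ φ := contDiff_timePrimitive t₁ hgs
  set σ : ℝ × ℝ → ℝ := fun p => (bCurve b ξ p).im * Θ (qCurve q ξ p) with hσ
  have hσc : Continuous σ := (Complex.continuous_im.comp hB.continuous).mul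
    (hΘ.continuous.comp hQ.continuous)
  have hφt : ∀ s (y : E n), φ (s, y) = ∫ τ in t₁..y.fst, g (s, pt τ 0) := fun s y => by
    rw [hφ, timePrimitive_eq]
    rfl
  have hder : ∀ s t, HasDerivAt (fun t => (φ (s, pt t 0)).re) (σ (s, t)) t := by
    intro s t
    have hcont : Continuous fun τ : ℝ => g (s, pt τ 0) :=
      hgs.continuous.comp (continuous_const.prodMk (contDiff_pt contDiff_id contDiff_const).continuous)
    have h1 := intervalIntegral.integral_hasDerivAt_right (hcont.intervalIntegrable t₁ t)
      (hcont.stronglyMeasurableAtFilter _ _) hcont.continuousAt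
    have h2 := Complex.reCLM.hasFDerivAt.comp_hasDerivAt t h1
    have h3 : (fun t => (φ (s, pt t 0)).re) = ⇑Complex.reCLM ∘ fun t => ∫ τ in t₁..t, g (s, pt τ 0) := by
      funext t
      simp [hφt]
    rw [h3]
    refine h2.congr_deriv ?_
    simp [hg, hσ, hκ, symFam]
  -- The signs are given only at $s=0$ and at the two endpoints. Continuity carries them to small
  -- $s$ and to strips of fixed width.
  obtain ⟨c, hc, δ, hδ, hδ1, hδ2⟩ : ∃ c > 0, ∃ δ > 0, (∀ s t, |s| < δ → |t - t₁| < δ → c ≤ σ (s, t)) ∧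
      ∀ s t, |s| < δ → |t - t₂| < δ → σ (s, t) ≤ -c := by
    have e : ∀ t ∈ Icc t₁ t₂, σ (0, t) = (b (pt t 0) (pt 0 0)).im / q0 q ξ t := fun t ht => by
      simp only [hσ]
      rw [hΘr _ (hrq t ht).le, hQ0, hB0, div_eq_mul_inv]
    have p1 : 0 < σ (0, t₁) := by rw [e t₁ hI1]; exact h₁
    have p2 : σ (0, t₂) < 0 := by rw [e t₂ hI2]; exact h₂
    set c := min (σ (0, t₁)) (-σ (0, t₂)) / 2 with hc
    have hc0 : 0 < c := by
      have : 0 < min (σ (0, t₁)) (-σ (0, t₂)) := lt_min p1 (by linarith)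
      positivity
    have c1 : c < σ (0, t₁) := by have := min_le_left (σ (0, t₁)) (-σ (0, t₂)); linarith
    have c2 : σ (0, t₂) < -c := by have := min_le_right (σ (0, t₁)) (-σ (0, t₂)); linarith
    obtain ⟨d1, hd1, H1⟩ := Metric.eventually_nhds_iff.1
      ((hσc.continuousAt (x := ((0 : ℝ), t₁))).eventually (lt_mem_nhds c1))
    obtain ⟨d2, hd2, H2⟩ := Metric.eventually_nhds_iff.1
      ((hσc.continuousAt (x := ((0 : ℝ), t₂))).eventually (gt_mem_nhds c2))
    refine ⟨c, hc0, min d1 d2, lt_min hd1 hd2, fun s t hs ht => (H1 ?_).le, fun s t hs ht => (H2 ?_).le⟩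
    · rw [Prod.dist_eq, max_lt_iff]
      simp only [Real.dist_eq, sub_zero]
      exact ⟨hs.trans_le (min_le_left _ _), ht.trans_le (min_le_left _ _)⟩
    · rw [Prod.dist_eq, max_lt_iff]
      simp only [Real.dist_eq, sub_zero]
      exact ⟨hs.trans_le (min_le_right _ _), ht.trans_le (min_le_right _ _)⟩
  obtain ⟨C, hC⟩ := ((isCompact_Icc (a := (0 : ℝ)) (b := 1)).prod (isCompact_Icc (a := t₁) (b := t₂))).exists_bound_of_continuousOn
    hσc.continuousOn
  set s₁ := min 1 (min δ₀ δ / 2) with hs₁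
  have hs₁0 : 0 < s₁ := lt_min one_pos (half_pos (lt_min hδ₀ hδ))
  have hs₁1 : s₁ ≤ 1 := min_le_left _ _
  have hs₁2 : s₁ < δ₀ ∧ s₁ < δ := by
    have h1 : s₁ ≤ min δ₀ δ / 2 := min_le_right _ _
    have h2 := min_le_left δ₀ δ
    have h3 := min_le_right δ₀ δ
    have h4 := lt_min hδ₀ hδ
    constructor <;> linarith
  set ρ := min (δ / 4) ((t₂ - t₁) / 4) with hρ
  have hρ0 : 0 < ρ := lt_min (by linarith) (by linarith)
  have hρ1 : ρ ≤ δ / 4 := min_le_left _ _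
  have hρ2 : ρ ≤ (t₂ - t₁) / 4 := min_le_right _ _
  have habs : ∀ s ∈ Icc 0 s₁, |s| < δ₀ ∧ |s| < δ := fun s hs => by
    rw [abs_of_nonneg hs.1]
    exact ⟨hs.2.trans_lt hs₁2.1, hs.2.trans_lt hs₁2.2⟩
  have hT : ∀ s, ∃ T, s ∈ Icc 0 s₁ → T ∈ Icc (t₁ + ρ) (t₂ - ρ) ∧ ∀ t ∈ Icc t₁ t₂,
      (φ (s, pt t 0)).re ≤ (φ (s, pt T 0)).re ∧
      (t ∉ Icc (t₁ + ρ) (t₂ - ρ) → (φ (s, pt t 0)).re ≤ (φ (s, pt T 0)).re - c * ρ) ∧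
      (φ (s, pt T 0)).re - |C| * |t - T| ≤ (φ (s, pt t 0)).re := by
    intro s
    by_cases hs : s ∈ Icc 0 s₁
    · obtain ⟨T, hT, h⟩ := exists_interior_max (hder s) (t₁ := t₁) (t₂ := t₂) (C := |C|) hρ0 hc (by linarith)
        (fun t ht => hδ1 s t (habs s hs).2 (by rw [abs_lt]; constructor <;> linarith [ht.1, ht.2]))
        (fun t ht => hδ2 s t (habs s hs).2 (by rw [abs_lt]; constructor <;> linarith [ht.1, ht.2]))
        (fun t ht => (hC (s, t) ⟨⟨hs.1, hs.2.trans hs₁1⟩, ht⟩).trans (le_abs_self C))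
      exact ⟨T, fun _ => ⟨hT, h⟩⟩
    · exact ⟨0, fun h => absurd h hs⟩
  choose T hT using hT
  have hφ0 : ∀ (v : X n) z, famD (pt 0 v) φ z = 0 := fun v z =>
    famD_eq_zero_of_const v (fun s t x x' => by rw [hφt, hφt, pt_fst, pt_fst]) z
      (hφs.differentiable (by simp) z)
  refine ⟨κ, φ, hκs, hφs, hφ0, s₁, ⟨hs₁0, hs₁1⟩, ρ, hρ0, c * ρ, by positivity, |C|, abs_nonneg _,
    by linarith, fun s hs y hy => ?_, T, fun s => (φ (s, pt (T s) 0)).re, fun s hs => ⟨(hT s hs).1,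
    fun y hy => ?_⟩⟩
  · have h1 := hδ₀q s (habs s hs).1 y.fst hy
    have h2 : (qCurve q ξ (s, y.fst) : ℂ) ≠ 0 := by
      intro h
      rw [Complex.ofReal_eq_zero] at h
      rw [h, abs_zero] at h1
      linarith
    have h3 : (qCurve q ξ (s, y.fst) : ℂ) * κ (s, y) = 1 := by
      simp only [hκ]
      rw [hΘr _ h1.le, Complex.ofReal_inv, mul_inv_cancel₀ h2]
    refine ⟨h3, ?_⟩
    rw [hφ, famD_timePrimitive_pt t₁ hgs]
    simp only [hg]
    linear_combination (-symFam ξ b (s, y)) * h3 +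
      ((qCurve q ξ (s, y.fst) : ℂ) * symFam ξ b (s, y) * κ (s, y)) * Complex.I_sq
  · have := (hT s hs).2 y.fst hy
    rw [hφt s y]
    simpa only [hφt, pt_fst] using this

end Phase

/-! ### The amplitude: transport equations solved by a polynomial in the parameter. -/

section Amplitude

variable {n : ℕ}

/-- The set `[t₁, t₂] × {|x| ≤ 1}`. -/
def cylinder (n : ℕ) (t₁ t₂ : ℝ) : Set (E n) := {y | y.fst ∈ Icc t₁ t₂ ∧ ‖y.snd‖ ≤ 1}

theorem isCompact_cylinder (t₁ t₂ : ℝ) : IsCompact (cylinder n t₁ t₂) := by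
  have h : cylinder n t₁ t₂ = (fun p : ℝ × X n => (pt p.1 p.2 : E n)) ''
      (Icc t₁ t₂ ×ˢ Metric.closedBall 0 1) := by
    ext y
    simp only [cylinder, mem_ofPred_eq, mem_image, mem_prod, mem_closedBall_zero_iff, Prod.exists]
    exact ⟨fun h => ⟨y.fst, y.snd, h, rfl⟩, fun ⟨a, b, h, e⟩ => e ▸ h⟩
  rw [h]
  exact (isCompact_Icc.prod (isCompact_closedBall 0 1)).image
    (contDiff_pt contDiff_fst contDiff_snd).continuous

/-- The coefficients of the formal solution of the transport equations with initial value `c₀`. -/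
def transportCoeff (t₁ : ℝ) (κ : ℝ × E n → ℂ) (R : (ℝ × E n → ℂ) → ℝ × E n → ℂ) (c₀ : ℝ × E n → ℂ) :
    ℕ → ℝ × E n → ℂ
  | 0 => c₀
  | k + 1 => timePrimitive t₁ fun z => -Complex.I * (κ z * R (transportCoeff t₁ κ R c₀ k) z)

section Coeff

variable {t₁ : ℝ} {κ c₀ : ℝ × E n → ℂ} {R : (ℝ × E n → ℂ) → ℝ × E n → ℂ}

theorem contDiff_transportCoeff (hR : IsDiffOp R) (hκ : ContDiff ℝ ∞ κ) (hc₀ : ContDiff ℝ ∞ c₀) (k : ℕ) :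
    ContDiff ℝ ∞ (transportCoeff t₁ κ R c₀ k) := by
  induction k with
  | zero => exact hc₀
  | succ k ih => exact contDiff_timePrimitive t₁ (contDiff_const.mul (hκ.mul (hR.contDiff ih)))

theorem famD_transportCoeff (hR : IsDiffOp R) (hκ : ContDiff ℝ ∞ κ) (hc₀ : ContDiff ℝ ∞ c₀) (k : ℕ)
    (z : ℝ × E n) : famD (pt 1 0) (transportCoeff t₁ κ R c₀ (k + 1)) z =
      -(κ z * R (transportCoeff t₁ κ R c₀ k) z) := by
  rw [transportCoeff, famD_timePrimitive_pt t₁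
    (contDiff_const.mul (hκ.mul (hR.contDiff (contDiff_transportCoeff hR hκ hc₀ k))))]
  linear_combination (κ z * R (transportCoeff t₁ κ R c₀ k) z) * Complex.I_sq

theorem IsDiffOp.eq_zero_of_eventually (hR : IsDiffOp R) {a : ℝ × E n → ℂ} {z : ℝ × E n}
    (h : a =ᶠ[nhds z] fun _ => 0) : R a z = 0 := by
  rw [(hR.congr h).eq_of_nhds, hR.map_zero]

/-- Differential operators and primitives in $t$ do not enlarge the support in $x$. -/
theorem transportCoeff_eq_zero (hR : IsDiffOp R) (h₀ : ∀ z : ℝ × E n, 1 < ‖z.2.snd‖ → c₀ z = 0) (k : ℕ) :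
    ∀ z : ℝ × E n, 1 < ‖z.2.snd‖ → transportCoeff t₁ κ R c₀ k z = 0 := by
  have hopen : IsOpen {z : ℝ × E n | 1 < ‖z.2.snd‖} :=
    isOpen_lt continuous_const ((contDiff_snd_E.continuous.comp continuous_snd).norm)
  induction k with
  | zero => exact h₀
  | succ k ih =>
    intro z hz
    have : ∀ w : ℝ × E n, 1 < ‖w.2.snd‖ → R (transportCoeff t₁ κ R c₀ k) w = 0 := fun w hw =>
      hR.eq_zero_of_eventually (by filter_upwards [hopen.mem_nhds hw] with v hv using ih v hv)
    rw [transportCoeff, timePrimitive]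
    simp only [fun r => this (z.1, pt (t₁ + (z.2.fst - t₁) * r) z.2.snd) hz]
    simp

/-- The partial sums of the formal solution solve the transport equation up to a high power of the
parameter. -/
theorem transport_sum (hR : IsDiffOp R) (hκ : ContDiff ℝ ∞ κ) (hc₀ : ContDiff ℝ ∞ c₀)
    (hd : ∀ z, famD (pt 1 0) c₀ z = 0) (K : ℕ) {q : ℂ} {z : ℝ × E n} (hq : q * κ z = 1) :
    q * famD (pt 1 0) (fun z => ∑ k ∈ Finset.range (K + 1), ((z.1 ^ k : ℝ) : ℂ) *
        transportCoeff t₁ κ R c₀ k z) z +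
      (z.1 : ℂ) * R (fun z => ∑ k ∈ Finset.range (K + 1), ((z.1 ^ k : ℝ) : ℂ) *
        transportCoeff t₁ κ R c₀ k z) z =
      ((z.1 ^ (K + 1) : ℝ) : ℂ) * R (transportCoeff t₁ κ R c₀ K) z := by
  have hs := contDiff_transportCoeff (t₁ := t₁) hR hκ hc₀
  rw [(IsDiffOp.deriv (pt 1 0)).map_sum_pow hs, hR.map_sum_pow hs]
  beta_reduce
  rw [Finset.sum_range_succ', Finset.sum_range_succ (fun k => ((z.1 ^ k : ℝ) : ℂ) *
    R (transportCoeff t₁ κ R c₀ k) z), mul_add, mul_add, Finset.mul_sum, Finset.mul_sum,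
    show famD (pt 1 0) (transportCoeff t₁ κ R c₀ 0) z = 0 from hd z]
  have h1 : ∑ k ∈ Finset.range K, q * (((z.1 ^ (k + 1) : ℝ) : ℂ) *
      famD (pt 1 0) (transportCoeff t₁ κ R c₀ (k + 1)) z) =
      -∑ k ∈ Finset.range K, (z.1 : ℂ) * (((z.1 ^ k : ℝ) : ℂ) * R (transportCoeff t₁ κ R c₀ k) z) := by
    rw [← Finset.sum_neg_distrib]
    refine Finset.sum_congr rfl fun k _ => ?_
    rw [famD_transportCoeff hR hκ hc₀]
    push_cast
    linear_combination (-(z.1 : ℂ) ^ (k + 1) * R (transportCoeff t₁ κ R c₀ k) z) * hq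
  rw [h1]
  push_cast
  ring

end Coeff

/-- The formal solution is truncated and multiplied by a cutoff in $t$. The equation holds to high
order where the cutoff is constant. Near the ends the error is merely bounded, to be absorbed there
by the small exponential. -/
theorem exists_amplitude {R : (ℝ × E n → ℂ) → ℝ × E n → ℂ} (hR : IsDiffOp R) {κ Q : ℝ × E n → ℂ}
    (hκ : ContDiff ℝ ∞ κ) (hQ : ContDiff ℝ ∞ Q) {t₁ t₂ ρ s₁ : ℝ} (hρ : 0 < ρ) (hρt : 4 * ρ ≤ t₂ - t₁)
    (hs₁ : s₁ ∈ Ioc (0 : ℝ) 1)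
    (hQκ : ∀ s ∈ Icc 0 s₁, ∀ y : E n, y.fst ∈ Icc t₁ t₂ → Q (s, y) * κ (s, y) = 1) (K : ℕ) :
    ∃ a : ℝ × E n → ℂ, ContDiff ℝ ∞ a ∧ (∀ s, ∀ y ∉ cylinder n t₁ t₂, a (s, y) = 0) ∧
      (∃ C, 0 ≤ C ∧ ∀ s ∈ Icc 0 s₁, ∀ y,
        (y ∉ cylinder n t₁ t₂ → Q (s, y) * famD (pt 1 0) a (s, y) + (s : ℂ) * R a (s, y) = 0) ∧
        ‖Q (s, y) * famD (pt 1 0) a (s, y) + (s : ℂ) * R a (s, y)‖ ≤ C ∧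
        (y.fst ∈ Icc (t₁ + ρ) (t₂ - ρ) →
          ‖Q (s, y) * famD (pt 1 0) a (s, y) + (s : ℂ) * R a (s, y)‖ ≤ C * s ^ (K + 1))) ∧
      ∃ s₂ ∈ Ioc 0 s₁, ∀ s ∈ Icc 0 s₂, ∀ y : E n, y.fst ∈ Icc (t₁ + ρ / 2) (t₂ - ρ / 2) →
        ‖y.snd‖ ≤ 1 / 2 → 1 / 2 ≤ ‖a (s, y)‖ := by
  let β : ContDiffBump (0 : X n) := ⟨1 / 2, 1, by norm_num, by norm_num⟩
  -- The cutoff is one up to distance `ρ / 4` from the ends, hence on a neighbourhood of the smaller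
  -- intervals where the error and the lower bound are needed.
  let χ : ContDiffBump ((t₁ + t₂) / 2) := ⟨(t₂ - t₁) / 2 - ρ / 4, (t₂ - t₁) / 2, by linarith, by linarith⟩
  have hχ1 : ∀ t ∈ Icc (t₁ + ρ / 4) (t₂ - ρ / 4), χ t = 1 := fun t ht =>
    χ.one_of_mem_closedBall (by
      rw [Metric.mem_closedBall, Real.dist_eq, abs_le]
      change -((t₂ - t₁) / 2 - ρ / 4) ≤ _ ∧ _ ≤ (t₂ - t₁) / 2 - ρ / 4
      constructor <;> linarith [ht.1, ht.2])
  have hχ0 : ∀ t ∉ Icc t₁ t₂, χ t = 0 := fun t ht => χ.zero_of_le_dist (by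
    change (t₂ - t₁) / 2 ≤ _
    rw [Real.dist_eq, le_abs]
    rw [mem_Icc, not_and_or, not_le, not_le] at ht
    rcases ht with h | h
    · right; linarith
    · left; linarith)
  set c₀ : ℝ × E n → ℂ := fun z => (β z.2.snd : ℂ) with hc₀
  have hc₀s : ContDiff ℝ ∞ c₀ :=
    Complex.ofRealCLM.contDiff.comp (β.contDiff.comp (contDiff_snd_E.comp contDiff_snd))
  have hc₀0 : ∀ z : ℝ × E n, 1 < ‖z.2.snd‖ → c₀ z = 0 := fun z hz => by
    rw [hc₀]
    beta_reduce
    rw [β.zero_of_le_dist (by rw [dist_zero_right]; exact hz.le), Complex.ofReal_zero]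
  have hc₀d : ∀ z, famD (pt 1 0) c₀ z = 0 := by
    rintro ⟨s, y⟩
    rw [famD_eq_dirD _ hc₀s, dirD]
    have h1 : HasFDerivAt (fun y : E n => (β y.snd : ℂ))
        (((fderiv ℝ (fun x : X n => (β x : ℂ)) y.snd)).comp (WithLp.sndL 2 ℝ ℝ (X n))) y := by
      have := (Complex.ofRealCLM.contDiff.comp (β.contDiff (n := ⊤))).differentiable (by simp) y.snd
      exact this.hasFDerivAt.comp y (WithLp.sndL 2 ℝ ℝ (X n)).hasFDerivAt
    have h2 : (WithLp.sndL 2 ℝ ℝ (X n)) (pt 1 0 : E n) = 0 := rfl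
    rw [show fderiv ℝ (fun y : E n => c₀ (s, y)) y = _ from h1.fderiv, ContinuousLinearMap.comp_apply,
      h2, ContinuousLinearMap.map_zero, mul_zero]
  set c := transportCoeff t₁ κ R c₀ with hc
  have hcs : ∀ k, ContDiff ℝ ∞ (c k) := contDiff_transportCoeff hR hκ hc₀s
  set a' : ℝ × E n → ℂ := fun z => ∑ k ∈ Finset.range (K + 1), ((z.1 ^ k : ℝ) : ℂ) * c k z with ha'
  have ha's : ContDiff ℝ ∞ a' := ContDiff.sum fun k _ => (contDiff_param_pow k).mul (hcs k)
  set a : ℝ × E n → ℂ := fun z => (χ z.2.fst : ℂ) * a' z with ha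
  have has : ContDiff ℝ ∞ a := (Complex.ofRealCLM.contDiff.comp
    (χ.contDiff.comp (contDiff_fst_E.comp contDiff_snd))).mul ha's
  have ha0 : ∀ s, ∀ y ∉ cylinder n t₁ t₂, a (s, y) = 0 := by
    intro s y hy
    simp only [ha]
    by_cases h : y.fst ∈ Icc t₁ t₂
    · have h2 : 1 < ‖y.snd‖ := by
        by_contra h'
        exact hy ⟨h, not_lt.1 h'⟩
      have : a' (s, y) = 0 := Finset.sum_eq_zero fun k _ => by
        rw [hc, transportCoeff_eq_zero hR hc₀0 k (s, y) h2, mul_zero]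
      rw [this, mul_zero]
    · rw [hχ0 _ h, Complex.ofReal_zero, zero_mul]
  set W : ℝ × E n → ℂ := fun z => Q z * famD (pt 1 0) a z + (z.1 : ℂ) * R a z with hW
  have hWc : Continuous W := ((hQ.mul (contDiff_famD _ has)).add
    ((Complex.ofRealCLM.contDiff.comp contDiff_fst).mul (hR.contDiff has))).continuous
  have hKc := isCompact_cylinder (n := n) t₁ t₂
  obtain ⟨C₁, hC₁⟩ := ((isCompact_Icc (a := (0 : ℝ)) (b := 1)).prod hKc).exists_bound_of_continuousOn
    hWc.continuousOn
  obtain ⟨C₂, hC₂⟩ := ((isCompact_Icc (a := (0 : ℝ)) (b := 1)).prod hKc).exists_bound_of_continuousOn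
    (hR.contDiff (hcs K)).continuous.continuousOn
  set G : ℝ × E n → ℂ := fun z => ∑ k ∈ Finset.range K, ((z.1 ^ k : ℝ) : ℂ) * c (k + 1) z with hG
  have hGc : Continuous G := (ContDiff.sum fun k _ => (contDiff_param_pow k).mul (hcs (k + 1))).continuous
  obtain ⟨C₃, hC₃⟩ := ((isCompact_Icc (a := (0 : ℝ)) (b := 1)).prod hKc).exists_bound_of_continuousOn
    hGc.continuousOn
  have hW0 : ∀ s, ∀ y ∉ cylinder n t₁ t₂, W (s, y) = 0 := by
    intro s y hy
    have hev : a =ᶠ[nhds (s, y)] fun _ => 0 := by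
      have : IsOpen {z : ℝ × E n | z.2 ∉ cylinder n t₁ t₂} :=
        hKc.isClosed.isOpen_compl.preimage continuous_snd
      filter_upwards [this.mem_nhds hy] with z hz using ha0 z.1 z.2 hz
    simp only [hW]
    rw [hR.eq_zero_of_eventually hev, (IsDiffOp.deriv _).eq_zero_of_eventually hev, mul_zero, mul_zero,
      add_zero]
  refine ⟨a, has, ha0, ⟨|C₁| + |C₂|, by positivity, fun s hs y => ⟨hW0 s y, ?_, fun hy => ?_⟩⟩,
    min s₁ (1 / (2 * (|C₃| + 1))), ⟨lt_min hs₁.1 (by positivity), min_le_left _ _⟩, fun s hs y hy hy2 => ?_⟩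
  · change ‖W (s, y)‖ ≤ _
    by_cases hyK : y ∈ cylinder n t₁ t₂
    · have := hC₁ (s, y) ⟨⟨hs.1, hs.2.trans hs₁.2⟩, hyK⟩
      have := le_abs_self C₁
      have := abs_nonneg C₂
      linarith
    · rw [hW0 s y hyK, norm_zero]
      positivity
  · change ‖W (s, y)‖ ≤ _
    have := hs.1
    by_cases hyK : y ∈ cylinder n t₁ t₂
    · have hev : a =ᶠ[nhds (s, y)] a' := by
        have : IsOpen {z : ℝ × E n | z.2.fst ∈ Ioo (t₁ + ρ / 2) (t₂ - ρ / 2)} :=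
          isOpen_Ioo.preimage (contDiff_fst_E.continuous.comp continuous_snd)
        have hm : y.fst ∈ Ioo (t₁ + ρ / 2) (t₂ - ρ / 2) :=
          ⟨by linarith [hy.1], by linarith [hy.2]⟩
        filter_upwards [this.mem_nhds hm] with z hz
        simp only [ha]
        rw [hχ1 _ ⟨by linarith [hz.1], by linarith [hz.2]⟩, Complex.ofReal_one, one_mul]
      simp only [hW]
      rw [(hR.congr hev).eq_of_nhds, ((IsDiffOp.deriv (pt 1 0)).congr hev).eq_of_nhds,
        transport_sum hR hκ hc₀s hc₀d K (hQκ s hs y hyK.1), norm_mul, Complex.norm_real,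
        Real.norm_of_nonneg (by positivity), mul_comm]
      gcongr
      have := hC₂ (s, y) ⟨⟨hs.1, hs.2.trans hs₁.2⟩, hyK⟩
      have := le_abs_self C₂
      have := abs_nonneg C₁
      linarith
    · rw [hW0 s y hyK, norm_zero]
      positivity
  · have hyK : y ∈ cylinder n t₁ t₂ := ⟨⟨by linarith [hy.1], by linarith [hy.2]⟩, by linarith⟩
    -- The leading coefficient equals one here and all others carry a factor $s$. The choice of `s₂`
    -- keeps their sum below one half.
    have h1 : a (s, y) = 1 + (s : ℂ) * G (s, y) := by
      simp only [ha, ha', hG]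
      rw [hχ1 _ ⟨by linarith [hy.1], by linarith [hy.2]⟩, Complex.ofReal_one, one_mul,
        Finset.sum_range_succ', Finset.mul_sum, add_comm]
      congr 1
      · have : c 0 (s, y) = 1 := by
          change ((β y.snd : ℝ) : ℂ) = 1
          rw [β.one_of_mem_closedBall (by rw [mem_closedBall_zero_iff]; exact hy2), Complex.ofReal_one]
        simp [this]
      · refine Finset.sum_congr rfl fun k _ => ?_
        push_cast
        ring
    have hs2 : s ≤ 1 / (2 * (|C₃| + 1)) := hs.2.trans (min_le_right _ _)
    have hs1 : s ≤ 1 := (hs.2.trans (min_le_left _ _)).trans hs₁.2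
    have h2 : ‖(s : ℂ) * G (s, y)‖ ≤ 1 / 2 := by
      rw [norm_mul, Complex.norm_real, Real.norm_of_nonneg hs.1]
      have h3 := hC₃ (s, y) ⟨⟨hs.1, hs1⟩, hyK⟩
      have h4 := le_abs_self C₃
      calc s * ‖G (s, y)‖ ≤ 1 / (2 * (|C₃| + 1)) * (|C₃| + 1) := by
            have := hs.1
            gcongr
            linarith
        _ = 1 / 2 := by field_simp
    have h5 : ‖(1 : ℂ)‖ ≤ ‖1 + (s : ℂ) * G (s, y)‖ + ‖(s : ℂ) * G (s, y)‖ := by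
      have := norm_sub_le (1 + (s : ℂ) * G (s, y)) ((s : ℂ) * G (s, y))
      simpa using this
    rw [norm_one] at h5
    rw [h1]
    linarith

end Amplitude

/-! ### Assembly and normalization of the quasimodes. -/

section Quasimodes

variable {n : ℕ}

/-- The ball of radius $s^2$ has volume proportional to $s^{2\dim}$, and the $L^2$ norm takes the
square root. -/
theorem exists_le_eLpNorm (n : ℕ) : ∃ c > 0, ∀ s > 0, ∀ κ ≥ 0, ∀ (y₀ : E n) (f : E n → ℂ),
    (∀ y ∈ Metric.closedBall y₀ (s ^ 2), κ ≤ ‖f y‖) →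
    ENNReal.ofReal (c * κ * s ^ Module.finrank ℝ (E n)) ≤ eLpNorm f 2 volume := by
  set v := (volume (Metric.ball (0 : E n) 1)).toReal with hv
  have hv0 : 0 < v := ENNReal.toReal_pos (Metric.measure_ball_pos _ _ one_pos).ne' measure_ball_lt_top.ne
  refine ⟨Real.sqrt v, Real.sqrt_pos.2 hv0, fun s hs κ hκ y₀ f hf => ?_⟩
  have h1 : eLpNorm ((Metric.closedBall y₀ (s ^ 2)).indicator fun _ => κ) 2 volume ≤ eLpNorm f 2 volume := by
    refine eLpNorm_mono fun y => ?_
    by_cases hy : y ∈ Metric.closedBall y₀ (s ^ 2)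
    · rw [indicator_of_mem hy, Real.norm_of_nonneg hκ]
      exact hf y hy
    · rw [indicator_of_notMem hy, norm_zero]
      exact norm_nonneg _
  refine le_trans (le_of_eq ?_) h1
  have h2 : volume (Metric.closedBall y₀ (s ^ 2)) =
      ENNReal.ofReal (v * (s ^ Module.finrank ℝ (E n)) ^ 2) := by
    rw [Measure.addHaar_closedBall volume y₀ (by positivity : 0 ≤ s ^ 2), mul_comm,
      ENNReal.ofReal_mul hv0.le, hv, ENNReal.ofReal_toReal measure_ball_lt_top.ne, ← pow_mul, ← pow_mul,
      mul_comm 2]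
  rw [eLpNorm_indicator_const Metric.isClosed_closedBall.measurableSet (by norm_num) (by norm_num), h2,
    ENNReal.ofReal_rpow_of_nonneg (by positivity) (by positivity), Real.enorm_of_nonneg hκ,
    ← ENNReal.ofReal_mul hκ]
  congr 1
  have h3 : (v * (s ^ Module.finrank ℝ (E n)) ^ 2) ^ (1 / ENNReal.toReal 2) =
      Real.sqrt v * s ^ Module.finrank ℝ (E n) := by
    rw [ENNReal.toReal_ofNat, ← Real.sqrt_eq_rpow, Real.sqrt_mul hv0.le, Real.sqrt_sq (by positivity)]
  rw [h3]
  ring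

theorem norm_wkb (φ : ℝ × E n → ℂ) (m s : ℝ) (a : ℝ × E n → ℂ) (y : E n) :
    ‖wkb φ (m : ℂ) s a y‖ = Real.exp ((s ^ 2)⁻¹ * (φ (s, y)).re - m) * ‖a (s, y)‖ := by
  rw [wkb, norm_mul, Complex.norm_exp, Complex.sub_re, Complex.re_ofReal_mul, Complex.ofReal_re]

theorem exp_neg_inv_sq_le {c : ℝ} (hc : 0 < c) (N : ℕ) {s : ℝ} (hs : s ∈ Ioc (0 : ℝ) 1) :
    Real.exp (-((s ^ 2)⁻¹ * c)) ≤ N.factorial / c ^ N * s ^ N := by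
  have hs0 := hs.1
  have h1 := Real.pow_div_factorial_le_exp ((s ^ 2)⁻¹ * c) (by positivity) N
  rw [Real.exp_neg, inv_le_comm₀ (Real.exp_pos _) (by positivity)]
  refine le_trans ?_ h1
  rw [mul_inv, inv_div, mul_pow, inv_pow]
  have h2 : (s ^ N)⁻¹ ≤ ((s ^ 2) ^ N)⁻¹ := by
    refine inv_anti₀ (by positivity) (pow_le_pow_left₀ (by positivity) ?_ N)
    exact pow_le_of_le_one hs0.le hs.2 two_ne_zero
  calc c ^ N / N.factorial * (s ^ N)⁻¹ ≤ c ^ N / N.factorial * ((s ^ 2) ^ N)⁻¹ := by gcongr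
    _ = _ := by ring

/-- Quasimodes of the conjugated operator, for `β = 1/7` and `h = s⁷`. -/
theorem exists_conjP_quasimode {q : Fin n → Fin n → E n → X n → ℝ} {b : E n → E n → ℂ}
    (hq : ∀ j k, IsSymbol 0 (q j k)) (hb : IsSymbol 1 b) (ξ : X n) {t₁ t₂ : ℝ} (ht : t₁ < t₂)
    (hq0 : ∀ t ∈ Icc t₁ t₂, q0 q ξ t ≠ 0) (h₁ : 0 < (b (pt t₁ 0) (pt 0 0)).im / q0 q ξ t₁)
    (h₂ : (b (pt t₂ 0) (pt 0 0)).im / q0 q ξ t₂ < 0) (N : ℕ) :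
    ∃ C : ℝ, ∃ s₀ > 0, ∀ s ∈ Ioo 0 s₀, ∃ A : E n → ℂ, ContDiff ℝ ∞ A ∧
      tsupport A ⊆ cylinder n t₁ t₂ ∧ eLpNorm A 2 volume ≠ 0 ∧ eLpNorm A 2 volume ≠ ⊤ ∧
      eLpNorm (conjP q b (1 / 7) ξ (s ^ 7) A) 2 volume ≤
        ENNReal.ofReal (C * s ^ (7 * N)) * eLpNorm A 2 volume := by
  obtain ⟨κ, φ, hκ, hφ, hφ0, s₁, hs₁, ρ, hρ, c, hc, Cφ, hCφ, hρt, hqκ, T, m, hTm⟩ :=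
    exists_phase hq hb ξ ht hq0 h₁ h₂
  set d := Module.finrank ℝ (E n) with hd
  -- Here $h^N=s^{7N}$, and the extra `d` pays for a norm that is only bounded below by $s^d$. Then
  -- `M` is chosen so that $3(M+1)=2k+N'$: the Taylor remainder gains $s^{3(M+1)}$, the `k`
  -- derivatives cost $s^{-2k}$, and `k` grows with `M` at rate one.
  set N' := 7 * N + d with hN'
  set M := N' + 2 * d + 9 with hM
  set k := d + 2 + (M + 1) + 1 + 1 + 1 with hk
  obtain ⟨R, hR, hRe⟩ := exists_isDiffOp_conjExpansion (fun j k => isSymbol_liftSymbol (hq j k)) hb ξ M hφ hφ0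
  have hQ : ContDiff ℝ ∞ fun z : ℝ × E n => (qCurve q ξ (z.1, z.2.fst) : ℂ) :=
    Complex.ofRealCLM.contDiff.comp ((contDiff_qCurve hq ξ).comp
      (contDiff_fst.prodMk (contDiff_fst_E.comp contDiff_snd)))
  obtain ⟨a, ha, ha0, ⟨Ca, hCa0, hCa⟩, s₂, hs₂, hlow⟩ := exists_amplitude hR hκ hQ hρ hρt hs₁
    (fun s hs y hy => (hqκ s hs y hy).1) N'
  obtain ⟨R₀, hR₀⟩ := (isCompact_cylinder (n := n) t₁ t₂).isBounded.subset_closedBall 0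
  obtain ⟨Cw, hCw0, hCw⟩ := exists_ckBound_wkb hφ ha (isCompact_cylinder t₁ t₂) hR₀ ha0 k
  obtain ⟨Cr, hCr0, hCr⟩ := exists_conjP_sub_conjExpansion_le hq hb ξ R₀ M (d + 1)
  obtain ⟨CL, hCL0, hCL⟩ := exists_eLpNorm_le n
  obtain ⟨cL, hcL0, hcL⟩ := exists_le_eLpNorm n
  set Ce := 1 + N'.factorial / c ^ N' with hCe
  set B := Ca * Ce * (1 + |R₀|) ^ (d + 1) + Cr * Cw with hB
  have hB0 : 0 ≤ B := by positivity
  set e₀ := Real.exp (-Cφ) / 2 with he₀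
  have he₀0 : 0 < e₀ := by positivity
  refine ⟨CL * B / (cL * e₀), min s₂ (min (1 / 2) (ρ / 2)), lt_min hs₂.1 (lt_min (by norm_num) (by linarith)),
    fun s hs => ?_⟩
  have hs0 : 0 < s := hs.1
  have hss₂ : s ≤ s₂ := hs.2.le.trans (min_le_left _ _)
  have hss₁ : s ≤ s₁ := hss₂.trans hs₂.2
  have hs1 : s ≤ 1 := hss₁.trans hs₁.2
  have hs12 : s ≤ 1 / 2 := hs.2.le.trans ((min_le_right _ _).trans (min_le_left _ _))
  have hsρ : s ≤ ρ / 2 := hs.2.le.trans ((min_le_right _ _).trans (min_le_right _ _))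
  have hssq : s ^ 2 ≤ s := pow_le_of_le_one hs0.le hs1 two_ne_zero
  have hsI : s ∈ Icc 0 s₁ := ⟨hs0.le, hss₁⟩
  have hsI1 : s ∈ Ioc (0 : ℝ) 1 := ⟨hs0, hs1⟩
  obtain ⟨hT, hTy⟩ := hTm s hsI
  -- Subtracting the scaled maximum of $\operatorname{Re}\varphi$ makes the exponential at most one
  -- on the cylinder and comparable to one near $t=T(s)$.
  set μ := (s ^ 2)⁻¹ * m s with hμ
  set A := wkb φ (μ : ℂ) s a with hA
  have hre : ∀ y : E n, (s ^ 2)⁻¹ * (φ (s, y)).re - μ = (s ^ 2)⁻¹ * ((φ (s, y)).re - m s) := fun y => by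
    rw [hμ]; ring
  have hsinv : 0 < (s ^ 2)⁻¹ := by positivity
  have hre0 : ∀ y ∈ cylinder n t₁ t₂, (s ^ 2)⁻¹ * (φ (s, y)).re - μ ≤ 0 := fun y hy => by
    rw [hre]
    exact mul_nonpos_of_nonneg_of_nonpos hsinv.le (sub_nonpos.2 (hTy y hy.1).1)
  have hAck := hCw s hsI1 μ hre0
  have hAs : tsupport A ⊆ cylinder n t₁ t₂ := by
    refine closure_minimal (fun y hy => ?_) (isCompact_cylinder t₁ t₂).isClosed
    by_contra h
    exact hy (by rw [hA, wkb, ha0 s y h, mul_zero])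
  have hAcs : HasCompactSupport A := hAck.hasCompactSupport
  have hmain : ∀ y, ‖conjExpansion q b ξ M s A y‖ ≤
      Ca * Ce * (1 + |R₀|) ^ (d + 1) * s ^ N' * ((1 + ‖y‖) ^ (d + 1))⁻¹ := by
    intro y
    have hz : ((qCurve q ξ (s, y.fst) : ℂ) * famD (pt 1 0) φ (s, y) + symFam ξ b (s, y)) * a (s, y) = 0 := by
      by_cases hy : y ∈ cylinder n t₁ t₂
      · rw [(hqκ s hsI y hy.1).2, zero_mul]
      · rw [ha0 s y hy, mul_zero]
    have hz' : wkb φ (μ : ℂ) s (fun z => ((qCurve q ξ (z.1, z.2.fst) : ℂ) * famD (pt 1 0) φ z +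
        symFam ξ b z) * a z) y = 0 := by
      rw [wkb, hz, mul_zero]
    rw [hA, hRe s hs0.ne' _ a ha y, hz', mul_zero, add_zero, norm_mul, Complex.norm_real, norm_wkb,
      Real.norm_of_nonneg (by positivity)]
    beta_reduce
    obtain ⟨w1, w2, w3⟩ := hCa s hsI y
    set W := (qCurve q ξ (s, y.fst) : ℂ) * famD (pt 1 0) a (s, y) + (s : ℂ) * R a (s, y)
    by_cases hy : y ∈ cylinder n t₁ t₂
    · have hyR : ‖y‖ ≤ |R₀| := (mem_closedBall_zero_iff.1 (hR₀ hy)).trans (le_abs_self _)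
      have hkey : Real.exp ((s ^ 2)⁻¹ * (φ (s, y)).re - μ) * ‖W‖ ≤ Ca * Ce * s ^ N' := by
        -- Inside, the transport equation holds up to $s^{N'+1}$. Near the ends it fails, but the
        -- phase lies below its maximum by `c`, and $e^{-c/s^2}$ is smaller than any power of $s$.
        by_cases hyin : y.fst ∈ Icc (t₁ + ρ) (t₂ - ρ)
        · have h1 : Real.exp ((s ^ 2)⁻¹ * (φ (s, y)).re - μ) ≤ 1 := Real.exp_le_one_iff.2 (hre0 y hy)
          refine (mul_le_of_le_one_left (norm_nonneg _) h1).trans ((w3 hyin).trans ?_)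
          have h2 : s ^ (N' + 1) ≤ s ^ N' := pow_le_pow_of_le_one hs0.le hs1 (Nat.le_succ _)
          have h3 : 1 ≤ Ce := by
            rw [hCe]
            have : 0 ≤ N'.factorial / c ^ N' := by positivity
            linarith
          calc Ca * s ^ (N' + 1) ≤ Ca * s ^ N' := by gcongr
            _ ≤ Ca * Ce * s ^ N' := by
              gcongr
              exact le_mul_of_one_le_right hCa0 h3
        · have h1 : Real.exp ((s ^ 2)⁻¹ * (φ (s, y)).re - μ) ≤ N'.factorial / c ^ N' * s ^ N' := by
            refine le_trans (Real.exp_le_exp.2 ?_) (exp_neg_inv_sq_le hc N' hsI1)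
            rw [hre, ← mul_neg]
            have := (hTy y hy.1).2.1 hyin
            gcongr
            linarith
          calc _ ≤ N'.factorial / c ^ N' * s ^ N' * Ca := by gcongr
            _ ≤ Ce * s ^ N' * Ca := by
              gcongr
              rw [hCe]
              linarith
            _ = _ := by ring
      have h9 : s ^ 9 ≤ 1 := pow_le_one₀ hs0.le hs1
      refine (mul_le_of_le_one_left (by positivity) h9).trans (hkey.trans ?_)
      rw [← div_eq_mul_inv, le_div_iff₀ (by positivity)]
      calc Ca * Ce * s ^ N' * (1 + ‖y‖) ^ (d + 1) ≤ Ca * Ce * s ^ N' * (1 + |R₀|) ^ (d + 1) := by gcongr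
        _ = _ := by ring
    · rw [w1 hy, norm_zero, mul_zero, mul_zero]
      positivity
  -- The conjugated operator is nonlocal, so this remainder need not have compact support; the
  -- weight makes it square integrable.
  have hrem : ∀ y, ‖conjP q b (1 / 7) ξ (s ^ 7) A y - conjExpansion q b ξ M s A y‖ ≤
      Cr * Cw * s ^ N' * ((1 + ‖y‖) ^ (d + 1))⁻¹ := by
    intro y
    refine (hCr s hsI1 _ A hAck y).trans_eq ?_
    have h1 : ((s ^ 2)⁻¹) ^ k * s ^ (3 * (M + 1)) = s ^ N' := by
      have : 3 * (M + 1) = 2 * k + N' := by omega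
      rw [this, pow_add s (2 * k), pow_mul s 2 k, inv_pow, inv_mul_cancel_left₀ (by positivity)]
    rw [← h1]
    ring
  have hconj : eLpNorm (conjP q b (1 / 7) ξ (s ^ 7) A) 2 volume ≤ ENNReal.ofReal (CL * (B * s ^ N')) := by
    refine hCL _ (by positivity) _ fun y => ?_
    have h1 := norm_add_le (conjP q b (1 / 7) ξ (s ^ 7) A y - conjExpansion q b ξ M s A y)
      (conjExpansion q b ξ M s A y)
    rw [sub_add_cancel] at h1
    refine h1.trans ((add_le_add (hrem y) (hmain y)).trans_eq ?_)
    rw [hB]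
    ring
  -- Within distance $s^2$ of $(T(s),0)$ the Lipschitz bound for $\operatorname{Re}\varphi$ costs at
  -- most `Cφ` in the exponent, and the amplitude is at least one half.
  have hlower : ENNReal.ofReal (cL * e₀ * s ^ d) ≤ eLpNorm A 2 volume := by
    refine hcL s hs0 e₀ he₀0.le (pt (T s) 0) A fun y hy => ?_
    rw [Metric.mem_closedBall, dist_eq_norm] at hy
    have hf : |y.fst - T s| ≤ s ^ 2 := (norm_fst_le (y - pt (T s) 0)).trans hy
    have hx : ‖y.snd‖ ≤ s ^ 2 := by
      have := (norm_snd_le (y - pt (T s) 0)).trans hy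
      simpa using this
    have hf' := abs_le.1 hf
    have hyt : y.fst ∈ Icc (t₁ + ρ / 2) (t₂ - ρ / 2) := by
      constructor <;> linarith [hT.1, hT.2]
    have hyI : y.fst ∈ Icc t₁ t₂ := ⟨by linarith [hyt.1], by linarith [hyt.2]⟩
    have h1 := hlow s ⟨hs0.le, hss₂⟩ y hyt (by linarith)
    have h2 := (hTy y hyI).2.2
    rw [hA, norm_wkb, he₀, div_eq_mul_one_div]
    refine mul_le_mul (Real.exp_le_exp.2 ?_) h1 (by norm_num) (Real.exp_pos _).le
    rw [hre]
    have h3 : -(Cφ * s ^ 2) ≤ (φ (s, y)).re - m s := by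
      have : Cφ * |y.fst - T s| ≤ Cφ * s ^ 2 := by gcongr
      linarith
    calc -Cφ = (s ^ 2)⁻¹ * (-(Cφ * s ^ 2)) := by field_simp
      _ ≤ _ := by gcongr
  refine ⟨A, hAck.smooth, hAs, ?_, ?_, hconj.trans ?_⟩
  · refine (lt_of_lt_of_le (ENNReal.ofReal_pos.2 ?_) hlower).ne'
    positivity
  · exact (hAck.smooth.continuous.memLp_of_hasCompactSupport hAcs).eLpNorm_ne_top
  · refine le_trans (le_of_eq ?_) (mul_le_mul_right hlower _)
    rw [← ENNReal.ofReal_mul (by positivity)]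
    congr 1
    rw [hN', pow_add]
    field_simp

theorem opP_const_mul (q : Fin n → Fin n → E n → X n → ℝ) (b : E n → E n → ℂ) (h : ℝ) (c : ℂ)
    (u : E n → ℂ) (y : E n) : opP q b h (fun z => c * u z) y = c * opP q b h u y := by
  simp only [opP, opH, fourier_const_mul, ← integral_const_mul]
  exact integral_congr_ae (.of_forall fun ζ => by ring)

theorem contDiff_dil (r : ℝ) : ContDiff ℝ ∞ (dil r : E n → E n) :=
  contDiff_pt contDiff_fst_E (contDiff_snd_E.const_smul r)

theorem contDiff_osc (α : ℝ) (ξ : X n) (h : ℝ) : ContDiff ℝ ∞ (osc α ξ h : E n → ℂ) :=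
  (contDiff_const.mul (Complex.ofRealCLM.contDiff.comp
    ((contDiff_snd_E.inner ℝ contDiff_const).div_const _))).cexp

/-- Multiplication by `osc` preserves the modulus and a dilation multiplies all $L^2$ norms by the
same factor, so the quotient of norms is that of the conjugated operator. The dilation by $h^{3/7}$
shrinks the unit ball in $x$ into $|x|\le\varepsilon$. -/
theorem exists_quasimodes {q : Fin n → Fin n → E n → X n → ℝ} {b : E n → E n → ℂ}
    (hq : ∀ j k, IsSymbol 0 (q j k)) (hb : IsSymbol 1 b) (ξ : X n) {t₁ t₂ : ℝ} (ht : t₁ < t₂)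
    (hq0 : ∀ t ∈ Icc t₁ t₂, q0 q ξ t ≠ 0) (h₁ : 0 < (b (pt t₁ 0) (pt 0 0)).im / q0 q ξ t₁)
    (h₂ : (b (pt t₂ 0) (pt 0 0)).im / q0 q ξ t₂ < 0) {ε : ℝ} (hε : 0 < ε) (N : ℕ) :
    ∃ C : ℝ, ∃ h₀ > 0, ∃ u : ℝ → E n → ℂ, ∀ h ∈ Ioo (0 : ℝ) h₀,
      ContDiff ℝ ∞ (u h) ∧ tsupport (u h) ⊆ {y | y.fst ∈ Icc t₁ t₂ ∧ ‖y.snd‖ ≤ ε} ∧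
      eLpNorm (u h) 2 volume = 1 ∧
      eLpNorm (opP q b h (u h)) 2 volume ≤ ENNReal.ofReal (C * h ^ N) := by
  obtain ⟨C, s₀, hs₀, hC⟩ := exists_conjP_quasimode hq hb ξ ht hq0 h₁ h₂ N
  -- The range of $h$ is a premise inside the existential, so that `choose` yields a family defined
  -- for all $h$; outside the range its value is immaterial.
  suffices H : ∀ h, ∃ u : E n → ℂ, h ∈ Ioo (0 : ℝ) ((min s₀ (min 1 ε)) ^ 7) →
      ContDiff ℝ ∞ u ∧ tsupport u ⊆ {y | y.fst ∈ Icc t₁ t₂ ∧ ‖y.snd‖ ≤ ε} ∧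
      eLpNorm u 2 volume = 1 ∧ eLpNorm (opP q b h u) 2 volume ≤ ENNReal.ofReal (C * h ^ N) by
    choose u hu using H
    exact ⟨C, _, pow_pos (lt_min hs₀ (lt_min one_pos hε)) 7, u, hu⟩
  intro h
  by_cases hh : h ∈ Ioo (0 : ℝ) ((min s₀ (min 1 ε)) ^ 7)
  swap
  · exact ⟨0, fun h' => absurd h' hh⟩
  have hs_pos : 0 < h ^ (1 / 7 : ℝ) := Real.rpow_pos_of_pos hh.1 _
  obtain ⟨s, hs0, rfl⟩ : ∃ s : ℝ, 0 < s ∧ s ^ 7 = h := by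
    refine ⟨h ^ (1 / 7 : ℝ), hs_pos, ?_⟩
    rw [← Real.rpow_natCast, ← Real.rpow_mul hh.1.le]
    norm_num
  have hs : s < min s₀ (min 1 ε) :=
    lt_of_pow_lt_pow_left₀ 7 (lt_min hs₀ (lt_min one_pos hε)).le hh.2
  have hs1 : s ≤ 1 := hs.le.trans ((min_le_right _ _).trans (min_le_left _ _))
  have hsε : s ≤ ε := hs.le.trans ((min_le_right _ _).trans (min_le_right _ _))
  obtain ⟨A, hA, hAs, hA0, hAt, hAe⟩ := hC s ⟨hs0, hs.trans_le (min_le_left _ _)⟩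
  set r := (s ^ 7) ^ (3 * (1 / 7) : ℝ) with hr
  have hr3 : r = s ^ 3 := rpow_seventh hs0 (by norm_num)
  have hr0 : 0 < r := Real.rpow_pos_of_pos hh.1 _
  have hrε : r ≤ ε := by
    rw [hr3]
    exact (pow_le_of_le_one hs0.le hs1 (by norm_num)).trans hsε
  have hrn : (s ^ 7) ^ (-(3 * (1 / 7)) : ℝ) = r⁻¹ := Real.rpow_neg hh.1.le _
  set o := osc (1 - 4 * (1 / 7)) ξ (s ^ 7) with ho
  set u₀ : E n → ℂ := fun z => o (dil r⁻¹ z) * A (dil r⁻¹ z) with hu₀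
  have hu₀s : ContDiff ℝ ∞ u₀ := ((contDiff_osc _ ξ _).mul hA).comp (contDiff_dil r⁻¹)
  obtain ⟨c, hc0, hct, hc⟩ := exists_eLpNorm_dil (n := n) hr0.ne'
  have e1 : eLpNorm A 2 volume = c * eLpNorm u₀ 2 volume := by
    rw [← hc u₀]
    refine eLpNorm_congr_norm_ae (.of_forall fun y => ?_)
    simp only [hu₀, dil_inv_dil hr0.ne']
    rw [norm_mul, ho, norm_osc, one_mul]
  have e2 : eLpNorm (conjP q b (1 / 7) ξ (s ^ 7) A) 2 volume = c * eLpNorm (opP q b (s ^ 7) u₀) 2 volume := by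
    rw [← hc (opP q b (s ^ 7) u₀)]
    refine eLpNorm_congr_norm_ae (.of_forall fun y => ?_)
    rw [conjP, norm_mul, norm_inv, norm_osc, inv_one, one_mul, scaledP, hrn]
  rw [e1, e2, mul_left_comm, ENNReal.mul_le_mul_iff_right hc0 hct] at hAe
  rw [e1] at hA0 hAt
  have hν0 : eLpNorm u₀ 2 volume ≠ 0 := right_ne_zero_of_mul hA0
  have hνt : eLpNorm u₀ 2 volume ≠ ⊤ := fun h => hAt (by rw [h, ENNReal.mul_top hc0])
  set ν := (eLpNorm u₀ 2 volume).toReal with hν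
  have hνpos : 0 < ν := ENNReal.toReal_pos hν0 hνt
  have hνe : ‖((ν⁻¹ : ℝ) : ℂ)‖ₑ = (eLpNorm u₀ 2 volume)⁻¹ := by
    rw [← ofReal_norm, Complex.norm_real, Real.norm_of_nonneg (by positivity),
      ENNReal.ofReal_inv_of_pos hνpos, hν, ENNReal.ofReal_toReal hνt]
  have hmul : ∀ f : E n → ℂ, eLpNorm (fun z => ((ν⁻¹ : ℝ) : ℂ) * f z) 2 volume =
      (eLpNorm u₀ 2 volume)⁻¹ * eLpNorm f 2 volume := fun f => by
    rw [← hνe, ← eLpNorm_const_smul]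
    rfl
  refine ⟨fun z => ((ν⁻¹ : ℝ) : ℂ) * u₀ z, fun _ => ⟨contDiff_const.mul hu₀s, ?_, ?_, ?_⟩⟩
  · have hcl : IsClosed {y : E n | y.fst ∈ Icc t₁ t₂ ∧ ‖y.snd‖ ≤ ε} :=
      (isClosed_Icc.preimage contDiff_fst_E.continuous).inter
        (isClosed_le contDiff_snd_E.continuous.norm continuous_const)
    refine closure_minimal (fun y hy => ?_) hcl
    have hy' : dil r⁻¹ y ∈ cylinder n t₁ t₂ := by
      by_contra h
      refine hy ?_
      simp only [hu₀]
      rw [image_eq_zero_of_notMem_tsupport (fun h' => h (hAs h')), mul_zero, mul_zero]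
    refine ⟨hy'.1, ?_⟩
    have h3 : ‖r⁻¹ • y.snd‖ ≤ 1 := hy'.2
    rw [norm_smul, Real.norm_of_nonneg (by positivity), inv_mul_le_iff₀ hr0, mul_one] at h3
    exact h3.trans hrε
  · rw [hmul, ENNReal.inv_mul_cancel hν0 hνt]
  · have : opP q b (s ^ 7) (fun z => ((ν⁻¹ : ℝ) : ℂ) * u₀ z) =
        fun y => ((ν⁻¹ : ℝ) : ℂ) * opP q b (s ^ 7) u₀ y := funext (opP_const_mul q b _ _ u₀)
    rw [this, hmul, ← pow_mul]
    refine (mul_le_mul_right hAe _).trans_eq ?_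
    rw [mul_left_comm, ENNReal.inv_mul_cancel hν0 hνt, mul_one]

end Quasimodes

end

end TangentialQuasimode

theorem proposition3p3 {n : ℕ} (hn : 0 < n)
    (q : Fin n → Fin n → E n → X n → ℝ) (b : E n → E n → ℂ)
    (hq : ∀ j k, IsSymbol 0 (q j k)) (hsymm : ∀ j k y ξ, q j k y ξ = q k j y ξ)
    (hnondeg : (Matrix.of fun j k => q j k (pt 0 0) 0).det ≠ 0)
    (hb : IsSymbol 1 b) :
    -- non-degeneracy provides covectors for which `q₀` has no zero near `t = 0`
    (∃ ξ : X n, ∃ δ > 0, ∀ t ∈ Icc (-δ) δ, q0 q ξ t ≠ 0) ∧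
    -- the transport system: the conjugated operator is `h^{1+2β} (transport + O(h^β))`
    (∀ β : ℝ, 0 < β → β ≤ 1 / 6 → ∀ (ξ : X n) (a : ℝ → E n → ℂ), BoundedFamily a →
      ∃ C : ℝ, ∀ h ∈ Ioc (0 : ℝ) 1,
        (∀ y, ‖conjP q b β ξ h (a h) y - ((h ^ (1 + 2 * β) : ℝ) : ℂ) * transport q b β ξ h (a h) y‖
          ≤ C * (h ^ (1 + 2 * β) * h ^ β)) ∧
        eLpNorm (fun y => conjP q b β ξ h (a h) y
            - ((h ^ (1 + 2 * β) : ℝ) : ℂ) * transport q b β ξ h (a h) y) 2 volume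
          ≤ ENNReal.ofReal (C * (h ^ (1 + 2 * β) * h ^ β))) ∧
    -- the solution formula: it solves the first transport equation exactly and the whole
    -- transport equation modulo `O(h^β)`
    (∀ β : ℝ, 0 < β → β ≤ 1 / 7 → ∀ (ξ : X n) (t₁ t₂ : ℝ), (∀ t ∈ Icc t₁ t₂, q0 q ξ t ≠ 0) →
      ∀ t₀ ∈ Icc t₁ t₂, ∀ φ : X n → ℂ, ContDiff ℝ ∞ φ → HasCompactSupport φ →
      ∃ C : ℝ, ∀ h ∈ Ioc (0 : ℝ) 1, ∀ y : E n, y.fst ∈ Ioo t₁ t₂ →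
        let a : E n → ℂ := fun z => φ z.snd * expFactor q b β ξ t₀ h z.fst
        ((h ^ (-2 * β) : ℝ) : ℂ) * bh b β ξ h y.fst * a y + (q0 q ξ y.fst : ℂ) * Dt a y = 0 ∧
        ‖transport q b β ξ h a y‖ ≤ C * h ^ β * ‖expFactor q b β ξ t₀ h y.fst‖) ∧
    -- quasimodes of infinite order, when the imaginary part of `b` changes sign on the line
    -- `x = 0`, `τ = 0`, `ξ = 0`
    (∀ (ξ : X n) (t₁ t₂ : ℝ), t₁ < t₂ → (∀ t ∈ Icc t₁ t₂, q0 q ξ t ≠ 0) →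
      0 < (b (pt t₁ 0) (pt 0 0)).im / q0 q ξ t₁ → (b (pt t₂ 0) (pt 0 0)).im / q0 q ξ t₂ < 0 →
      ∀ ε > 0, ∀ N : ℕ, ∃ C : ℝ, ∃ h₀ > 0, ∃ u : ℝ → E n → ℂ, ∀ h ∈ Ioo (0 : ℝ) h₀,
        ContDiff ℝ ∞ (u h) ∧ tsupport (u h) ⊆ {y | y.fst ∈ Icc t₁ t₂ ∧ ‖y.snd‖ ≤ ε} ∧
        eLpNorm (u h) 2 volume = 1 ∧
        eLpNorm (opP q b h (u h)) 2 volume ≤ ENNReal.ofReal (C * h ^ N)) := by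
  refine ⟨exists_q0_ne_zero_near hn q hq hsymm hnondeg, ?_, ?_, ?_⟩
  · intro β hβ hβ' ξ a ha
    exact conjP_transport_bounds hq hsymm hb hβ hβ' ξ ha
  · intro β hβ hβ' ξ t₁ t₂ hq0 t₀ ht₀ φ hφ hφc
    exact solution_formula hq hb hβ hβ' ξ hq0 ht₀ hφ hφc
  · intro ξ t₁ t₂ ht hq0 h₁ h₂ ε hε N
    exact exists_quasimodes hq hb ξ ht hq0 h₁ h₂ hε N
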